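/- Let $\mathfrak{sl}_2=\mathfrak{sl}_2(\mathbb{C})$ with basis $x,y,h$, $[x,y]=h$, $[h,x]=2x$, $[h,y]=-2y$, and dual basis $x',y',h'$. Vertex algebras are realized as spaces of mutually quantum commuting (local) fields $a(z)=\sum_{n\in\mathbb{Z}}a(n)z^{-n-1}$ on a complex vector space that contain $1$ and are closed under all circle products ($n$-th products) $\circ_n$, $n\in\mathbb{Z}$; write $:ab:\ =a\circ_{-1}b$ for the Wick product and $\partial=d/dz$. Let $\mathcal{S}=\mathcal{S}(\mathfrak{sl}_2)$ be the $\beta\gamma$ system, that is, the vertex algebra generated by the even fields $\beta^{\xi},\gamma^{\xi'}$ (linear in $\xi\in\mathfrak{sl}_2$, $\xi'\in\mathfrak{sl}_2^*$) with $\beta^{\xi}(z)\gamma^{\xi'}(w)\sim\langle\xi',\xi\rangle(z-w)^{-1}$, $\beta^\xi(z)\beta^\eta(w)\sim 0$, $\gamma^{\xi'}(z)\gamma^{\eta'}(w)\sim0$, acting on its Fock space. Let $\Theta_{\mathcal{S}}\subset\mathcal{S}$ be the vertex subalgebra generated by the fields $$\Theta_{\mathcal S}^{\xi}=-\sum_{u\in\{x,y,h\}}:\beta^{[\xi,u]}\gamma^{u'}:,\qquad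 \xi\in\mathfrak{sl}_2.$$ Then the commutant $\mathrm{Com}(\Theta_{\mathcal S},\mathcal S)=\{v\in\mathcal S\mid [a(z),v(w)]=0\ \ \forall a\in\Theta_{\mathcal S}\}$ is a vertex algebra, it coincides with the space of invariants $\mathcal{S}^{\mathfrak{sl}_2[t]}=\{v\in\mathcal S\mid \Theta^{\xi}_{\mathcal S}\circ_n v=0\ \ \forall \xi\in\mathfrak{sl}_2,\ n\ge 0\}$, and it is strongly generated by the three fields $$v^x=\tfrac12\big(:\gamma^{h'}\gamma^{h'}:+:\gamma^{x'}\gamma^{y'}:\big),\qquad v^y=-\tfrac12\big(:\beta^h\beta^h:+4:\beta^x\beta^y:\big),\qquad v^h=\ :\beta^h\gamma^{h'}:+:\beta^x\gamma^{x'}:+:\beta^y\gamma^{y'}: .$$ That is, $v^x,v^y,v^h$ lie in it, and it is spanned by the iterated (right-nested) Wick products $:\partial^{k_1}a_1\cdots\partial^{k_m}a_m:$ with $m\ge 0$, $k_i\ge 0$ and $a_i\in\{v^x,v^y,v^h\}$ (the empty product being $1$). -/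

import Mathlib

open scoped VertexOperator

noncomputable section

namespace BetaGamma

/-! ### Quantum operators on a complex vector space

`QO V` is the space of linear maps `V → V((z))`; the `n`-th Fourier mode of `a` is `a[[n]]`, so
`a(z) = ∑ a[[n]] z ^ (-n-1)`. All vector spaces below are purely even, so no signs occur. -/

/-- Linear maps `V → V((z))`. -/
abbrev QO (V : Type*) [AddCommGroup V] [Module ℂ V] := VertexOperator ℂ V

section Fields

variable {V : Type*} [AddCommGroup V] [Module ℂ V]

/-- For every vector `v` we have `a[[n]] v = 0` for `n ≫ 0`. -/
theorem exists_mode_eq_zero (a : QO V) (v : V) :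
    ∃ N : ℤ, ∀ n : ℤ, N ≤ n → (a[[n]]) v = 0 := by
  refine ⟨-((HahnModule.of ℂ).symm (a v)).order, fun n hn => ?_⟩
  exact VertexOperator.ncoeff_eq_zero_of_lt_order a n v (by lia)

/-- The field `∑ f n z ^ (-n-1)` with prescribed Fourier modes. -/
def ofModes (f : ℤ → Module.End ℂ V) (hf : ∀ v, ∃ N : ℤ, ∀ n : ℤ, N ≤ n → f n v = 0) : QO V :=
  VertexOperator.of_coeff (fun k => f (-k - 1)) (by
    intro v
    obtain ⟨N, hN⟩ := hf v
    refine ⟨-N, fun k hk => ?_⟩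
    by_contra hlt
    exact hk (hN _ (by lia)))

@[simp]
theorem ofModes_mode (f : ℤ → Module.End ℂ V) (hf : ∀ v, ∃ N : ℤ, ∀ n : ℤ, N ≤ n → f n v = 0)
    (n : ℤ) : (ofModes f hf)[[n]] = f n := by
  simp [ofModes]

/-- The identity field `1`. -/
def one : QO V :=
  ofModes (fun n => if n = -1 then 1 else 0) (fun v => ⟨0, fun n hn => by
    rw [if_neg (by lia)]; rfl⟩)

/-- The formal derivative `∂a = d/dz a(z)`, with modes `(∂a)[[n]] = -n a[[n-1]]`. -/
def deriv (a : QO V) : QO V :=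
  ofModes (fun n => (-(n : ℂ)) • a[[n - 1]]) (fun v => by
    obtain ⟨N, hN⟩ := exists_mode_eq_zero a v
    exact ⟨N + 1, fun n hn => by simp [hN (n - 1) (by lia)]⟩)

/-- The `j`-th term of the `m`-th mode of `a ∘ₙ b` applied to `v`. It comes from the expansions
`(z-w)^n = ∑ⱼ (-1)^j (n choose j) z^(n-j) w^j` for `|z| > |w|` and
`(z-w)^n = (-1)^n ∑ⱼ (-1)^j (n choose j) z^j w^(n-j)` for `|w| > |z|`. -/
def circTerm (a b : QO V) (n m : ℤ) (v : V) (j : ℕ) : V :=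
  ((-1 : ℤ) ^ j * Ring.choose n j) •
    ((a[[n - j]]) ((b[[m + j]]) v) - (n.negOnePow : ℤ) • (b[[m + n - j]]) ((a[[(j : ℤ)]]) v))

theorem circTerm_finite (a b : QO V) (n m : ℤ) (v : V) :
    (Function.support (circTerm a b n m v)).Finite := by
  obtain ⟨N, hN⟩ := exists_mode_eq_zero a v
  obtain ⟨M, hM⟩ := exists_mode_eq_zero b v
  refine (Set.finite_lt_nat (N.toNat + (M - m).toNat)).subset fun j hj => ?_
  by_contra hlt
  simp only [Set.mem_ofPred_eq, not_lt] at hlt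
  exact hj (by simp [circTerm, hN j (by lia), hM (m + j) (by lia)])

/-- The `m`-th mode of the circle product `a ∘ₙ b`. -/
def circMode (a b : QO V) (n m : ℤ) : Module.End ℂ V where
  toFun v := ∑ᶠ j : ℕ, circTerm a b n m v j
  map_add' u v := by
    rw [← finsum_add_distrib (circTerm_finite a b n m u) (circTerm_finite a b n m v)]
    refine finsum_congr fun j => ?_
    simp only [circTerm, map_add, ← smul_add]
    congr 1
    simp only [smul_add]
    abel
  map_smul' c v := by
    rw [RingHom.id_apply, smul_finsum' c (circTerm_finite a b n m v)]
    refine finsum_congr fun j => ?_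
    simp only [circTerm, map_smul]
    rw [smul_comm c, smul_comm (n.negOnePow : ℤ) c, ← smul_sub]

theorem circMode_eventually_zero (a b : QO V) (n : ℤ) (v : V) :
    ∃ N : ℤ, ∀ m : ℤ, N ≤ m → circMode a b n m v = 0 := by
  obtain ⟨N, hN⟩ := exists_mode_eq_zero a v
  obtain ⟨M, hM⟩ := exists_mode_eq_zero b v
  choose K hK using fun j : ℕ => exists_mode_eq_zero b ((a[[(j : ℤ)]]) v)
  obtain ⟨L, hL⟩ := ((Finset.range N.toNat).image K).bddAbove
  refine ⟨max M (L - n + N.toNat), fun m hm => ?_⟩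
  refine (finsum_congr fun j => ?_).trans finsum_zero
  have h1 : (b[[m + j]]) v = 0 := hM _ (by lia)
  have h2 : (b[[m + n - j]]) ((a[[(j : ℤ)]]) v) = 0 := by
    by_cases hj : j < N.toNat
    · have := hL (Finset.mem_coe.2 (Finset.mem_image_of_mem K (Finset.mem_range.2 hj)))
      exact hK j _ (by lia)
    · rw [hN j (by lia), map_zero]
  simp [circTerm, h1, h2]

/-- The `n`-th circle product
`a(w) ∘ₙ b(w) = Res_z a(z) b(w) ι_{|z|>|w|} (z-w)^n - Res_z b(w) a(z) ι_{|w|>|z|} (z-w)^n`. -/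
def circ (a : QO V) (n : ℤ) (b : QO V) : QO V :=
  ofModes (circMode a b n) (circMode_eventually_zero a b n)

/-- The Wick product `:a b:`, which is `a ∘₋₁ b`. -/
def wick (a b : QO V) : QO V := circ a (-1) b

/-- `[a(z), b(w)] = 0`. -/
def FieldsCommute (a b : QO V) : Prop :=
  ∀ m n : ℤ, Commute (a[[m]]) (b[[n]])

/-- `(z-w)^N [a(z), b(w)] = 0` for some `N ≥ 0`. -/
def QuantumCommute (a b : QO V) : Prop :=
  ∃ N : ℕ, ∀ m n : ℤ, ∑ j ∈ Finset.range (N + 1),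
    ((-1 : ℤ) ^ j * (N.choose j : ℤ)) • ⁅a[[m + N - j]], b[[n + j]]⁆ = 0

/-- Quantum operator algebras: subspaces of `QO V` containing `1` and closed under all circle
products. -/
structure IsQOA (A : Submodule ℂ (QO V)) : Prop where
  one_mem : one ∈ A
  circ_mem : ∀ a ∈ A, ∀ b ∈ A, ∀ n : ℤ, circ a n b ∈ A

/-- Vertex algebras, as commutative quantum operator algebras. -/
structure IsVertexAlgebra (A : Submodule ℂ (QO V)) : Prop extends IsQOA A where
  quantumCommute : ∀ a ∈ A, ∀ b ∈ A, QuantumCommute a b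

/-- The quantum operator algebra generated by a set of fields. -/
def generated (S : Set (QO V)) : Submodule ℂ (QO V) :=
  sInf {A | IsQOA A ∧ S ⊆ A}

/-- The commutant `Com(A, B)` of `A` in `B`. -/
def commutant (A B : Submodule ℂ (QO V)) : Submodule ℂ (QO V) where
  carrier := {v | v ∈ B ∧ ∀ a ∈ A, FieldsCommute a v}
  zero_mem' := ⟨B.zero_mem, fun a _ m n => by
    rw [map_zero, Pi.zero_apply]; exact Commute.zero_right _⟩
  add_mem' := fun hu hv => ⟨B.add_mem hu.1 hv.1, fun a ha m n => by
    rw [map_add, Pi.add_apply]; exact (hu.2 a ha m n).add_right (hv.2 a ha m n)⟩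
  smul_mem' := fun c _ hv => ⟨B.smul_mem c hv.1, fun a ha m n => by
    rw [map_smul, Pi.smul_apply]; exact (hv.2 a ha m n).smul_right c⟩

/-- The set of iterated Wick products `:∂^k₁ a₁ ⋯ ∂^kᵣ aᵣ:` with `a₁, …, aᵣ ∈ S` and
`k₁, …, kᵣ ≥ 0`, nested to the right; for `r = 0` the product is `1`. -/
def wickMonomials (S : Set (QO V)) : Set (QO V) :=
  {a | ∃ l : List (ℕ × QO V), (∀ p ∈ l, p.2 ∈ S) ∧
    a = l.foldr (fun p b => wick (deriv^[p.1] p.2) b) one}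

/-- `S ⊆ A` strongly generates `A`: the iterated Wick products of elements of `S` and their
derivatives span `A`. -/
def StronglyGenerates (S : Set (QO V)) (A : Submodule ℂ (QO V)) : Prop :=
  S ⊆ A ∧ Submodule.span ℂ (wickMonomials S) = A

end Fields

/-! ### The `βγ` system

For a vector space with a basis indexed by `ι`, the Fock space is the polynomial ring in variables
`β^i_k` and `γ^i_k` (`k ≥ 0`), which act as the modes `β^i(-k-1)` and `γ^i(-k-1)`. -/

/-- The Fock space: `Sum.inl (i, k)` is the variable `β^i_k`, `Sum.inr (i, k)` is `γ^i_k`. -/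
abbrev Fock (ι : Type) := MvPolynomial ((ι × ℕ) ⊕ (ι × ℕ)) ℂ

section Fock

variable {ι : Type}

theorem pderiv_eventually_zero (e : ℕ → (ι × ℕ) ⊕ (ι × ℕ)) (he : Function.Injective e)
    (v : Fock ι) : ∃ N : ℕ, ∀ k : ℕ, N ≤ k → MvPolynomial.pderiv (e k) v = 0 := by
  obtain ⟨N, hN⟩ := (v.vars.finite_toSet.preimage he.injOn).bddAbove
  refine ⟨N + 1, fun k hk => MvPolynomial.pderiv_eq_zero_of_notMem_vars fun hmem => ?_⟩
  have : k ≤ N := hN hmem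
  lia

/-- Multiplication by the variable `s`, as an operator on the Fock space. -/
def create (s : (ι × ℕ) ⊕ (ι × ℕ)) : Module.End ℂ (Fock ι) :=
  LinearMap.mulLeft ℂ (MvPolynomial.X s)

/-- The partial derivative in the variable `s`, as an operator on the Fock space. -/
def annihilate (s : (ι × ℕ) ⊕ (ι × ℕ)) : Module.End ℂ (Fock ι) :=
  (MvPolynomial.pderiv s).toLinearMap

/-- The modes of `β^i`: `β^i(-k-1)` is multiplication by `β^i_k`, and `β^i(k) = ∂/∂γ^i_k`, for
`k ≥ 0`. -/
def betaMode (i : ι) : ℤ → Module.End ℂ (Fock ι)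
  | Int.ofNat k => annihilate (Sum.inr (i, k))
  | Int.negSucc k => create (Sum.inl (i, k))

/-- The modes of `γ^i`: `γ^i(-k-1)` is multiplication by `γ^i_k`, and `γ^i(k) = -∂/∂β^i_k`, for
`k ≥ 0`. -/
def gammaMode (i : ι) : ℤ → Module.End ℂ (Fock ι)
  | Int.ofNat k => -annihilate (Sum.inl (i, k))
  | Int.negSucc k => create (Sum.inr (i, k))

theorem betaMode_eventually_zero (i : ι) (v : Fock ι) :
    ∃ N : ℤ, ∀ n : ℤ, N ≤ n → betaMode i n v = 0 := by
  obtain ⟨N, hN⟩ := pderiv_eventually_zero (fun k => Sum.inr (i, k)) (fun a b h => by simpa using h) v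
  refine ⟨N, fun n hn => ?_⟩
  obtain ⟨k, rfl⟩ := Int.eq_ofNat_of_zero_le (show 0 ≤ n by lia)
  exact hN k (by lia)

theorem gammaMode_eventually_zero (i : ι) (v : Fock ι) :
    ∃ N : ℤ, ∀ n : ℤ, N ≤ n → gammaMode i n v = 0 := by
  obtain ⟨N, hN⟩ := pderiv_eventually_zero (fun k => Sum.inl (i, k)) (fun a b h => by simpa using h) v
  refine ⟨N, fun n hn => ?_⟩
  obtain ⟨k, rfl⟩ := Int.eq_ofNat_of_zero_le (show 0 ≤ n by lia)
  exact neg_eq_zero.2 (hN k (by lia))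

/-- The field `β^i(z)` of the `i`-th basis vector. -/
def betaField (i : ι) : QO (Fock ι) := ofModes (betaMode i) (betaMode_eventually_zero i)

/-- The field `γ^i(z)` of the `i`-th dual basis vector. -/
def gammaField (i : ι) : QO (Fock ι) := ofModes (gammaMode i) (gammaMode_eventually_zero i)

end Fock

section LieAlgebra

variable {ι : Type} [Fintype ι] {𝔤 : Type} [LieRing 𝔤] [LieAlgebra ℂ 𝔤]

/-- The field `β^ξ`, linear in `ξ ∈ 𝔤`. -/
def beta (B : Module.Basis ι ℂ 𝔤) (ξ : 𝔤) : QO (Fock ι) :=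
  ∑ i, B.repr ξ i • betaField i

/-- The field `γ^ξ'`, linear in `ξ' ∈ 𝔤*`. -/
def gamma (B : Module.Basis ι ℂ 𝔤) (ξ' : Module.Dual ℂ 𝔤) : QO (Fock ι) :=
  ∑ i, ξ' (B i) • gammaField i

/-- The `βγ` system `S(𝔤)`, generated by the fields `β^ξ` and `γ^ξ'`. -/
def system (B : Module.Basis ι ℂ 𝔤) : Submodule ℂ (QO (Fock ι)) :=
  generated (Set.range (beta B) ∪ Set.range (gamma B))

/-- The field `Θ^ξ = -∑ᵢ :β^[ξ, ξᵢ] γ^ξᵢ':` for the basis `ξᵢ` with dual basis `ξᵢ'`. -/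
def theta (B : Module.Basis ι ℂ 𝔤) (ξ : 𝔤) : QO (Fock ι) :=
  -∑ i, wick (beta B ⁅ξ, B i⁆) (gamma B (B.coord i))

/-- The algebra `Θ_S`, generated by the fields `Θ^ξ`. -/
def thetaAlgebra (B : Module.Basis ι ℂ 𝔤) : Submodule ℂ (QO (Fock ι)) :=
  generated (Set.range (theta B))

/-- The set `S(𝔤)^{𝔤[t]}` of elements of `S(𝔤)` annihilated by `Θ^ξ ∘ₙ` for all `ξ ∈ 𝔤` and all
`n ≥ 0`, which is the action of `ξ tⁿ ∈ 𝔤[t]`. -/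
def currentInvariants (B : Module.Basis ι ℂ 𝔤) : Set (QO (Fock ι)) :=
  {v | v ∈ system B ∧ ∀ (ξ : 𝔤) (n : ℕ), circ (theta B ξ) n v = 0}

end LieAlgebra

/-! ### The case of `sl₂` -/

/-- The Lie algebra `sl₂` of traceless complex `2 × 2` matrices. -/
abbrev sl2 : Type := LieAlgebra.SpecialLinear.sl (Fin 2) ℂ

/-- The matrix with rows `(c, a)` and `(b, -c)`, which is `a x + b y + c h`. -/
def sl2Mk (a b c : ℂ) : sl2 :=
  ⟨!![c, a; b, -c], by
    simp [LieAlgebra.SpecialLinear.sl, Matrix.trace_fin_two]⟩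

/-- Coordinates on `sl₂` in the basis `x, y, h`. -/
def sl2Coords : sl2 ≃ₗ[ℂ] (Fin 3 → ℂ) where
  toFun m := ![m.1 0 1, m.1 1 0, m.1 0 0]
  invFun v := sl2Mk (v 0) (v 1) (v 2)
  map_add' m n := by
    ext i; fin_cases i <;> simp
  map_smul' c m := by
    ext i; fin_cases i <;> simp
  left_inv m := by
    have htr : m.1 0 0 + m.1 1 1 = 0 := by
      have h := m.2
      simpa [LieAlgebra.SpecialLinear.sl, Matrix.trace_fin_two] using h
    apply Subtype.ext
    ext i j
    fin_cases i <;> fin_cases j <;> simp [sl2Mk]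
    linear_combination -htr
  right_inv v := by
    ext i; fin_cases i <;> simp [sl2Mk]

/-- The basis `x = (0 1; 0 0)`, `y = (0 0; 1 0)`, `h = (1 0; 0 -1)` of `sl₂`, in this order; it
satisfies `[x, y] = h`, `[h, x] = 2 x`, `[h, y] = -2 y`. -/
def sl2Basis : Module.Basis (Fin 3) ℂ sl2 := Module.Basis.ofEquivFun sl2Coords

/-- The vector `x`. -/
abbrev xx : sl2 := sl2Basis 0

/-- The vector `y`. -/
abbrev yy : sl2 := sl2Basis 1

/-- The vector `h`. -/
abbrev hh : sl2 := sl2Basis 2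

/-- The dual basis vector `x'`. -/
abbrev xx' : Module.Dual ℂ sl2 := sl2Basis.coord 0

/-- The dual basis vector `y'`. -/
abbrev yy' : Module.Dual ℂ sl2 := sl2Basis.coord 1

/-- The dual basis vector `h'`. -/
abbrev hh' : Module.Dual ℂ sl2 := sl2Basis.coord 2

/-- `β^ξ` for `sl₂`. -/
abbrev β (ξ : sl2) : QO (Fock (Fin 3)) := beta sl2Basis ξ

/-- `γ^ξ'` for `sl₂`. -/
abbrev γ (ξ' : Module.Dual ℂ sl2) : QO (Fock (Fin 3)) := gamma sl2Basis ξ'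

/-- `v^x = 1/2 (:γ^h' γ^h': + :γ^x' γ^y':)`. -/
def vx : QO (Fock (Fin 3)) :=
  (1 / 2 : ℂ) • (wick (γ hh') (γ hh') + wick (γ xx') (γ yy'))

/-- `v^y = -1/2 (:β^h β^h: + 4 :β^x β^y:)`. -/
def vy : QO (Fock (Fin 3)) :=
  (-(1 / 2) : ℂ) • (wick (β hh) (β hh) + (4 : ℂ) • wick (β xx) (β yy))

/-- `v^h = :β^h γ^h': + :β^x γ^x': + :β^y γ^y':`. -/
def vh : QO (Fock (Fin 3)) :=
  wick (β hh) (γ hh') + wick (β xx) (γ xx') + wick (β yy) (γ yy')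

end BetaGamma

end

/-! A field of the βγ system is determined by its state in the Fock space
(`eq_zero_of_state_eq_zero`), and commuting with the fields Θ^ξ amounts to being killed by their
nonnegative modes, since locality recovers the negative ones (`coe_commutant_eq_currentInvariants`).
The question thus becomes one about polynomials, viewed as functions on pairs of arcs (l, w), each
made of three power series.

On polynomials, Θ^ξ(n) is the derivation by which ξ tⁿ acts on arcs plus a second-order contraction
that lowers degrees (`theta_mode`). The top homogeneous part of an invariant vector is therefore
invariant under the derivations alone. The heart of the proof is `exists_eq_aeval_quadric`: such
polynomials are polynomials in the coefficients of the three quadratic series l₂² + 4 l₀l₁, l·w and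
w₂² + w₀w₁. Wick monomials in the three generators have exactly the monomials in these coefficients
as leading terms (`exists_wickMonomial`), so one subtracts a combination of them and inducts on the
degree (`exists_state_eq`).

For the arc statement, the elements x p(t) and y p(t) act nilpotently and integrate to unipotent
substitutions that fix invariant polynomials (`arcEval_flow`). Over a generic pair they move w to
(0, 0, s) with s² = w₂² + w₀w₁, and l to a normal form depending only on a = l₂² + 4 l₀l₁ and e =
(l·w)/s (`arcEval_eq_normalForm`). An invariant is thus a polynomial in the coefficients of a, e, s,
and the freedom in the sign of s makes it even in (e, s). Hence some power of the constant
coefficient of s² multiplies it into the polynomials in a, es, s² (`exists_pow_quadric_mul_eq`).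
That power cancels because the three series can still be prescribed when s² has zero constant
coefficient (`exists_eq_aeval_quadric_of_pow`). -/

open scoped VertexOperator

noncomputable section

namespace BetaGamma

/-! ### Difference operators on families of modes. -/

section Shift

variable {ι M : Type*} [AddCommGroup ι] [AddCommGroup M]

/-- Translation of functions on an additive group. -/
def shift (g : ι) : Module.End ℤ (ι → M) where
  toFun F x := F (x + g)
  map_add' _ _ := rfl
  map_smul' _ _ := rfl

@[simp]
theorem shift_apply (g : ι) (F : ι → M) (x : ι) : shift (M := M) g F x = F (x + g) := rfl

theorem commute_shift (g h : ι) : Commute (shift g : Module.End ℤ (ι → M)) (shift h) := by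
  ext F x
  change F (x + g + h) = F (x + h + g)
  rw [add_right_comm]

/-- The difference of two translations. -/
def shiftDiff (g h : ι) : Module.End ℤ (ι → M) := shift g - shift h

@[simp]
theorem shiftDiff_apply (g h : ι) (F : ι → M) (x : ι) :
    shiftDiff (M := M) g h F x = F (x + g) - F (x + h) := rfl

theorem commute_shiftDiff (g h g' h' : ι) :
    Commute (shiftDiff g h : Module.End ℤ (ι → M)) (shiftDiff g' h') :=
  ((commute_shift g g').sub_right (commute_shift g h')).sub_left
    ((commute_shift h g').sub_right (commute_shift h h'))

theorem shift_pow_apply (g : ι) (n : ℕ) (F : ι → M) (x : ι) :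
    ((shift g : Module.End ℤ (ι → M)) ^ n) F x = F (x + n • g) := by
  induction n generalizing x with
  | zero => simp
  | succ n ih => rw [pow_succ', Module.End.mul_apply, shift_apply, ih, succ_nsmul']; congr 1; abel

theorem shiftDiff_pow_apply (g h : ι) (N : ℕ) (F : ι → M) (x : ι) :
    ((shiftDiff g h : Module.End ℤ (ι → M)) ^ N) F x =
      ∑ j ∈ Finset.range (N + 1), ((-1 : ℤ) ^ j * (N.choose j : ℤ)) •
        F (x + (N - j) • g + j • h) := by
  have hc : Commute (-(shift h : Module.End ℤ (ι → M))) (shift g) := (commute_shift h g).neg_left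
  have : (shiftDiff g h : Module.End ℤ (ι → M)) = -shift h + shift g := by
    rw [shiftDiff]; abel
  rw [this, hc.add_pow]
  simp only [LinearMap.sum_apply, Finset.sum_apply]
  refine Finset.sum_congr rfl fun j hj => ?_
  rw [← nsmul_eq_mul', neg_pow, LinearMap.smul_apply, Pi.smul_apply, Module.End.mul_apply,
    Module.End.mul_apply]
  have : ((-1 : Module.End ℤ (ι → M)) ^ j) = ((-1 : ℤ) ^ j) • 1 := by
    rcases neg_one_pow_eq_or ℤ j with h | h <;> rcases j.even_or_odd with h' | h' <;>
      simp [h'.neg_one_pow]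
  rw [this, LinearMap.smul_apply, Pi.smul_apply, Module.End.one_apply, shift_pow_apply,
    shift_pow_apply, ← natCast_zsmul, smul_smul, mul_comm]
  congr 2
  abel

end Shift

/-! ### Modes of circle products. -/

section Fields

variable {V : Type*} [AddCommGroup V] [Module ℂ V]

theorem ext_modes {a b : QO V} (h : ∀ n, a[[n]] = b[[n]]) : a = b := by
  apply VertexOperator.ext
  intro v
  apply (HahnModule.of ℂ).symm.injective
  ext n
  have := LinearMap.congr_fun (h (-n - 1)) v
  rw [VertexOperator.ncoeff_apply, VertexOperator.ncoeff_apply,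
    HVertexOperator.coeff_apply_apply, HVertexOperator.coeff_apply_apply] at this
  simpa only [neg_sub, Int.sub_neg, sub_neg_eq_add, add_sub_cancel_left] using this

theorem one_mode (n : ℤ) : (one : QO V)[[n]] = if n = -1 then 1 else 0 := ofModes_mode _ _ _

theorem deriv_mode (a : QO V) (n : ℤ) : (deriv a)[[n]] = (-(n : ℂ)) • a[[n - 1]] :=
  ofModes_mode _ _ _

theorem circ_mode (a b : QO V) (n m : ℤ) (v : V) :
    ((circ a n b)[[m]]) v = ∑ᶠ j : ℕ, circTerm a b n m v j := by
  rw [circ, ofModes_mode]; rfl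

theorem circ_mode_eq_sum (a b : QO V) (n m : ℤ) (v : V) {N : ℕ}
    (h : ∀ j, N ≤ j → circTerm a b n m v j = 0) :
    ((circ a n b)[[m]]) v = ∑ j ∈ Finset.range N, circTerm a b n m v j := by
  rw [circ_mode]
  refine finsum_eq_sum_of_support_subset _ fun j hj => ?_
  by_contra hlt
  exact hj (h j (by simpa using hlt))

/-- For n ≥ 0 both expansions of (z-w)^n are the same finite polynomial. Reversing the order of the
second sum matches the two halves into commutators. -/
theorem circ_natCast_mode (a b : QO V) (n : ℕ) (m : ℤ) :
    (circ a n b)[[m]] = ∑ j ∈ Finset.range (n + 1),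
      ((-1 : ℤ) ^ j * (n.choose j : ℤ)) • ⁅a[[(n : ℤ) - j]], b[[m + j]]⁆ := by
  ext v
  rw [circ_mode_eq_sum a b n m v (N := n + 1)]
  · simp only [circTerm, smul_sub, Finset.sum_sub_distrib, LinearMap.sum_apply,
      LinearMap.smul_apply, Ring.lie_def, LinearMap.sub_apply, Module.End.mul_apply,
      Ring.choose_natCast]
    congr 1
    rw [← Finset.sum_range_reflect]
    refine Finset.sum_congr rfl fun j hj => ?_
    have hj' : j ≤ n := by simpa [Nat.lt_succ_iff] using hj
    rw [show n + 1 - 1 - j = n - j by lia, Nat.choose_symm hj', smul_smul]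
    have e : ((-1 : ℤ) ^ (n - j) * (n.choose j : ℤ) * ((n : ℤ).negOnePow : ℤ)) =
        (-1) ^ j * (n.choose j : ℤ) := by
      obtain ⟨k, rfl⟩ := Nat.exists_eq_add_of_le hj'
      have hn : ((((j + k : ℕ) : ℤ).negOnePow : ℤˣ) : ℤ) = (-1) ^ (j + k) := by
        rw [Int.negOnePow_def, zpow_natCast]
        simp
      rw [hn, Nat.add_sub_cancel_left, pow_add]
      have : ((-1 : ℤ) ^ k) * (-1) ^ k = 1 := by rw [← mul_pow]; simp
      linear_combination ((-1) ^ j * ((j + k).choose j : ℤ)) * this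
    rw [e]
    push_cast [Nat.cast_sub hj']
    congr 4
    lia
  · intro j hj
    rw [circTerm, Ring.choose_natCast, Nat.choose_eq_zero_of_lt (by lia)]
    simp

theorem wick_mode_eq_sum (a b : QO V) (m : ℤ) (v : V) {N : ℕ}
    (h : ∀ j : ℕ, N ≤ j → (b[[m + j]]) v = 0 ∧ (a[[(j : ℤ)]]) v = 0) :
    ((wick a b)[[m]]) v = ∑ j ∈ Finset.range N,
      ((a[[-1 - (j : ℤ)]]) ((b[[m + j]]) v) + (b[[m - 1 - j]]) ((a[[(j : ℤ)]]) v)) := by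
  rw [wick, circ_mode_eq_sum a b (-1) m v (N := N)]
  · refine Finset.sum_congr rfl fun j _ => ?_
    have : Ring.choose (-1 : ℤ) j = (-1) ^ j := by
      rw [Ring.choose_neg', Int.negOnePow_def]
      simp [Units.smul_def]
    rw [circTerm, this, ← mul_pow]
    simp [sub_eq_add_neg]
  · intro j hj
    simp [circTerm, (h j hj).1, (h j hj).2]

/-- `∂a = a ∘₋₂ 1`. -/
theorem circ_neg_two_one (a : QO V) : circ a (-2) one = deriv a := by
  apply ext_modes
  intro m
  ext v
  -- These are the coefficients of (1-x)^(-2). As the identity field has a single nonzero mode, only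
  -- one term survives: from the first expansion if m < 0, from the second if m > 0.
  have hc (j : ℕ) : (-1 : ℤ) ^ j * Ring.choose (-2 : ℤ) j = j + 1 := by
    rw [Ring.choose_neg', Int.negOnePow_def, zpow_natCast, Ring.multichoose_two]
    rcases neg_one_pow_eq_or ℤ j with h | h <;>
      simp [Units.smul_def, h, add_comm]
  rw [deriv_mode, circ_mode_eq_sum a one (-2) m v (N := m.natAbs + 1)]
  · simp only [circTerm, hc, one_mode]
    rcases lt_trichotomy m 0 with hm | rfl | hm
    · obtain ⟨k, rfl⟩ : ∃ k : ℕ, m = -1 - k := ⟨(-1 - m).toNat, by lia⟩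
      rw [Finset.sum_eq_single k]
      · rw [if_pos (by lia), if_neg (by lia), ← Int.cast_smul_eq_zsmul ℂ]
        simp only [Module.End.one_apply, LinearMap.zero_apply, smul_zero, sub_zero,
          LinearMap.smul_apply]
        rw [show (-2 : ℤ) - k = -1 - k - 1 by ring]
        congr 1
        push_cast
        ring
      · intro j _ hj
        rw [if_neg (by lia), if_neg (by lia)]
        simp
      · intro hk
        exact absurd (Finset.mem_range.2 (by lia)) hk
    · simp
    · obtain ⟨k, rfl⟩ : ∃ k : ℕ, m = k + 1 := ⟨(m - 1).toNat, by lia⟩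
      rw [Finset.sum_eq_single k]
      · rw [if_neg (by lia), if_pos (by lia), ← Int.cast_smul_eq_zsmul ℂ]
        simp [Int.negOnePow_def]
        rw [← neg_smul]
        congr 1
        ring
      · intro j _ hj
        rw [if_neg (by lia), if_neg (by lia)]
        simp
      · intro hk
        exact absurd (Finset.mem_range.2 (by lia)) hk
  · intro j hj
    simp only [circTerm, one_mode]
    rw [if_neg (by lia), if_neg (by lia)]
    simp

/-! ### Quantum commutativity -/

/-- The commutators of the modes of two fields. -/
def modeBracket (a b : QO V) : ℤ × ℤ → Module.End ℂ V := fun x => ⁅a[[x.1]], b[[x.2]]⁆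

/-- Multiplying by z or w shifts one mode index, so multiplying by (z-w)^N is the N-th power of a
difference of shifts. This replaces calculus with formal distributions by algebra of commuting
operators. -/
theorem quantumCommute_iff {a b : QO V} :
    QuantumCommute a b ↔ ∃ N : ℕ,
      (shiftDiff (1, 0) (0, 1) ^ N : Module.End ℤ (ℤ × ℤ → Module.End ℂ V)) (modeBracket a b) =
        0 := by
  have key (N : ℕ) (m n : ℤ) : (shiftDiff (1, 0) (0, 1) ^ N :
      Module.End ℤ (ℤ × ℤ → Module.End ℂ V)) (modeBracket a b) (m, n) =
      ∑ j ∈ Finset.range (N + 1),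
        ((-1 : ℤ) ^ j * (N.choose j : ℤ)) • ⁅a[[m + N - j]], b[[n + j]]⁆ := by
    rw [shiftDiff_pow_apply]
    refine Finset.sum_congr rfl fun j hj => ?_
    have hj' : j ≤ N := by simpa [Nat.lt_succ_iff] using hj
    simp [modeBracket, Nat.cast_sub hj', add_sub_assoc]
  refine exists_congr fun N => ⟨fun h => funext fun x => ?_, fun h m n => ?_⟩
  · exact (key N x.1 x.2).trans (h _ _)
  · rw [← key, h]; rfl

theorem QuantumCommute.symm {a b : QO V} (h : QuantumCommute a b) : QuantumCommute b a := by
  obtain ⟨N, hN⟩ := h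
  refine ⟨N, fun m n => ?_⟩
  rw [← Finset.sum_range_reflect]
  have := congrArg (fun x => (-(-1) ^ N : ℤ) • x) (hN n m)
  simp only [smul_zero, Finset.smul_sum, smul_smul] at this
  rw [← this]
  refine Finset.sum_congr rfl fun j hj => ?_
  have hj' : j ≤ N := by simpa [Nat.lt_succ_iff] using hj
  obtain ⟨k, rfl⟩ := Nat.exists_eq_add_of_le hj'
  rw [show j + k + 1 - 1 - j = k by lia, Nat.choose_symm_add, Ring.lie_def,
    Ring.lie_def, ← neg_sub, smul_neg, ← neg_smul]
  have : ((-1 : ℤ) ^ j) * (-1) ^ j = 1 := by rw [← mul_pow]; simp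
  congr 1
  · rw [pow_add]
    linear_combination ((-1) ^ k * ((j + k).choose k : ℤ)) * this
  · push_cast
    rw [show m + (j + k : ℤ) - k = m + j by ring, show n + (j + k : ℤ) - j = n + k by ring]

theorem FieldsCommute.quantumCommute {a b : QO V} (h : FieldsCommute a b) :
    QuantumCommute a b :=
  ⟨0, fun m n => by simp [(h _ _).lie_eq]⟩

theorem FieldsCommute.symm {a b : QO V} (h : FieldsCommute a b) : FieldsCommute b a :=
  fun m n => (h n m).symm

theorem fieldsCommute_one (a : QO V) : FieldsCommute a one := fun m n => by
  rw [one_mode]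
  split_ifs
  exacts [Commute.one_right _, Commute.zero_right _]

theorem QuantumCommute.exists_le {a b : QO V} (h : QuantumCommute a b) :
    ∃ N : ℕ, ∀ K, N ≤ K →
      (shiftDiff (1, 0) (0, 1) ^ K : Module.End ℤ (ℤ × ℤ → Module.End ℂ V)) (modeBracket a b) =
        0 := by
  obtain ⟨N, hN⟩ := quantumCommute_iff.1 h
  refine ⟨N, fun K hK => ?_⟩
  obtain ⟨k, rfl⟩ := Nat.exists_eq_add_of_le' hK
  rw [pow_add, Module.End.mul_apply, hN, map_zero]

theorem QuantumCommute.add_right {a b c : QO V} (hb : QuantumCommute a b)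
    (hc : QuantumCommute a c) : QuantumCommute a (b + c) := by
  obtain ⟨N, hN⟩ := hb.exists_le
  obtain ⟨M, hM⟩ := hc.exists_le
  refine quantumCommute_iff.2 ⟨max N M, ?_⟩
  have : modeBracket a (b + c) = modeBracket a b + modeBracket a c := by
    ext x : 1
    simp [modeBracket, Ring.lie_def, mul_add, add_mul, add_sub_add_comm]
  rw [this, map_add, hN _ (le_max_left _ _), hM _ (le_max_right _ _), add_zero]

theorem QuantumCommute.smul_right {a b : QO V} (hb : QuantumCommute a b) (c : ℂ) :
    QuantumCommute a (c • b) := by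
  obtain ⟨N, hN⟩ := hb
  refine ⟨N, fun m n => ?_⟩
  have := congrArg (c • ·) (hN m n)
  rw [smul_zero, Finset.smul_sum] at this
  rw [← this]
  refine Finset.sum_congr rfl fun j _ => ?_
  rw [smul_comm c, map_smul, Pi.smul_apply, Ring.lie_def, Ring.lie_def, mul_smul_comm,
    smul_mul_assoc, ← smul_sub]

/-- If `a` and `b` are quantum commuting and `a ∘ₙ b = 0` for all `n ≥ 0`, then `a` and `b`
commute. -/
theorem QuantumCommute.fieldsCommute {a b : QO V} (h : QuantumCommute a b)
    (h0 : ∀ n : ℕ, circ a n b = 0) : FieldsCommute a b := by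
  obtain ⟨N, hN⟩ := h
  -- The term j = 0 of the commutator formula for `circ a n b` is the bracket with a(n); the others
  -- involve a(i) with 0 ≤ i < n.
  have h1 (n : ℕ) (m : ℤ) : ⁅a[[(n : ℤ)]], b[[m]]⁆ = 0 := by
    induction n using Nat.strong_induction_on generalizing m with
    | _ n ih =>
      have := circ_natCast_mode a b n m
      rw [h0, map_zero, Pi.zero_apply, Finset.sum_range_succ', Finset.sum_eq_zero] at this
      · simpa using this.symm
      · intro j hj
        have hj' : j < n := by simpa using hj
        rw [show (n : ℤ) - (j + 1 : ℕ) = ((n - (j + 1) : ℕ) : ℤ) by lia, ih _ (by lia),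
          smul_zero]
  -- Locality is a recursion in the mode index: the term j = N is the wanted bracket up to sign, and
  -- every other term has a larger mode of a.
  have h2 (n : ℕ) (m : ℤ) : ⁅a[[-(n : ℤ)]], b[[m]]⁆ = 0 := by
    induction n using Nat.strong_induction_on generalizing m with
    | _ n ih =>
      have := hN (-n) (m - N)
      rw [Finset.sum_range_succ, Finset.sum_eq_zero, zero_add] at this
      · have e : ((-1 : ℤ) ^ N) * (-1) ^ N = 1 := by rw [← mul_pow]; simp
        have := congrArg (fun x => ((-1 : ℤ) ^ N) • x) this
        simpa [smul_smul, e] using this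
      · intro j hj
        have hj' : j < N := by simpa using hj
        rcases le_or_gt 0 (-(n : ℤ) + N - j) with hle | hlt
        · rw [← Int.toNat_of_nonneg hle, h1, smul_zero]
        · rw [show -(n : ℤ) + N - j = -((n - (N - j) : ℕ) : ℤ) by lia, ih _ (by lia), smul_zero]
  intro m n
  rw [commute_iff_lie_eq]
  rcases le_or_gt 0 m with hle | hlt
  · rw [← Int.toNat_of_nonneg hle, h1]
  · rw [show m = -((-m).toNat : ℤ) by lia, h2]

theorem FieldsCommute.circ_natCast {a b : QO V} (h : FieldsCommute a b) (n : ℕ) :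
    circ a n b = 0 := by
  apply ext_modes
  intro m
  rw [circ_natCast_mode, map_zero, Pi.zero_apply]
  exact Finset.sum_eq_zero fun j _ => by rw [(h _ _).lie_eq, smul_zero]

theorem FieldsCommute.circ_right {a b d : QO V} (hb : FieldsCommute a b)
    (hd : FieldsCommute a d) (n : ℤ) : FieldsCommute a (circ b n d) := by
  intro p m
  ext v
  have e1 := circ_mode b d n m v
  have e2 := circ_mode b d n m ((a[[p]]) v)
  rw [Module.End.mul_apply, Module.End.mul_apply, e1, e2,
    map_finsum (a[[p]]) (circTerm_finite b d n m v)]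
  refine finsum_congr fun j => ?_
  have hb' (i : ℤ) (x : V) : (a[[p]]) ((b[[i]]) x) = (b[[i]]) ((a[[p]]) x) :=
    LinearMap.congr_fun (hb p i) x
  have hd' (i : ℤ) (x : V) : (a[[p]]) ((d[[i]]) x) = (d[[i]]) ((a[[p]]) x) :=
    LinearMap.congr_fun (hd p i) x
  simp only [circTerm, map_zsmul, map_sub, hb', hd']

end Fields

/-! ### Dong's lemma -/

section Dong

/-- Transports locality from brackets in two variables to families in three: a reindexing compatible
with the shifts intertwines the difference operators. -/
theorem shiftDiff_pow_comp {ι ι' M M' : Type*} [AddCommGroup ι] [AddCommGroup ι']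
    [AddCommGroup M] [AddCommGroup M'] (f : M →+ M') (g : ι' → ι) {e₁ e₂ : ι'} {E₁ E₂ : ι}
    (h₁ : ∀ x, g (x + e₁) = g x + E₁) (h₂ : ∀ x, g (x + e₂) = g x + E₂) (F : ι → M) (N : ℕ) :
    ((shiftDiff e₁ e₂ : Module.End ℤ (ι' → M')) ^ N) (fun x => f (F (g x))) =
      fun x => f (((shiftDiff E₁ E₂ : Module.End ℤ (ι → M)) ^ N) F (g x)) := by
  induction N with
  | zero => simp
  | succ N ih =>
    rw [pow_succ', pow_succ', Module.End.mul_apply, ih]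
    ext x
    simp [Module.End.mul_apply, h₁, h₂]

/-- Summation by parts with Pascal's rule. It encodes (z-w)·(z-w)^n = (z-w)^(n+1) on expansions. -/
theorem choose_smul_telescope {V : Type*} [AddCommGroup V] (n : ℤ) (X : ℕ → V) (N : ℕ)
    (hX : ∀ j, N ≤ j → X j = 0) :
    ∑ᶠ j : ℕ, ((-1 : ℤ) ^ j * Ring.choose n j) • (X j - X (j + 1)) =
      ∑ᶠ j : ℕ, ((-1 : ℤ) ^ j * Ring.choose (n + 1) j) • X j := by
  have hs (Y : ℕ → V) (k : ℤ) (hY : ∀ j, N ≤ j → Y j = 0) :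
      ∑ᶠ j : ℕ, ((-1 : ℤ) ^ j * Ring.choose k j) • Y j =
        ∑ j ∈ Finset.range (N + 1), ((-1 : ℤ) ^ j * Ring.choose k j) • Y j := by
    refine finsum_eq_sum_of_support_subset _ fun j hj => ?_
    by_contra hlt
    exact hj (by simp [hY j (by simp at hlt; lia)])
  rw [hs _ _ fun j hj => by rw [hX j hj, hX _ (by lia), sub_zero], hs _ _ hX]
  simp only [smul_sub, Finset.sum_sub_distrib]
  rw [Finset.sum_range_succ (fun j => ((-1 : ℤ) ^ j * Ring.choose n j) • X (j + 1)),
    Finset.sum_range_succ' _ N, Finset.sum_range_succ' _ N,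
    hX (N + 1) (by lia), smul_zero, add_zero, add_sub_right_comm, ← Finset.sum_sub_distrib]
  congr 1
  · refine Finset.sum_congr rfl fun j _ => ?_
    rw [← sub_smul, Ring.choose_succ_succ]
    congr 1
    ring
  · simp

variable {V : Type*} [AddCommGroup V]

/-- Pairs of three-parameter families to which the residue defining the circle product in the
first two parameters applies. -/
def poleBounded : Submodule ℤ (ℤ × ℤ × ℤ → V × V) where
  carrier := {Φ | ∀ r, ∃ M : ℤ, ∀ k, M ≤ k → ∀ p, (Φ (p, k, r)).1 = 0 ∧ (Φ (k, p, r)).2 = 0}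
  zero_mem' := fun _ => ⟨0, fun _ _ _ => ⟨rfl, rfl⟩⟩
  add_mem' := fun {Φ Ψ} hΦ hΨ r => by
    obtain ⟨M, hM⟩ := hΦ r
    obtain ⟨K, hK⟩ := hΨ r
    refine ⟨max M K, fun k hk p => ?_⟩
    have h1 := hM k (le_trans (le_max_left _ _) hk) p
    have h2 := hK k (le_trans (le_max_right _ _) hk) p
    simp [h1.1, h1.2, h2.1, h2.2]
  smul_mem' := fun c Φ hΦ r => by
    obtain ⟨M, hM⟩ := hΦ r
    refine ⟨M, fun k hk p => ?_⟩
    simp [(hM k hk p).1, (hM k hk p).2]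

theorem shift_mem_poleBounded {Φ : ℤ × ℤ × ℤ → V × V} (h : Φ ∈ poleBounded) (g : ℤ × ℤ × ℤ) :
    shift (M := V × V) g Φ ∈ poleBounded := by
  intro r
  obtain ⟨M, hM⟩ := h (r + g.2.2)
  refine ⟨max (M - g.1) (M - g.2.1), fun k hk p => ?_⟩
  have h1 := le_trans (le_max_left _ _) hk
  have h2 := le_trans (le_max_right _ _) hk
  exact ⟨(hM (k + g.2.1) (by lia) (p + g.1)).1, (hM (k + g.1) (by lia) (p + g.2.1)).2⟩

theorem pow_mem_of_mapsTo {R M : Type*} [CommRing R] [AddCommGroup M] [Module R M]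
    {S : Submodule R M} {A : Module.End R M} (h : ∀ x ∈ S, A x ∈ S) (n : ℕ) :
    ∀ x ∈ S, (A ^ n) x ∈ S := by
  induction n with
  | zero => simp
  | succ n ih => exact fun x hx => by rw [pow_succ', Module.End.mul_apply]; exact h _ (ih x hx)

theorem shiftDiff_mem_poleBounded (g h : ℤ × ℤ × ℤ) :
    ∀ Φ ∈ (poleBounded : Submodule ℤ (ℤ × ℤ × ℤ → V × V)), shiftDiff (M := V × V) g h Φ ∈ poleBounded :=
  fun _ hΦ => poleBounded.sub_mem (shift_mem_poleBounded hΦ g) (shift_mem_poleBounded hΦ h)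

/-- The summands of the residue defining the circle product. -/
def pairTerm (Φ : ℤ × ℤ × ℤ → V × V) (n m r : ℤ) (j : ℕ) : V :=
  ((-1 : ℤ) ^ j * Ring.choose n j) •
    ((Φ (n - j, m + j, r)).1 - (n.negOnePow : ℤ) • (Φ (j, m + n - j, r)).2)

theorem pairTerm_finite {Φ : ℤ × ℤ × ℤ → V × V} (h : Φ ∈ poleBounded) (n m r : ℤ) :
    (Function.support (pairTerm Φ n m r)).Finite := by
  obtain ⟨M, hM⟩ := h r
  refine (Set.finite_lt_nat (M.toNat + (M - m).toNat)).subset fun j hj => ?_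
  by_contra hlt
  simp only [Set.mem_ofPred_eq, not_lt] at hlt
  exact hj (by simp [pairTerm, (hM (m + j) (by lia) _).1, (hM j (by lia) _).2])

/-- The residue defining the circle product. -/
def pairCirc (n : ℤ) (Φ : ℤ × ℤ × ℤ → V × V) (x : ℤ × ℤ) : V := ∑ᶠ j, pairTerm Φ n x.1 x.2 j

theorem pairCirc_sub {Φ Ψ : ℤ × ℤ × ℤ → V × V} (hΦ : Φ ∈ poleBounded) (hΨ : Ψ ∈ poleBounded)
    (n : ℤ) : pairCirc n (Φ - Ψ) = pairCirc n Φ - pairCirc n Ψ := by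
  ext x
  rw [Pi.sub_apply, pairCirc, pairCirc, pairCirc,
    ← finsum_sub_distrib (pairTerm_finite hΦ _ _ _) (pairTerm_finite hΨ _ _ _)]
  refine finsum_congr fun j => ?_
  simp only [pairTerm, ← smul_sub, Pi.sub_apply, Prod.fst_sub, Prod.snd_sub]
  congr 1
  simp only [smul_sub]
  abel

theorem pairCirc_smul {Φ : ℤ × ℤ × ℤ → V × V} (h : Φ ∈ poleBounded) (c n : ℤ) :
    pairCirc n (c • Φ) = c • pairCirc n Φ := by
  ext x
  rw [Pi.smul_apply, pairCirc, pairCirc, smul_finsum' c (pairTerm_finite h _ _ _)]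
  refine finsum_congr fun j => ?_
  simp only [pairTerm, Pi.smul_apply, Prod.smul_fst, Prod.smul_snd]
  rw [smul_comm c, smul_comm (n.negOnePow : ℤ) c, ← smul_sub]

/-- The residue is taken in the first variable, so the factor z₂ - z₃ passes through it. -/
theorem pairCirc_shiftDiff_snd {Φ : ℤ × ℤ × ℤ → V × V} (h : Φ ∈ poleBounded) (n : ℤ) :
    pairCirc n ((shiftDiff (0, 1, 0) (0, 0, 1) : Module.End ℤ (ℤ × ℤ × ℤ → V × V)) Φ) =
      (shiftDiff (1, 0) (0, 1) : Module.End ℤ (ℤ × ℤ → V)) (pairCirc n Φ) := by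
  rw [shiftDiff, LinearMap.sub_apply,
    pairCirc_sub (shift_mem_poleBounded h _) (shift_mem_poleBounded h _)]
  ext x
  simp only [Pi.sub_apply, shiftDiff_apply]
  congr 1
  · simp [pairCirc, pairTerm, add_right_comm, add_sub_right_comm]
  · simp [pairCirc, pairTerm]

theorem pairCirc_shiftDiff_snd_pow {Φ : ℤ × ℤ × ℤ → V × V} (h : Φ ∈ poleBounded) (n : ℤ)
    (N : ℕ) :
    pairCirc n ((shiftDiff (0, 1, 0) (0, 0, 1) ^ N : Module.End ℤ (ℤ × ℤ × ℤ → V × V)) Φ) =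
      (shiftDiff (1, 0) (0, 1) ^ N : Module.End ℤ (ℤ × ℤ → V)) (pairCirc n Φ) := by
  induction N with
  | zero => simp
  | succ N ih =>
    rw [pow_succ', pow_succ', Module.End.mul_apply, Module.End.mul_apply, ← ih,
      pairCirc_shiftDiff_snd (pow_mem_of_mapsTo (shiftDiff_mem_poleBounded _ _) _ _ h)]

theorem pairCirc_shiftDiff_fst {Φ : ℤ × ℤ × ℤ → V × V} (h : Φ ∈ poleBounded) (n : ℤ) :
    pairCirc n ((shiftDiff (1, 0, 0) (0, 1, 0) : Module.End ℤ (ℤ × ℤ × ℤ → V × V)) Φ) = pairCirc (n + 1) Φ := by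
  ext ⟨m, r⟩
  obtain ⟨M, hM⟩ := h r
  have := choose_smul_telescope n (fun j => (Φ (n + 1 - j, m + j, r)).1 +
    (n.negOnePow : ℤ) • (Φ (j, m + n + 1 - j, r)).2) (M.toNat + (M - m).toNat) fun j hj => by
      simp [(hM (m + j) (by lia) _).1, (hM j (by lia) _).2]
  refine Eq.trans ?_ (this.trans ?_)
  · refine finsum_congr fun j => ?_
    simp only [pairTerm, shiftDiff_apply, Prod.mk_add_mk, Prod.fst_sub, Prod.snd_sub, add_zero]
    rw [show n - (j : ℤ) + 1 = n + 1 - j by ring,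
      show n + 1 - ((j + 1 : ℕ) : ℤ) = n - j by push_cast; ring,
      show m + ((j + 1 : ℕ) : ℤ) = m + j + 1 by push_cast; ring,
      show m + n + 1 - ((j + 1 : ℕ) : ℤ) = m + n - j by push_cast; ring,
      show m + n - (j : ℤ) + 1 = m + n + 1 - j by ring, Nat.cast_succ]
    congr 1
    simp only [smul_sub]
    abel
  · refine finsum_congr fun j => ?_
    simp only [pairTerm]
    rw [Int.negOnePow_succ, ← add_assoc m]
    simp

theorem pairCirc_shiftDiff_fst_pow {Φ : ℤ × ℤ × ℤ → V × V} (h : Φ ∈ poleBounded) (n : ℤ)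
    (N : ℕ) :
    pairCirc n ((shiftDiff (1, 0, 0) (0, 1, 0) ^ N : Module.End ℤ (ℤ × ℤ × ℤ → V × V)) Φ) =
      pairCirc (n + N) Φ := by
  induction N generalizing Φ with
  | zero => simp
  | succ N ih =>
    rw [pow_succ, Module.End.mul_apply, ih (shiftDiff_mem_poleBounded _ _ _ h),
      pairCirc_shiftDiff_fst h]
    congr 1
    push_cast
    ring

theorem pairCirc_zero (Φ : ℤ × ℤ × ℤ → V × V) (x : ℤ × ℤ) :
    pairCirc 0 Φ x = (Φ (0, x)).1 - (Φ (0, x)).2 := by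
  rw [pairCirc, finsum_eq_single _ 0]
  · simp [pairTerm]
  · intro j hj
    obtain ⟨k, rfl⟩ := Nat.exists_eq_succ_of_ne_zero hj
    simp [pairTerm, Ring.choose_zero_succ]

/-- Pairs with equal components. -/
def diagonalPairs : Submodule ℤ (ℤ × ℤ × ℤ → V × V) where
  carrier := {Φ | ∀ x, (Φ x).1 = (Φ x).2}
  zero_mem' := fun _ => rfl
  add_mem' := fun hΦ hΨ x => by simp [hΦ x, hΨ x]
  smul_mem' := fun c Φ hΦ x => by simp [hΦ x]

theorem shiftDiff_mem_diagonalPairs (g h : ℤ × ℤ × ℤ) :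
    ∀ Φ ∈ (diagonalPairs : Submodule ℤ (ℤ × ℤ × ℤ → V × V)), shiftDiff (M := V × V) g h Φ ∈ diagonalPairs :=
  fun _ hΦ x => by simp [hΦ _]

/-- The kernel of the residue. -/
def pairCircKer (n : ℤ) : Submodule ℤ (ℤ × ℤ × ℤ → V × V) where
  carrier := {Φ | Φ ∈ poleBounded ∧ pairCirc n Φ = 0}
  zero_mem' := ⟨zero_mem _, by
    simpa using pairCirc_smul (zero_mem (poleBounded : Submodule ℤ (ℤ × ℤ × ℤ → V × V))) 0 n⟩
  add_mem' := fun {Φ Ψ} hΦ hΨ => ⟨add_mem hΦ.1 hΨ.1, by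
    have hn : pairCirc n (-Ψ) = 0 := by simpa [hΨ.2] using pairCirc_smul hΨ.1 (-1) n
    rw [← sub_neg_eq_add, pairCirc_sub hΦ.1 (neg_mem hΨ.1), hΦ.2, hn, sub_zero]⟩
  smul_mem' := fun c Φ hΦ => ⟨Submodule.smul_mem _ c hΦ.1, by rw [pairCirc_smul hΦ.1, hΦ.2, smul_zero]⟩

/-- The factor (z₁-z₂)^k makes the total exponent n + k nonnegative, where the two expansions
coincide; the residue is then that of a difference of equal components. -/
theorem pow_mem_pairCircKer {Φ : ℤ × ℤ × ℤ → V × V} (h : Φ ∈ poleBounded)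
    (hd : Φ ∈ diagonalPairs) {n : ℤ} {k : ℕ} (hk : 0 ≤ n + k) :
    (shiftDiff (1, 0, 0) (0, 1, 0) ^ k : Module.End ℤ (ℤ × ℤ × ℤ → V × V)) Φ ∈ pairCircKer n := by
  refine ⟨pow_mem_of_mapsTo (shiftDiff_mem_poleBounded _ _) _ _ h, ?_⟩
  obtain ⟨l, hl⟩ := Int.eq_ofNat_of_zero_le hk
  rw [pairCirc_shiftDiff_fst_pow h, hl, ← zero_add (l : ℤ), ← pairCirc_shiftDiff_fst_pow h]
  ext x
  rw [pairCirc_zero]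
  exact sub_eq_zero.2 (pow_mem_of_mapsTo (shiftDiff_mem_diagonalPairs _ _) _ _ hd _)

/-- Write A, B, D for z₁-z₂, z₁-z₃, z₂-z₃, so that D = B - A, and expand D^(4N) = (B-A)^(3N) D^N. A
term with A^i, i ≤ 2N, contains B^N D^N and kills Φ. If i > 2N, one factor A^N makes the components
equal and the remaining A^(i-N), with i - N ≥ N ≥ -n, clears the pole. -/
theorem exists_pow_mem_pairCircKer {Φ : ℤ × ℤ × ℤ → V × V} (h : Φ ∈ poleBounded) {N : ℕ} {n : ℤ}
    (hn : 0 ≤ n + N)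
    (h1 : (shiftDiff (1, 0, 0) (0, 1, 0) ^ N : Module.End ℤ (ℤ × ℤ × ℤ → V × V)) Φ ∈
      diagonalPairs)
    (h2 : (shiftDiff (1, 0, 0) (0, 0, 1) ^ N : Module.End ℤ (ℤ × ℤ × ℤ → V × V))
      ((shiftDiff (0, 1, 0) (0, 0, 1) ^ N : Module.End ℤ (ℤ × ℤ × ℤ → V × V)) Φ) = 0) :
    (shiftDiff (0, 1, 0) (0, 0, 1) ^ (4 * N) : Module.End ℤ (ℤ × ℤ × ℤ → V × V)) Φ ∈
      pairCircKer n := by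
  set A : Module.End ℤ (ℤ × ℤ × ℤ → V × V) := shiftDiff (1, 0, 0) (0, 1, 0) with hA
  set B : Module.End ℤ (ℤ × ℤ × ℤ → V × V) := shiftDiff (1, 0, 0) (0, 0, 1) with hB
  set D : Module.End ℤ (ℤ × ℤ × ℤ → V × V) := shiftDiff (0, 1, 0) (0, 0, 1) with hD
  have hAB : Commute A B := commute_shiftDiff _ _ _ _
  have hAD : Commute A D := commute_shiftDiff _ _ _ _
  have hDAB : D = -A + B := by rw [hA, hB, hD]; simp only [shiftDiff]; abel
  have hpow : D ^ (4 * N) = ∑ i ∈ Finset.range (3 * N + 1),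
      ((-1 : ℤ) ^ i * ((3 * N).choose i : ℤ)) • (A ^ i * B ^ (3 * N - i) * D ^ N) := by
    rw [show 4 * N = 3 * N + N by ring, pow_add]
    conv_lhs => rw [hDAB, hAB.neg_left.add_pow, ← hDAB]
    rw [Finset.sum_mul]
    refine Finset.sum_congr rfl fun i _ => ?_
    rw [← nsmul_eq_mul', neg_pow, smul_mul_assoc, ← natCast_zsmul, mul_comm ((-1 : ℤ) ^ i),
      ← smul_smul]
    congr 1
    rcases i.even_or_odd with h' | h' <;> simp [h'.neg_one_pow]
  rw [hpow, LinearMap.sum_apply]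
  refine Submodule.sum_mem _ fun i hi => Submodule.smul_mem _ _ ?_
  have hi' : i ≤ 3 * N := by simpa [Nat.lt_succ_iff] using hi
  rcases le_or_gt i (2 * N) with hle | hlt
  · have : A ^ i * B ^ (3 * N - i) * D ^ N = A ^ i * B ^ (3 * N - i - N) * (B ^ N * D ^ N) := by
      rw [← mul_assoc, mul_assoc (A ^ i) _ (B ^ N), ← pow_add]
      congr 3
      lia
    rw [this, Module.End.mul_apply, Module.End.mul_apply (B ^ N), h2, map_zero]
    exact zero_mem _
  · have : A ^ i * B ^ (3 * N - i) * D ^ N =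
        A ^ (i - N) * (B ^ (3 * N - i) * D ^ N * A ^ N) := by
      have hc : Commute (A ^ N) (B ^ (3 * N - i) * D ^ N) :=
        (hAB.pow_pow _ _).mul_right (hAD.pow_pow _ _)
      rw [← hc.eq, ← mul_assoc, ← mul_assoc, ← pow_add, Nat.sub_add_cancel (by lia)]
    rw [this, Module.End.mul_apply]
    refine pow_mem_pairCircKer ?_ ?_ (by lia)
    · rw [Module.End.mul_apply, Module.End.mul_apply]
      exact pow_mem_of_mapsTo (shiftDiff_mem_poleBounded _ _) _ _
        (pow_mem_of_mapsTo (shiftDiff_mem_poleBounded _ _) _ _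
          (pow_mem_of_mapsTo (shiftDiff_mem_poleBounded _ _) _ _ h))
    · rw [Module.End.mul_apply, Module.End.mul_apply]
      exact pow_mem_of_mapsTo (shiftDiff_mem_diagonalPairs _ _) _ _
        (pow_mem_of_mapsTo (shiftDiff_mem_diagonalPairs _ _) _ _ h1)

variable [Module ℂ V]

/-- **Dong's lemma**: circle products of fields quantum commuting with `d` and with each other
quantum commute with `d`. -/
theorem QuantumCommute.circ_left {a b d : QO V} (hab : QuantumCommute a b)
    (had : QuantumCommute a d) (hbd : QuantumCommute b d) (n : ℤ) :
    QuantumCommute (circ a n b) d := by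
  obtain ⟨N₁, h₁⟩ := hab.exists_le
  obtain ⟨N₂, h₂⟩ := had.exists_le
  obtain ⟨N₃, h₃⟩ := hbd.exists_le
  set N := max (max N₁ N₂) (max N₃ n.natAbs) with hN
  replace h₁ := h₁ N (by lia)
  replace h₂ := h₂ N (by lia)
  replace h₃ := h₃ N (by lia)
  refine quantumCommute_iff.2 ⟨4 * N, ?_⟩
  ext y x
  let ev : Module.End ℂ V →+ V := AddMonoidHom.mk' (fun T => T x) fun _ _ => rfl
  -- The components are the modes of [a(z₁)b(z₂), d(z₃)] and [b(z₂)a(z₁), d(z₃)] applied to x.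
  let Φ : ℤ × ℤ × ℤ → V × V := fun p =>
    ((a[[p.1]]) ((b[[p.2.1]]) ((d[[p.2.2]]) x)) - (d[[p.2.2]]) ((a[[p.1]]) ((b[[p.2.1]]) x)),
      (b[[p.2.1]]) ((a[[p.1]]) ((d[[p.2.2]]) x)) - (d[[p.2.2]]) ((b[[p.2.1]]) ((a[[p.1]]) x)))
  have hΦ : Φ ∈ poleBounded := by
    intro r
    obtain ⟨M₁, hM₁⟩ := exists_mode_eq_zero a x
    obtain ⟨M₂, hM₂⟩ := exists_mode_eq_zero b x
    obtain ⟨M₃, hM₃⟩ := exists_mode_eq_zero a ((d[[r]]) x)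
    obtain ⟨M₄, hM₄⟩ := exists_mode_eq_zero b ((d[[r]]) x)
    refine ⟨max (max M₁ M₂) (max M₃ M₄), fun k hk p => ?_⟩
    simp [Φ, hM₁ k (by lia), hM₂ k (by lia), hM₃ k (by lia), hM₄ k (by lia)]
  have hev : (fun z => ev (modeBracket (circ a n b) d z)) = pairCirc n Φ := by
    ext ⟨m, r⟩
    change (⁅(circ a n b)[[m]], d[[r]]⁆ : Module.End ℂ V) x = _
    rw [Ring.lie_def, LinearMap.sub_apply, Module.End.mul_apply, Module.End.mul_apply, circ_mode,
      circ_mode, map_finsum (d[[r]]) (circTerm_finite a b n m x), ← finsum_sub_distrib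
        (circTerm_finite a b n m _)]
    · refine finsum_congr fun j => ?_
      simp only [circTerm, pairTerm, map_zsmul, map_sub, ← smul_sub, Φ]
      congr 1
      simp only [smul_sub]
      abel
    · refine (circTerm_finite a b n m x).subset fun j hj hj' => hj ?_
      simp only [hj', map_zero]
  have key : pairCirc n ((shiftDiff (0, 1, 0) (0, 0, 1) ^ (4 * N) :
      Module.End ℤ (ℤ × ℤ × ℤ → V × V)) Φ) = 0 := by
    refine (exists_pow_mem_pairCircKer hΦ (N := N) (by lia) ?_ ?_).2
    -- The difference of the components is [[a, b], d], which (z₁-z₂)^N kills.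
    · intro y
      let f : V × V →+ V := AddMonoidHom.fst V V - AddMonoidHom.snd V V
      let f' : Module.End ℂ V →+ V :=
        AddMonoidHom.mk' (fun T => T ((d[[y.2.2]]) x) - (d[[y.2.2]]) (T x)) fun S T => by
          simp only [LinearMap.add_apply, map_add]; abel
      have e₁ := congrFun (shiftDiff_pow_comp f (fun p : ℤ × ℤ => (p.1, p.2, y.2.2))
        (e₁ := (1, 0)) (e₂ := (0, 1)) (E₁ := (1, 0, 0)) (E₂ := (0, 1, 0)) (by simp) (by simp) Φ N)
        (y.1, y.2.1)
      have e₂ := congrFun (shiftDiff_pow_comp f' (fun p : ℤ × ℤ => p)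
        (e₁ := (1, 0)) (e₂ := (0, 1)) (E₁ := (1, 0)) (E₂ := (0, 1)) (by simp) (by simp)
        (modeBracket a b) N) (y.1, y.2.1)
      have e₃ : (fun p : ℤ × ℤ => f (Φ (p.1, p.2, y.2.2))) = fun p => f' (modeBracket a b p) := by
        ext p
        simp only [f, f', Φ, modeBracket, Ring.lie_def, AddMonoidHom.sub_apply,
          AddMonoidHom.coe_fst, AddMonoidHom.coe_snd, AddMonoidHom.mk'_apply, Module.End.mul_apply,
          map_sub]
      rw [e₃, e₂, h₁] at e₁
      exact sub_eq_zero.1 (e₁.symm.trans (map_zero f'))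
    -- By the Leibniz rule the commutator splits into a part containing [b, d], killed by (z₂-z₃)^N,
    -- and a part containing [a, d], killed by (z₁-z₃)^N.
    · let Φ₁ : ℤ × ℤ × ℤ → V × V := fun p =>
        ((a[[p.1]]) (modeBracket b d p.2 x), modeBracket b d p.2 ((a[[p.1]]) x))
      let Φ₂ : ℤ × ℤ × ℤ → V × V := fun p =>
        (modeBracket a d (p.1, p.2.2) ((b[[p.2.1]]) x), (b[[p.2.1]]) (modeBracket a d (p.1, p.2.2) x))
      have e : Φ = Φ₁ + Φ₂ := by
        ext p
        · simp [Φ, Φ₁, Φ₂, modeBracket, Ring.lie_def]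
        · simp [Φ, Φ₁, Φ₂, modeBracket, Ring.lie_def]
      have hΦ₁ : (shiftDiff (0, 1, 0) (0, 0, 1) ^ N : Module.End ℤ (ℤ × ℤ × ℤ → V × V)) Φ₁ = 0 := by
        ext1 y
        let f : Module.End ℂ V →+ V × V :=
          AddMonoidHom.mk' (fun T => ((a[[y.1]]) (T x), T ((a[[y.1]]) x))) fun S T => by simp
        have e₁ := congrFun (shiftDiff_pow_comp f (fun p : ℤ × ℤ => p)
          (e₁ := (1, 0)) (e₂ := (0, 1)) (E₁ := (1, 0)) (E₂ := (0, 1)) (by simp) (by simp)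
          (modeBracket b d) N) y.2
        have e₂ := congrFun (shiftDiff_pow_comp (AddMonoidHom.id (V × V))
          (fun p : ℤ × ℤ => (y.1, p)) (e₁ := (1, 0)) (e₂ := (0, 1)) (E₁ := (0, 1, 0))
          (E₂ := (0, 0, 1)) (by simp) (by simp) Φ₁ N) y.2
        rw [h₃] at e₁
        exact e₂.symm.trans (e₁.trans (map_zero f))
      have hΦ₂ : (shiftDiff (1, 0, 0) (0, 0, 1) ^ N : Module.End ℤ (ℤ × ℤ × ℤ → V × V)) Φ₂ = 0 := by
        ext1 y
        let f : Module.End ℂ V →+ V × V :=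
          AddMonoidHom.mk' (fun T => (T ((b[[y.2.1]]) x), (b[[y.2.1]]) (T x))) fun S T => by simp
        have e₁ := congrFun (shiftDiff_pow_comp f (fun p : ℤ × ℤ => p)
          (e₁ := (1, 0)) (e₂ := (0, 1)) (E₁ := (1, 0)) (E₂ := (0, 1)) (by simp) (by simp)
          (modeBracket a d) N) (y.1, y.2.2)
        have e₂ := congrFun (shiftDiff_pow_comp (AddMonoidHom.id (V × V))
          (fun p : ℤ × ℤ => (p.1, y.2.1, p.2)) (e₁ := (1, 0)) (e₂ := (0, 1)) (E₁ := (1, 0, 0))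
          (E₂ := (0, 0, 1)) (by simp) (by simp) Φ₂ N) (y.1, y.2.2)
        rw [h₂] at e₁
        exact e₂.symm.trans (e₁.trans (map_zero f))
      have hc : Commute
          (shiftDiff (1, 0, 0) (0, 0, 1) ^ N : Module.End ℤ (ℤ × ℤ × ℤ → V × V))
          (shiftDiff (0, 1, 0) (0, 0, 1) ^ N) := (commute_shiftDiff _ _ _ _).pow_pow _ _
      rw [e, map_add, hΦ₁, zero_add, ← Module.End.mul_apply, hc.eq, Module.End.mul_apply, hΦ₂,
        map_zero]
  have e₁ := congrFun (shiftDiff_pow_comp ev (fun p : ℤ × ℤ => p)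
    (e₁ := (1, 0)) (e₂ := (0, 1)) (E₁ := (1, 0)) (E₂ := (0, 1)) (by simp) (by simp)
    (modeBracket (circ a n b) d) (4 * N)) y
  rw [hev, ← pairCirc_shiftDiff_snd_pow hΦ, key] at e₁
  exact e₁.symm

theorem isQOA_generated (S : Set (QO V)) : IsQOA (generated S) where
  one_mem := Submodule.mem_sInf.2 fun _ hA => hA.1.one_mem
  circ_mem a ha b hb n := Submodule.mem_sInf.2 fun A hA =>
    hA.1.circ_mem a (Submodule.mem_sInf.1 ha A hA) b (Submodule.mem_sInf.1 hb A hA) n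

theorem subset_generated (S : Set (QO V)) : S ⊆ generated S :=
  fun _ hs => Submodule.mem_sInf.2 fun _ hA => hA.2 hs

theorem generated_le {S : Set (QO V)} {A : Submodule ℂ (QO V)} (hA : IsQOA A) (h : S ⊆ A) :
    generated S ≤ A := sInf_le ⟨hA, h⟩

/-- A set of pairwise quantum commuting fields generates a vertex algebra. -/
theorem isVertexAlgebra_generated {S : Set (QO V)}
    (hS : ∀ a ∈ S, ∀ b ∈ S, QuantumCommute a b) : IsVertexAlgebra (generated S) := by
  -- A maximal set of pairwise local fields containing S is, by Dong's lemma and maximality, a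
  -- subspace closed under circle products, so it contains everything S generates.
  obtain ⟨T, hST, hT⟩ := zorn_subset_nonempty
    {T : Set (QO V) | ∀ a ∈ T, ∀ b ∈ T, QuantumCommute a b} (fun c hc hchain _ =>
      ⟨⋃₀ c, fun a ⟨t, ht, hat⟩ b ⟨u, hu, hbu⟩ => by
        rcases hchain.total ht hu with h | h
        · exact hc hu a (h hat) b hbu
        · exact hc ht a hat b (h hbu),
        fun t ht => Set.subset_sUnion_of_mem ht⟩) S hS
  have hmax {x : QO V} (h : ∀ a ∈ T, QuantumCommute a x) (hx : QuantumCommute x x) : x ∈ T := by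
    refine hT.2 (y := insert x T) ?_ (Set.subset_insert x T) (Set.mem_insert x T)
    rintro a (rfl | ha) b (rfl | hb)
    exacts [hx, (h b hb).symm, h a ha, hT.1 a ha b hb]
  have hadd {x y : QO V} (hx : x ∈ T) (hy : y ∈ T) : x + y ∈ T := by
    have h (a) (ha : a ∈ T) : QuantumCommute a (x + y) :=
      (hT.1 a ha x hx).add_right (hT.1 a ha y hy)
    exact hmax h ((h x hx).symm.add_right (h y hy).symm)
  have hsmul (c : ℂ) {x : QO V} (hx : x ∈ T) : c • x ∈ T := by
    have h (a) (ha : a ∈ T) : QuantumCommute a (c • x) := (hT.1 a ha x hx).smul_right c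
    exact hmax h ((h x hx).symm.smul_right c)
  have hone : one ∈ T :=
    hmax (fun a _ => (fieldsCommute_one a).quantumCommute) (fieldsCommute_one _).quantumCommute
  have hcirc {x y : QO V} (hx : x ∈ T) (hy : y ∈ T) (n : ℤ) : circ x n y ∈ T := by
    have h (a) (ha : a ∈ T) : QuantumCommute a (circ x n y) :=
      ((hT.1 x hx y hy).circ_left (hT.1 x hx a ha) (hT.1 y hy a ha) n).symm
    exact hmax h ((hT.1 x hx y hy).circ_left (h x hx) (h y hy) n)
  let A : Submodule ℂ (QO V) :=
    { carrier := T
      add_mem' := hadd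
      zero_mem' := by simpa using hsmul 0 hone
      smul_mem' := fun c _ hx => hsmul c hx }
  have hle : generated S ≤ A := generated_le ⟨hone, fun a ha b hb n => hcirc ha hb n⟩ hST
  exact ⟨isQOA_generated S, fun a ha b hb => hT.1 a (hle ha) b (hle hb)⟩

theorem IsQOA.deriv_mem {A : Submodule ℂ (QO V)} (hA : IsQOA A) {a : QO V} (ha : a ∈ A) :
    deriv a ∈ A := circ_neg_two_one a ▸ hA.circ_mem a ha one hA.one_mem _

theorem IsQOA.wick_mem {A : Submodule ℂ (QO V)} (hA : IsQOA A) {a b : QO V} (ha : a ∈ A)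
    (hb : b ∈ A) : wick a b ∈ A := hA.circ_mem a ha b hb _

theorem IsQOA.span_wickMonomials_le {A : Submodule ℂ (QO V)} (hA : IsQOA A) {S : Set (QO V)}
    (hS : S ⊆ A) : Submodule.span ℂ (wickMonomials S) ≤ A := by
  refine Submodule.span_le.2 ?_
  rintro _ ⟨l, hl, rfl⟩
  induction l with
  | nil => exact hA.one_mem
  | cons p l ih =>
    refine hA.wick_mem ?_ (ih fun q hq => hl q (List.mem_cons_of_mem _ hq))
    have hp : p.2 ∈ A := hS (hl p List.mem_cons_self)
    induction p.1 with
    | zero => exact hp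
    | succ k ihk => rw [Function.iterate_succ_apply']; exact hA.deriv_mem ihk

theorem IsQOA.commutant {A B : Submodule ℂ (QO V)} (hB : IsQOA B) :
    IsQOA (commutant A B) where
  one_mem := ⟨hB.one_mem, fun a _ => fieldsCommute_one a⟩
  circ_mem a ha b hb n :=
    ⟨hB.circ_mem a ha.1 b hb.1 n, fun e he => (ha.2 e he).circ_right (hb.2 e he) n⟩

/-- A field commuting with a set of fields commutes with the algebra they generate. -/
theorem fieldsCommute_of_mem_generated {S : Set (QO V)} {v : QO V}
    (h : ∀ a ∈ S, FieldsCommute a v) {a : QO V} (ha : a ∈ generated S) : FieldsCommute a v := by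
  -- The fields commuting with v are closed under circle products; v enters as the line it spans
  -- because commutants are taken of subspaces.
  have hA : IsQOA (BetaGamma.commutant (Submodule.span ℂ {v}) ⊤) :=
    IsQOA.commutant ⟨trivial, fun _ _ _ _ _ => trivial⟩
  refine ((generated_le hA fun s hs => ⟨trivial, fun w hw => ?_⟩) ha).2 v
    (Submodule.mem_span_singleton_self v) |>.symm
  obtain ⟨c, rfl⟩ := Submodule.mem_span_singleton.1 hw
  intro m n
  rw [map_smul, Pi.smul_apply]
  exact ((h s hs).symm m n).smul_left c

end Dong

/-! ### States -/

section State

variable {V : Type*} [AddCommGroup V] [Module ℂ V]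

/-- The fields all of whose nonnegative modes kill `Ω`. -/
def creative (Ω : V) : Submodule ℂ (QO V) where
  carrier := {a | ∀ n : ℤ, 0 ≤ n → (a[[n]]) Ω = 0}
  zero_mem' n _ := by simp
  add_mem' ha hb n hn := by simp [ha n hn, hb n hn]
  smul_mem' c a ha n hn := by simp [ha n hn]

theorem isQOA_creative (Ω : V) : IsQOA (creative Ω) where
  one_mem n hn := by rw [one_mode, if_neg (by lia)]; rfl
  circ_mem a ha b hb n m hm := by
    rw [circ_mode]
    refine (finsum_congr fun j => ?_).trans finsum_zero
    simp [circTerm, ha j (by lia), hb (m + j) (by lia)]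

/-- The state `a(-1)Ω` of a field. -/
def state (Ω : V) : QO V →ₗ[ℂ] V where
  toFun a := (a[[-1]]) Ω
  map_add' a b := by simp
  map_smul' c a := by simp

theorem state_apply (Ω : V) (a : QO V) : state Ω a = (a[[-1]]) Ω := rfl

theorem state_one (Ω : V) : state Ω one = Ω := by
  rw [state_apply, one_mode, if_pos rfl]; rfl

/-- Nonnegative modes kill Ω, so only the term j = 0 of the first expansion survives. -/
theorem state_circ {Ω : V} {a b : QO V} (ha : a ∈ creative Ω) (hb : b ∈ creative Ω) (n : ℤ) :
    state Ω (circ a n b) = (a[[n]]) (state Ω b) := by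
  rw [state_apply, circ_mode, finsum_eq_single _ 0]
  · simp [circTerm, ha 0 le_rfl, state_apply]
  · intro j hj
    simp [circTerm, ha j (by lia), hb (-1 + j) (by lia)]

theorem succ_smul_signed_choose (n : ℤ) (j : ℕ) :
    ((j : ℤ) + 1) * ((-1 : ℤ) ^ (j + 1) * Ring.choose n (j + 1)) =
      -((n - j) * ((-1 : ℤ) ^ j * Ring.choose n j)) := by
  have := Ring.choose_smul_choose n (Nat.le_succ j)
  rw [Nat.choose_succ_self_right, Nat.succ_sub (le_refl j), Nat.sub_self, Ring.choose_one_right,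
    nsmul_eq_mul] at this
  push_cast at this
  rw [pow_succ]
  linear_combination (-(-1) ^ j) * this

/-- The coefficient form of (∂_z + ∂_w)(z-w)^n = 0; the recursion of the signed binomials makes the
sum telescope. It yields the Leibniz rule of translation for circle products. -/
theorem sum_signed_choose_shift {M : Type*} [AddCommGroup M] (n : ℤ) (A : ℕ → M) (N : ℕ) (hA : A (N + 1) = 0) :
    ∑ j ∈ Finset.range (N + 1), ((-1 : ℤ) ^ j * Ring.choose n j) •
      ((j : ℤ) • A j + (n - j) • A (j + 1)) = 0 := by
  have := Finset.sum_range_sub' (fun j : ℕ =>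
    ((j : ℤ) * ((-1 : ℤ) ^ j * Ring.choose n j)) • A j) (N + 1)
  rw [hA, smul_zero, sub_zero, Nat.cast_zero, zero_mul, zero_smul] at this
  rw [← this]
  refine Finset.sum_congr rfl fun j _ => ?_
  rw [Nat.cast_succ, succ_smul_signed_choose, neg_smul, sub_neg_eq_add, smul_add, smul_smul,
    smul_smul, mul_comm, mul_comm (n - (j : ℤ))]

/-- The fields satisfying `[T, a(z)] = ∂a(z)`. -/
def translationCovariant (T : Module.End ℂ V) : Submodule ℂ (QO V) where
  carrier := {a | ∀ (n : ℤ) (x : V), T ((a[[n]]) x) = (a[[n]]) (T x) - n • (a[[n - 1]]) x}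
  zero_mem' n x := by simp
  add_mem' ha hb n x := by
    simp only [map_add, Pi.add_apply, LinearMap.add_apply, ha n x, hb n x, smul_add]
    abel
  smul_mem' c a ha n x := by
    simp only [map_smul, Pi.smul_apply, LinearMap.smul_apply, ha n x, smul_sub, smul_comm n c]

theorem isQOA_translationCovariant (T : Module.End ℂ V) : IsQOA (translationCovariant T) where
  one_mem n x := by
    rw [one_mode, one_mode]
    rcases eq_or_ne n 0 with rfl | hn
    · simp
    · split_ifs <;> first | lia | simp
  circ_mem a ha b hb n m x := by
    obtain ⟨N, hN⟩ : ∃ N : ℕ, ∀ j : ℕ, N ≤ j → (a[[(j : ℤ)]]) x = 0 ∧ (a[[(j : ℤ)]]) (T x) = 0 ∧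
        (b[[m - 1 + j]]) x = 0 ∧ (b[[m + j]]) x = 0 ∧ (b[[m + j]]) (T x) = 0 ∧
        (a[[(j : ℤ) - 1]]) x = 0 := by
      obtain ⟨M₁, h₁⟩ := exists_mode_eq_zero a x
      obtain ⟨M₂, h₂⟩ := exists_mode_eq_zero a (T x)
      obtain ⟨M₃, h₃⟩ := exists_mode_eq_zero b x
      obtain ⟨M₄, h₄⟩ := exists_mode_eq_zero b (T x)
      refine ⟨(max (max (M₁ + 1) M₂) (max (M₃ - m + 1) (M₄ - m))).toNat, fun j hj => ?_⟩
      exact ⟨h₁ _ (by lia), h₂ _ (by lia), h₃ _ (by lia), h₃ _ (by lia), h₄ _ (by lia),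
        h₁ _ (by lia)⟩
    rw [circ_mode_eq_sum a b n m x (N := N + 1), circ_mode_eq_sum a b n m (T x) (N := N + 1),
      circ_mode_eq_sum a b n (m - 1) x (N := N + 1), map_sum]
    -- One telescoping identity for each of the two expansions; together they account for the defect
    -- in the Leibniz rule.
    · have eA := sum_signed_choose_shift n (fun j => (a[[n - j]]) ((b[[m - 1 + j]]) x)) N (by
        simp only [(hN (N + 1) (by lia)).2.2.1, map_zero])
      have eB := sum_signed_choose_shift n
        (fun j => (b[[m + n - j]]) ((a[[(j : ℤ) - 1]]) x)) N (by
        simp only [(hN (N + 1) (by lia)).2.2.2.2.2, map_zero])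
      rw [← sub_eq_zero, ← Finset.smul_sum.symm, ← Finset.sum_sub_distrib,
        ← Finset.sum_sub_distrib]
      have eC := congrArg₂ (fun u v => -u + (n.negOnePow : ℤ) • v) eA eB
      simp only [neg_zero, smul_zero, add_zero] at eC
      rw [← eC, Finset.smul_sum, ← Finset.sum_neg_distrib, ← Finset.sum_add_distrib]
      refine Finset.sum_congr rfl fun j _ => ?_
      simp only [circTerm, map_zsmul, map_sub, ha _ _, hb _ _]
      rw [smul_comm (n.negOnePow : ℤ), smul_comm m, ← smul_neg, ← smul_sub, ← smul_sub,
        ← smul_add]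
      congr 1
      push_cast
      rw [show n - ((j : ℤ) + 1) = n - j - 1 by ring, show m - 1 + ((j : ℤ) + 1) = m + j by ring,
        show m - 1 + (j : ℤ) = m + j - 1 by ring, show m - 1 + n - (j : ℤ) = m + n - j - 1 by ring,
        show m + n - ((j : ℤ) + 1) = m + n - j - 1 by ring,
        show (j : ℤ) + 1 - 1 = j by ring]
      module
    · intro j hj
      obtain ⟨h1, h2, h3, h4, h5, h6⟩ := hN j (by lia)
      simp [circTerm, h1, h3]
    · intro j hj
      obtain ⟨h1, h2, h3, h4, h5, h6⟩ := hN j (by lia)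
      simp [circTerm, h2, h5]
    · intro j hj
      obtain ⟨h1, h2, h3, h4, h5, h6⟩ := hN j (by lia)
      simp [circTerm, h1, h4]

/-- Since T kills Ω, covariance makes a(n-1)Ω a multiple of T a(n)Ω for n < 0, so all negative modes
follow from a(-1)Ω = 0. -/
theorem mode_neg_eq_zero {Ω : V} {T : Module.End ℂ V} (hT : T Ω = 0) {a : QO V}
    (ha : a ∈ creative Ω) (ha' : a ∈ translationCovariant T) (h0 : state Ω a = 0) (n : ℤ) :
    (a[[n]]) Ω = 0 := by
  rcases le_or_gt 0 n with hn | hn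
  · exact ha n hn
  obtain ⟨k, rfl⟩ : ∃ k : ℕ, n = -1 - k := ⟨(-1 - n).toNat, by lia⟩
  clear hn
  induction k with
  | zero => simpa [state_apply] using h0
  | succ k ih =>
    have := ha' (-1 - k) Ω
    rw [ih, hT, map_zero, map_zero, zero_sub, eq_comm, neg_eq_zero, ← Int.cast_smul_eq_zsmul ℂ,
      smul_eq_zero] at this
    rcases this with h | h
    · exact absurd (Int.cast_eq_zero.1 h) (by lia)
    · rwa [show -1 - ((k + 1 : ℕ) : ℤ) = -1 - k - 1 by push_cast; ring]

/-- If `a` and `b` are quantum commuting and `a(z)x = 0` then `a(z)b(w)x = 0`. -/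
theorem QuantumCommute.mode_mode_eq_zero {a b : QO V} (h : QuantumCommute a b) {x : V}
    (hx : ∀ n, (a[[n]]) x = 0) (p q : ℤ) : (a[[p]]) ((b[[q]]) x) = 0 := by
  obtain ⟨N, hN⟩ := h
  obtain ⟨M, hM⟩ := exists_mode_eq_zero b x
  -- Descend from the bound M above which b kills x: in the locality relation the term j = 0 is the
  -- wanted one and the others have larger modes of b.
  have key (k : ℕ) (p : ℤ) : (a[[p]]) ((b[[M - k]]) x) = 0 := by
    induction k using Nat.strong_induction_on generalizing p with
    | _ k ih =>
      have := LinearMap.congr_fun (hN (p - N) (M - k)) x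
      rw [Finset.sum_range_succ', LinearMap.add_apply, LinearMap.sum_apply,
        Finset.sum_eq_zero] at this
      · simpa [Ring.lie_def, hx] using this
      · intro j hj
        rcases le_or_gt (j + 1) k with hle | hlt
        · have e : M - (k : ℤ) + ((j + 1 : ℕ) : ℤ) = M - ((k - (j + 1) : ℕ) : ℤ) := by
            push_cast [Nat.cast_sub hle]; ring
          rw [e]
          simp [Ring.lie_def, hx, ih (k - (j + 1)) (by lia)]
        · simp [Ring.lie_def, hx, hM (M - (k : ℤ) + ((j : ℤ) + 1)) (by lia)]
  rcases le_or_gt M q with hq | hq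
  · rw [hM q hq, map_zero]
  · have := key (M - q).toNat p
    rwa [show M - ((M - q).toNat : ℤ) = q by lia] at this

/-- The fields quantum commuting with `a`. -/
def quantumCentralizer (a : QO V) : Submodule ℂ (QO V) where
  carrier := {b | QuantumCommute a b}
  zero_mem' := ⟨0, fun m n => by simp [Ring.lie_def]⟩
  add_mem' := QuantumCommute.add_right
  smul_mem' c _ hb := QuantumCommute.smul_right hb c

end State

/-! ### The Fock space -/

section FockSpace

open MvPolynomial

variable {ι : Type}

theorem create_apply (s : (ι × ℕ) ⊕ (ι × ℕ)) (f : Fock ι) : create s f = X s * f := rfl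

theorem annihilate_apply (s : (ι × ℕ) ⊕ (ι × ℕ)) (f : Fock ι) :
    annihilate s f = pderiv s f := rfl

theorem annihilate_one (s : (ι × ℕ) ⊕ (ι × ℕ)) : annihilate s (1 : Fock ι) = 0 := pderiv_one

theorem create_create (s t : (ι × ℕ) ⊕ (ι × ℕ)) (f : Fock ι) :
    create s (create t f) = create t (create s f) := by
  simp only [create_apply]
  ring

theorem annihilate_annihilate (s t : (ι × ℕ) ⊕ (ι × ℕ)) (f : Fock ι) :
    annihilate s (annihilate t f) = annihilate t (annihilate s f) := by
  classical
  have h : ⁅(pderiv s : Derivation ℂ (Fock ι) (Fock ι)),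
      (pderiv t : Derivation ℂ (Fock ι) (Fock ι))⁆ = 0 := by
    refine MvPolynomial.derivation_ext fun u => ?_
    simp only [Derivation.commutator_apply, pderiv_X, Pi.single_apply, Derivation.coe_zero,
      Pi.zero_apply]
    split_ifs <;> simp
  exact sub_eq_zero.1 (congrArg (fun D : Derivation ℂ (Fock ι) (Fock ι) => D f) h)

theorem annihilate_create [DecidableEq ι] (s t : (ι × ℕ) ⊕ (ι × ℕ)) (f : Fock ι) :
    annihilate s (create t f) = create t (annihilate s f) + if s = t then f else 0 := by
  simp only [create_apply, annihilate_apply, pderiv_mul, pderiv_X, Pi.single_apply,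
    eq_comm (a := t)]
  split_ifs <;> ring

theorem annihilate_create_of_ne {s t : (ι × ℕ) ⊕ (ι × ℕ)} (h : s ≠ t) (f : Fock ι) :
    annihilate s (create t f) = create t (annihilate s f) := by
  classical
  rw [annihilate_create, if_neg h, add_zero]

theorem betaField_mode (i : ι) (n : ℤ) : (betaField i)[[n]] = betaMode i n := ofModes_mode _ _ _

theorem gammaField_mode (i : ι) (n : ℤ) : (gammaField i)[[n]] = gammaMode i n :=
  ofModes_mode _ _ _

theorem betaMode_ofNat (i : ι) (k : ℕ) (f : Fock ι) :
    betaMode i (Int.ofNat k) f = annihilate (Sum.inr (i, k)) f := rfl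

theorem betaMode_negSucc (i : ι) (k : ℕ) (f : Fock ι) :
    betaMode i (Int.negSucc k) f = create (Sum.inl (i, k)) f := rfl

theorem gammaMode_ofNat (i : ι) (k : ℕ) (f : Fock ι) :
    gammaMode i (Int.ofNat k) f = -annihilate (Sum.inl (i, k)) f := rfl

theorem gammaMode_negSucc (i : ι) (k : ℕ) (f : Fock ι) :
    gammaMode i (Int.negSucc k) f = create (Sum.inr (i, k)) f := rfl

theorem betaMode_betaMode (i j : ι) (m n : ℤ) (f : Fock ι) :
    betaMode i m (betaMode j n f) = betaMode j n (betaMode i m f) := by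
  rcases m with k | k <;> rcases n with l | l <;> simp only [betaMode_ofNat, betaMode_negSucc]
  · exact annihilate_annihilate _ _ _
  · exact annihilate_create_of_ne (by simp) _
  · exact (annihilate_create_of_ne (by simp) _).symm
  · exact create_create _ _ _

theorem gammaMode_gammaMode (i j : ι) (m n : ℤ) (f : Fock ι) :
    gammaMode i m (gammaMode j n f) = gammaMode j n (gammaMode i m f) := by
  rcases m with k | k <;> rcases n with l | l <;>
    simp only [gammaMode_ofNat, gammaMode_negSucc, map_neg, neg_inj]
  · rw [annihilate_annihilate]
  · exact annihilate_create_of_ne (by simp) _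
  · exact (annihilate_create_of_ne (by simp) _).symm
  · exact create_create _ _ _

theorem betaMode_gammaMode [DecidableEq ι] (i j : ι) (m n : ℤ) (f : Fock ι) :
    betaMode i m (gammaMode j n f) =
      gammaMode j n (betaMode i m f) + if i = j ∧ m + n = -1 then f else 0 := by
  rcases m with k | k <;> rcases n with l | l <;>
    simp only [betaMode_ofNat, betaMode_negSucc, gammaMode_ofNat, gammaMode_negSucc, map_neg]
  · rw [if_neg (by simp; lia), annihilate_annihilate, add_zero]
  · rw [annihilate_create]
    congr 1
    refine if_congr ?_ rfl rfl
    simp only [Sum.inr.injEq, Prod.mk.injEq, Int.ofNat_eq_natCast, Int.negSucc_eq]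
    lia
  · rw [annihilate_create, neg_add, add_assoc, left_eq_add, neg_add_eq_zero]
    refine if_congr ?_ rfl rfl
    simp only [Sum.inl.injEq, Prod.mk.injEq, Int.ofNat_eq_natCast, Int.negSucc_eq]
    rw [eq_comm (a := i)]
    lia
  · rw [if_neg (by simp only [Int.negSucc_eq]; lia), create_create, add_zero]

theorem quantumCommute_betaField_gammaField (i j : ι) :
    QuantumCommute (betaField i) (gammaField j) := by
  classical
  have h (m n : ℤ) : ⁅(betaField i)[[m]], (gammaField j)[[n]]⁆ =
      if i = j ∧ m + n = -1 then 1 else 0 := by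
    refine LinearMap.ext fun f => ?_
    rw [betaField_mode, gammaField_mode]
    refine (sub_eq_iff_eq_add'.2 (betaMode_gammaMode i j m n f)).trans ?_
    split_ifs <;> rfl
  refine ⟨1, fun m n => ?_⟩
  simp only [Finset.sum_range_succ, Finset.sum_range_zero, h, Nat.cast_one, Nat.cast_zero,
    sub_zero, add_zero, zero_add, add_sub_cancel_right]
  rw [show m + 1 + n = m + (n + 1) by ring, ← add_smul]
  simp

/-- The translation operator of the Fock space. -/
def translation : Derivation ℂ (Fock ι) (Fock ι) :=
  mkDerivation ℂ (Sum.elim (fun p => ((p.2 : ℂ) + 1) • X (Sum.inl (p.1, p.2 + 1)))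
    fun p => ((p.2 : ℂ) + 1) • X (Sum.inr (p.1, p.2 + 1)))

theorem translation_create (f : Fock ι) (s : (ι × ℕ) ⊕ (ι × ℕ)) :
    translation (create s f) = create s (translation f) + translation (X s) * f := by
  rw [create_apply, create_apply, Derivation.leibniz, smul_eq_mul, smul_eq_mul, mul_comm f]

/-- A commutator of derivations is a derivation, so comparing on variables suffices. The truncated
index k - 1 is harmless at k = 0, where its coefficient vanishes. -/
theorem translation_annihilate (e : ι × ℕ → (ι × ℕ) ⊕ (ι × ℕ)) (he : e = Sum.inl ∨ e = Sum.inr)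
    (i : ι) (k : ℕ) (f : Fock ι) :
    translation (annihilate (e (i, k)) f) = annihilate (e (i, k)) (translation f) -
      (k : ℂ) • annihilate (e (i, k - 1)) f := by
  classical
  have h : ⁅(translation : Derivation ℂ (Fock ι) (Fock ι)),
      (pderiv (e (i, k)) : Derivation ℂ (Fock ι) (Fock ι))⁆ =
      -((k : ℂ) • pderiv (e (i, k - 1))) := by
    refine MvPolynomial.derivation_ext fun u => ?_
    rw [Derivation.commutator_apply, pderiv_X, Pi.single_apply]
    have h0 : translation (if u = e (i, k) then 1 else 0 : Fock ι) = 0 := by split_ifs <;> simp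
    rw [h0, zero_sub, Derivation.neg_apply, Derivation.smul_apply, pderiv_X, Pi.single_apply,
      translation, mkDerivation_X]
    congr 1
    rcases he with rfl | rfl <;> rcases u with ⟨j, l⟩ | ⟨j, l⟩ <;>
      simp only [Sum.elim_inl, Sum.elim_inr, Derivation.map_smul, pderiv_X, Pi.single_apply,
        Sum.inl.injEq, Sum.inr.injEq, Prod.mk.injEq, reduceCtorEq, if_false, smul_zero] <;>
    · by_cases hk : k = 0
      · subst hk; simp
      · have : (j = i ∧ l + 1 = k) ↔ (j = i ∧ l = k - 1) := by lia
        simp only [this]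
        split_ifs with hc
        · congr 1
          rw [hc.2]
          push_cast [Nat.cast_sub (Nat.one_le_iff_ne_zero.2 hk)]
          ring
        · simp
  have := congrArg (fun D : Derivation ℂ (Fock ι) (Fock ι) => D f) h
  simp only [Derivation.commutator_apply, Derivation.neg_apply, Derivation.smul_apply] at this
  simp only [annihilate_apply]
  rw [sub_eq_iff_eq_add.1 this]
  abel

theorem betaField_mem_translationCovariant (i : ι) :
    betaField i ∈ translationCovariant (translation (ι := ι)).toLinearMap := by
  intro n x
  rw [betaField_mode, betaField_mode]
  rcases n with k | k
  · have := translation_annihilate Sum.inr (Or.inr rfl) i k x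
    rcases k with _ | k
    · simpa [betaMode] using this
    · have e : Int.ofNat (k + 1) - 1 = Int.ofNat k := by simp
      rw [e]
      simp only [betaMode, Derivation.coeFn_coe]
      rw [this, ← Int.cast_smul_eq_zsmul ℂ]
      simp
  · have e : Int.negSucc k - 1 = Int.negSucc (k + 1) := by simp only [Int.negSucc_eq]; lia
    rw [e]
    simp only [betaMode, Derivation.coeFn_coe]
    rw [translation_create, ← Int.cast_smul_eq_zsmul ℂ, translation, mkDerivation_X]
    simp [create_apply, Int.negSucc_eq]
    module

theorem gammaField_mem_translationCovariant (i : ι) :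
    gammaField i ∈ translationCovariant (translation (ι := ι)).toLinearMap := by
  intro n x
  rw [gammaField_mode, gammaField_mode]
  rcases n with k | k
  · have := translation_annihilate Sum.inl (Or.inl rfl) i k x
    rcases k with _ | k
    · simpa [gammaMode] using this
    · have e : Int.ofNat (k + 1) - 1 = Int.ofNat k := by simp
      rw [e]
      simp only [gammaMode, Derivation.coeFn_coe, LinearMap.neg_apply, map_neg]
      rw [this, ← Int.cast_smul_eq_zsmul ℂ]
      simp
      abel
  · have e : Int.negSucc k - 1 = Int.negSucc (k + 1) := by simp only [Int.negSucc_eq]; lia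
    rw [e]
    simp only [gammaMode, Derivation.coeFn_coe]
    rw [translation_create, ← Int.cast_smul_eq_zsmul ℂ, translation, mkDerivation_X]
    simp [create_apply, Int.negSucc_eq]
    module

theorem betaField_mem_creative (i : ι) : betaField i ∈ creative (1 : Fock ι) := by
  intro n hn
  rw [betaField_mode]
  obtain ⟨k, rfl⟩ := Int.eq_ofNat_of_zero_le hn
  exact annihilate_one _

theorem gammaField_mem_creative (i : ι) : gammaField i ∈ creative (1 : Fock ι) := by
  intro n hn
  rw [gammaField_mode]
  obtain ⟨k, rfl⟩ := Int.eq_ofNat_of_zero_le hn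
  exact neg_eq_zero.2 (annihilate_one _)

end FockSpace

/-! ### The βγ system as a vertex algebra and its commutants. -/

section System

variable {ι : Type} [Fintype ι] {𝔤 : Type} [LieRing 𝔤] [LieAlgebra ℂ 𝔤]
  (B : Module.Basis ι ℂ 𝔤)

theorem beta_basis (i : ι) : beta B (B i) = betaField i := by
  classical
  simp [beta, Finsupp.single_apply, ite_smul]

theorem gamma_coord (i : ι) : gamma B (B.coord i) = gammaField i := by
  classical
  simp [gamma, Finsupp.single_apply, ite_smul]

variable {B} in
theorem range_subset {A : Submodule ℂ (QO (Fock ι))} (hβ : ∀ i, betaField i ∈ A)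
    (hγ : ∀ i, gammaField i ∈ A) : Set.range (beta B) ∪ Set.range (gamma B) ⊆ A := by
  rintro _ (⟨ξ, rfl⟩ | ⟨ξ, rfl⟩)
  · exact Submodule.sum_mem _ fun i _ => Submodule.smul_mem _ _ (hβ i)
  · exact Submodule.sum_mem _ fun i _ => Submodule.smul_mem _ _ (hγ i)

theorem isVertexAlgebra_system : IsVertexAlgebra (system B) := by
  refine isVertexAlgebra_generated fun a ha b hb => ?_
  have hβ (i : ι) : QuantumCommute (betaField i) b := by
    refine range_subset (A := quantumCentralizer (betaField i)) (fun j => ?_) (fun j => ?_) hb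
    · exact FieldsCommute.quantumCommute fun m n => LinearMap.ext fun f => by
        rw [betaField_mode, betaField_mode]; exact betaMode_betaMode _ _ _ _ _
    · exact quantumCommute_betaField_gammaField i j
  have hγ (i : ι) : QuantumCommute (gammaField i) b := by
    refine range_subset (A := quantumCentralizer (gammaField i)) (fun j => ?_) (fun j => ?_) hb
    · exact (quantumCommute_betaField_gammaField j i).symm
    · exact FieldsCommute.quantumCommute fun m n => LinearMap.ext fun f => by
        rw [gammaField_mode, gammaField_mode]; exact gammaMode_gammaMode _ _ _ _ _
  exact QuantumCommute.symm (range_subset (A := quantumCentralizer b) (fun j => (hβ j).symm)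
    (fun j => (hγ j).symm) ha)

theorem system_le_creative : system B ≤ creative 1 :=
  generated_le (isQOA_creative 1) (range_subset betaField_mem_creative gammaField_mem_creative)

theorem system_le_translationCovariant :
    system B ≤ translationCovariant (translation (ι := ι)).toLinearMap :=
  generated_le (isQOA_translationCovariant _)
    (range_subset betaField_mem_translationCovariant gammaField_mem_translationCovariant)

theorem beta_mem_system (ξ : 𝔤) : beta B ξ ∈ system B :=
  subset_generated _ (Or.inl ⟨ξ, rfl⟩)

theorem gamma_mem_system (ξ : Module.Dual ℂ 𝔤) : gamma B ξ ∈ system B :=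
  subset_generated _ (Or.inr ⟨ξ, rfl⟩)

theorem betaField_mem_system (i : ι) : betaField i ∈ system B :=
  beta_basis B i ▸ beta_mem_system B _

theorem gammaField_mem_system (i : ι) : gammaField i ∈ system B :=
  gamma_coord B i ▸ gamma_mem_system B _

/-- A field of the `βγ` system is determined by its state. -/
theorem eq_zero_of_state_eq_zero {v : QO (Fock ι)} (hv : v ∈ system B) (h : state 1 v = 0) :
    v = 0 := by
  have hq {a : QO (Fock ι)} (ha : a ∈ system B) := (isVertexAlgebra_system B).quantumCommute v hv a ha
  -- Translation covariance kills the vacuum; locality then propagates vanishing through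
  -- multiplication by variables, which are the negative modes of β and γ.
  have key (x : Fock ι) : ∀ n, (v[[n]]) x = 0 := by
    induction x using MvPolynomial.induction_on with
    | C c =>
      intro n
      rw [← mul_one (MvPolynomial.C c), ← MvPolynomial.smul_eq_C_mul, map_smul,
        mode_neg_eq_zero (Derivation.map_one_eq_zero _) (system_le_creative B hv)
          (system_le_translationCovariant B hv) h, smul_zero]
    | add p q hp hq => intro n; rw [map_add, hp, hq, add_zero]
    | mul_X p s hp =>
      intro n
      rw [mul_comm]
      rcases s with ⟨i, k⟩ | ⟨i, k⟩
      · have := (hq (betaField_mem_system B i)).mode_mode_eq_zero hp n (Int.negSucc k)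
        rwa [betaField_mode] at this
      · have := (hq (gammaField_mem_system B i)).mode_mode_eq_zero hp n (Int.negSucc k)
        rwa [gammaField_mode] at this
  exact ext_modes fun n => LinearMap.ext fun x => by simpa using key x n

theorem theta_mem_system (ξ : 𝔤) : theta B ξ ∈ system B :=
  neg_mem (sum_mem fun _ _ => (isVertexAlgebra_system B).toIsQOA.wick_mem (beta_mem_system B _)
    (gamma_mem_system B _))

theorem mem_currentInvariants_iff {v : QO (Fock ι)} (hv : v ∈ system B) :
    v ∈ currentInvariants B ↔ ∀ (ξ : 𝔤) (n : ℕ), ((theta B ξ)[[(n : ℤ)]]) (state 1 v) = 0 := by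
  refine ⟨fun h ξ n => ?_, fun h => ⟨hv, fun ξ n => ?_⟩⟩
  · rw [← state_circ (system_le_creative B (theta_mem_system B ξ)) (system_le_creative B hv), h.2,
      map_zero]
  · refine eq_zero_of_state_eq_zero B
      ((isVertexAlgebra_system B).circ_mem _ (theta_mem_system B ξ) _ hv _) ?_
    rw [state_circ (system_le_creative B (theta_mem_system B ξ)) (system_le_creative B hv), h]

/-- Commuting fields have vanishing nonnegative products. Conversely, vanishing products and
locality give commutation with each Θ^ξ, hence with the algebra they generate. -/
theorem coe_commutant_eq_currentInvariants :
    (commutant (thetaAlgebra B) (system B) : Set (QO (Fock ι))) = currentInvariants B := by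
  ext v
  constructor
  · rintro ⟨hv, h⟩
    exact ⟨hv, fun ξ n => (h _ (subset_generated _ ⟨ξ, rfl⟩)).circ_natCast n⟩
  · rintro ⟨hv, h⟩
    refine ⟨hv, fun a ha => fieldsCommute_of_mem_generated ?_ ha⟩
    rintro _ ⟨ξ, rfl⟩
    exact ((isVertexAlgebra_system B).quantumCommute _ (theta_mem_system B ξ) v hv).fieldsCommute
      (h ξ)

theorem isVertexAlgebra_commutant (A : Submodule ℂ (QO (Fock ι))) :
    IsVertexAlgebra (commutant A (system B)) :=
  ⟨(isVertexAlgebra_system B).toIsQOA.commutant, fun a ha b hb =>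
    (isVertexAlgebra_system B).quantumCommute a ha.1 b hb.1⟩

end System

open MvPolynomial

/-! ### Currents on the Fock space -/

section Linearity

variable {V : Type*} [AddCommGroup V] [Module ℂ V]

/-- The circle product as a linear map in its left argument. -/
def circLeft (n : ℤ) (b : QO V) : QO V →ₗ[ℂ] QO V where
  toFun a := circ a n b
  map_add' a a' := ext_modes fun m => LinearMap.ext fun v => by
    rw [map_add, Pi.add_apply, LinearMap.add_apply, circ_mode, circ_mode, circ_mode,
      ← finsum_add_distrib (circTerm_finite a b n m v) (circTerm_finite a' b n m v)]
    refine finsum_congr fun j => ?_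
    simp only [circTerm, map_add, Pi.add_apply, LinearMap.add_apply, ← smul_add]
    congr 1
    simp only [smul_add]
    abel
  map_smul' c a := ext_modes fun m => LinearMap.ext fun v => by
    rw [RingHom.id_apply, map_smul, Pi.smul_apply, LinearMap.smul_apply, circ_mode, circ_mode,
      smul_finsum' c (circTerm_finite a b n m v)]
    refine finsum_congr fun j => ?_
    simp only [circTerm, map_smul, Pi.smul_apply, LinearMap.smul_apply]
    rw [smul_comm c, smul_comm (n.negOnePow : ℤ) c, ← smul_sub]

theorem wick_sum_smul_left {κ : Type*} (s : Finset κ) (c : κ → ℂ) (a : κ → QO V) (b : QO V) :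
    wick (∑ i ∈ s, c i • a i) b = ∑ i ∈ s, c i • wick (a i) b := by
  change circLeft (-1) b _ = ∑ i ∈ s, c i • circLeft (-1) b (a i)
  simp only [map_sum, map_smul]

end Linearity

section Current

variable {ι : Type}

/-- A bound for the second indices of the variables of a polynomial. -/
theorem exists_index_bound (f : Fock ι) :
    ∃ N : ℕ, ∀ s ∈ f.vars, (s.elim Prod.snd Prod.snd : ℕ) < N := by
  refine ⟨f.vars.sup (fun s => s.elim Prod.snd Prod.snd) + 1, fun s hs => ?_⟩
  exact Nat.lt_succ_of_le (Finset.le_sup (f := fun s => (s.elim Prod.snd Prod.snd : ℕ)) hs)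

theorem annihilate_eq_zero {f : Fock ι} {N : ℕ}
    (hN : ∀ s ∈ f.vars, (s.elim Prod.snd Prod.snd : ℕ) < N) {s : (ι × ℕ) ⊕ (ι × ℕ)}
    (hs : N ≤ s.elim Prod.snd Prod.snd) : annihilate s f = 0 :=
  pderiv_eq_zero_of_notMem_vars fun h => absurd (hN s h) (by lia)

/-- Sorting the terms by type: one creation and one annihilation operator give the two first-order
sums, and the n terms with two annihilators give the second-order part. The bound N truncates the
infinite sums. -/
theorem wick_beta_gamma_mode (i j : ι) (n : ℕ) {f : Fock ι} {N : ℕ}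
    (hN : ∀ s ∈ f.vars, (s.elim Prod.snd Prod.snd : ℕ) < N) :
    ((wick (betaField i) (gammaField j))[[(n : ℤ)]]) f =
      -(∑ k ∈ Finset.range N, X (Sum.inl (i, k)) * pderiv (Sum.inl (j, n + k)) f) +
      (∑ k ∈ Finset.range N, X (Sum.inr (j, k)) * pderiv (Sum.inr (i, n + k)) f) -
      ∑ k ∈ Finset.range n, annihilate (Sum.inl (j, n - 1 - k)) (annihilate (Sum.inr (i, k)) f) := by
  rw [wick_mode_eq_sum _ _ _ _ (N := n + N)]
  · have h₁ : ∑ k ∈ Finset.range (n + N), (((betaField i)[[-1 - (k : ℤ)]])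
        (((gammaField j)[[(n : ℤ) + k]]) f)) =
        -∑ k ∈ Finset.range N, X (Sum.inl (i, k)) * pderiv (Sum.inl (j, n + k)) f := by
      rw [add_comm n, Finset.sum_range_add, ← Finset.sum_neg_distrib]
      rw [Finset.sum_eq_zero (s := Finset.range n), add_zero]
      · refine Finset.sum_congr rfl fun k _ => ?_
        rw [betaField_mode, gammaField_mode, show -1 - (k : ℤ) = Int.negSucc k by
          rw [Int.negSucc_eq]; ring, show (n : ℤ) + k = Int.ofNat (n + k) by simp,
          betaMode_negSucc, gammaMode_ofNat, create_apply, annihilate_apply, mul_neg]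
      · intro k _
        rw [gammaField_mode, show (n : ℤ) + (N + k : ℕ) = Int.ofNat (n + (N + k)) by simp,
          gammaMode_ofNat, annihilate_eq_zero hN (by simp; lia), neg_zero, map_zero]
    have h₂ : ∑ k ∈ Finset.range (n + N), (((gammaField j)[[(n : ℤ) - 1 - k]])
        (((betaField i)[[(k : ℤ)]]) f)) =
        -(∑ k ∈ Finset.range n,
          annihilate (Sum.inl (j, n - 1 - k)) (annihilate (Sum.inr (i, k)) f)) +
        ∑ k ∈ Finset.range N, X (Sum.inr (j, k)) * pderiv (Sum.inr (i, n + k)) f := by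
      rw [Finset.sum_range_add, ← Finset.sum_neg_distrib]
      congr 1
      · refine Finset.sum_congr rfl fun k hk => ?_
        have hk' : k < n := by simpa using hk
        rw [betaField_mode, gammaField_mode, show (n : ℤ) - 1 - k = Int.ofNat (n - 1 - k) by
          simp only [Int.ofNat_eq_natCast]; lia, ← Int.ofNat_eq_natCast, betaMode_ofNat,
          gammaMode_ofNat]
      · refine Finset.sum_congr rfl fun k _ => ?_
        rw [betaField_mode, gammaField_mode, show (n : ℤ) - 1 - (n + k : ℕ) = Int.negSucc k by
          rw [Int.negSucc_eq]; push_cast; ring, ← Int.ofNat_eq_natCast, betaMode_ofNat,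
          gammaMode_negSucc, create_apply, annihilate_apply]
    rw [Finset.sum_add_distrib, h₁, h₂]
    abel
  · intro k hk
    rw [betaField_mode, gammaField_mode]
    constructor
    · rw [show (n : ℤ) + k = Int.ofNat (n + k) by simp, gammaMode_ofNat,
        annihilate_eq_zero hN (by simp; lia), neg_zero]
    · rw [← Int.ofNat_eq_natCast, betaMode_ofNat, annihilate_eq_zero hN (by simp; lia)]

theorem derivation_sum_apply {R A M κ : Type*} [CommRing R] [CommRing A] [Algebra R A]
    [AddCommGroup M] [Module A M] [Module R M] (s : Finset κ) (D : κ → Derivation R A M) (a : A) :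
    (∑ i ∈ s, D i) a = ∑ i ∈ s, D i a := by
  classical
  induction s using Finset.induction_on with
  | empty => simp
  | insert i s hi ih => rw [Finset.sum_insert hi, Finset.sum_insert hi, Derivation.add_apply, ih]

variable [Fintype ι]

/-- The derivation by which `A tⁿ` acts on functions on pairs of arcs, for a matrix `A`. -/
def currentDerivation (A : ι → ι → ℂ) (n : ℕ) : Derivation ℂ (Fock ι) (Fock ι) :=
  mkDerivation ℂ (Sum.elim
    (fun p => if n ≤ p.2 then ∑ i, A i p.1 • X (Sum.inl (i, p.2 - n)) else 0)
    (fun p => if n ≤ p.2 then -∑ j, A p.1 j • X (Sum.inr (j, p.2 - n)) else 0))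

theorem currentDerivation_inl (A : ι → ι → ℂ) (n : ℕ) (i : ι) (m : ℕ) :
    currentDerivation A n (X (Sum.inl (i, m))) =
      if n ≤ m then ∑ l, A l i • X (Sum.inl (l, m - n)) else 0 := by
  rw [currentDerivation, mkDerivation_X]; rfl

theorem currentDerivation_inr (A : ι → ι → ℂ) (n : ℕ) (i : ι) (m : ℕ) :
    currentDerivation A n (X (Sum.inr (i, m))) =
      if n ≤ m then -∑ l, A i l • X (Sum.inr (l, m - n)) else 0 := by
  rw [currentDerivation, mkDerivation_X]; rfl

/-- The truncated right-hand side is itself a derivation, and derivations agreeing on the variables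
of f agree on f. -/
theorem currentDerivation_eq_sum (A : ι → ι → ℂ) (n : ℕ) {f : Fock ι} {N : ℕ}
    (hN : ∀ s ∈ f.vars, (s.elim Prod.snd Prod.snd : ℕ) < N) :
    currentDerivation A n f = ∑ j, ∑ i, A i j •
      ((∑ k ∈ Finset.range N, X (Sum.inl (i, k)) * pderiv (Sum.inl (j, n + k)) f) -
      (∑ k ∈ Finset.range N, X (Sum.inr (j, k)) * pderiv (Sum.inr (i, n + k)) f)) := by
  classical
  let D : Derivation ℂ (Fock ι) (Fock ι) := ∑ j, ∑ i, A i j •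
      ((∑ k ∈ Finset.range N, (X (Sum.inl (i, k)) : Fock ι) •
          (pderiv (Sum.inl (j, n + k)) : Derivation ℂ (Fock ι) (Fock ι))) -
        (∑ k ∈ Finset.range N, (X (Sum.inr (j, k)) : Fock ι) •
          (pderiv (Sum.inr (i, n + k)) : Derivation ℂ (Fock ι) (Fock ι))))
  have hD (g : Fock ι) : D g = ∑ j, ∑ i, A i j •
      ((∑ k ∈ Finset.range N, X (Sum.inl (i, k)) * pderiv (Sum.inl (j, n + k)) g) -
      (∑ k ∈ Finset.range N, X (Sum.inr (j, k)) * pderiv (Sum.inr (i, n + k)) g)) := by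
    simp [D, derivation_sum_apply]
  rw [← hD]
  refine derivation_eq_of_forall_mem_vars fun s hs => ?_
  rw [hD]
  have hs' := hN s hs
  have key (g : ℕ → Fock ι) (m : ℕ) (hm : m < N) (P : Prop) [Decidable P] :
      ∑ k ∈ Finset.range N, g k * (if P ∧ m = n + k then 1 else 0) =
        if P then if n ≤ m then g (m - n) else 0 else 0 := by
    by_cases hP : P
    · by_cases hn : n ≤ m
      · rw [Finset.sum_eq_single (m - n)]
        · simp [hP, hn]
        · intro b _ hb
          rw [if_neg (by lia), mul_zero]
        · intro h
          exact absurd (Finset.mem_range.2 (by lia)) h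
      · rw [Finset.sum_eq_zero]
        · simp [hn]
        · intro k _
          rw [if_neg (by lia), mul_zero]
    · simp [hP]
  rcases s with ⟨l, m⟩ | ⟨l, m⟩
  · simp only [Sum.elim_inl] at hs'
    rw [currentDerivation_inl]
    simp only [pderiv_X, Pi.single_apply, Sum.inl.injEq, Prod.mk.injEq, reduceCtorEq, if_false,
      mul_zero, Finset.sum_const_zero, sub_zero]
    simp only [key _ m hs', smul_ite, smul_zero]
    rw [Finset.sum_comm]
    simp
  · simp only [Sum.elim_inr] at hs'
    rw [currentDerivation_inr]
    simp only [pderiv_X, Pi.single_apply, Sum.inr.injEq, Prod.mk.injEq, reduceCtorEq, if_false,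
      mul_zero, Finset.sum_const_zero, zero_sub]
    simp only [key _ m hs', smul_neg, smul_ite, smul_zero]
    by_cases hn : n ≤ m <;> simp [hn]

/-- The second-order part of the action of `A tⁿ` on the Fock space. -/
def contraction (A : ι → ι → ℂ) (n : ℕ) (f : Fock ι) : Fock ι :=
  ∑ j, ∑ i, A i j • ∑ k ∈ Finset.range n,
    annihilate (Sum.inl (j, n - 1 - k)) (annihilate (Sum.inr (i, k)) f)

variable {𝔤 : Type} [LieRing 𝔤] [LieAlgebra ℂ 𝔤] (B : Module.Basis ι ℂ 𝔤)

theorem theta_mode (ξ : 𝔤) (n : ℕ) (f : Fock ι) :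
    ((theta B ξ)[[(n : ℤ)]]) f = currentDerivation (fun i j => B.repr ⁅ξ, B j⁆ i) n f +
      contraction (fun i j => B.repr ⁅ξ, B j⁆ i) n f := by
  obtain ⟨N, hN⟩ := exists_index_bound f
  rw [theta, currentDerivation_eq_sum _ _ hN, contraction]
  simp only [gamma_coord]
  simp only [beta, wick_sum_smul_left, map_neg, map_sum, map_smul, Pi.neg_apply,
    Finset.sum_apply, Pi.smul_apply, LinearMap.neg_apply, LinearMap.sum_apply,
    LinearMap.smul_apply, wick_beta_gamma_mode _ _ _ hN]
  rw [← Finset.sum_add_distrib, ← Finset.sum_neg_distrib]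
  refine Finset.sum_congr rfl fun j _ => ?_
  rw [← Finset.sum_add_distrib, ← Finset.sum_neg_distrib]
  refine Finset.sum_congr rfl fun i _ => ?_
  module

end Current

/-! ### Leading terms and the basic invariants -/

section Degree

variable {σ : Type*}

/-- Polynomials of total degree less than `d`. -/
def degLT (σ : Type*) (d : ℕ) : Submodule ℂ (MvPolynomial σ ℂ) where
  carrier := {f | ∀ m, coeff m f ≠ 0 → m.degree < d}
  zero_mem' m h := by simp at h
  add_mem' {f g} hf hg m h := by
    by_cases hm : coeff m f = 0
    · exact hg m fun h' => h (by rw [coeff_add, hm, h', add_zero])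
    · exact hf m hm
  smul_mem' c f hf m h := hf m fun h' => h (by rw [coeff_smul, h', smul_zero])

theorem degLT_mono {d e : ℕ} (h : d ≤ e) : degLT σ d ≤ degLT σ e :=
  fun _ hf m hm => (hf m hm).trans_le h

theorem degLT_zero {f : MvPolynomial σ ℂ} (hf : f ∈ degLT σ 0) : f = 0 := by
  ext m
  by_contra h
  exact absurd (hf m h) (by simp)

theorem IsHomogeneous.mem_degLT {f : MvPolynomial σ ℂ} {d e : ℕ} (hf : f.IsHomogeneous d)
    (h : d < e) : f ∈ degLT σ e := by
  intro m hm
  by_contra hlt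
  exact hm (hf.coeff_eq_zero (by lia))

theorem exists_mem_degLT (f : MvPolynomial σ ℂ) : ∃ d, f ∈ degLT σ d := by
  refine ⟨f.totalDegree + 1, fun m hm => Nat.lt_succ_of_le ?_⟩
  exact le_totalDegree (mem_support_iff.2 hm)

theorem IsHomogeneous.mul_mem_degLT {q f : MvPolynomial σ ℂ} {d e : ℕ} (hq : q.IsHomogeneous e)
    (hf : f ∈ degLT σ d) : q * f ∈ degLT σ (d + e) := by
  classical
  intro m hm
  rw [coeff_mul] at hm
  obtain ⟨⟨a, b⟩, hab, h⟩ := Finset.exists_ne_zero_of_sum_ne_zero hm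
  have h1 : a.degree = e := by
    by_contra hne
    exact h (by rw [hq.coeff_eq_zero hne, zero_mul])
  have h2 := hf b (right_ne_zero_of_mul h)
  rw [← Finset.HasAntidiagonal.mem_antidiagonal.1 hab, map_add]
  lia

theorem pderiv_mem_degLT (s : σ) {f : MvPolynomial σ ℂ} {d : ℕ} (hf : f ∈ degLT σ d) :
    pderiv s f ∈ degLT σ d := by
  intro m hm
  rw [coeff_pderiv] at hm
  have := hf _ (left_ne_zero_of_mul hm)
  rw [map_add] at this
  lia

theorem sub_homogeneousComponent_mem_degLT {f : MvPolynomial σ ℂ} {d : ℕ}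
    (hf : f ∈ degLT σ (d + 1)) : f - homogeneousComponent d f ∈ degLT σ d := by
  intro m hm
  rw [coeff_sub, coeff_homogeneousComponent] at hm
  split_ifs at hm with h
  · simp at hm
  · have := hf m (by simpa using hm)
    lia

theorem isHomogeneous_derivation {D : Derivation ℂ (MvPolynomial σ ℂ) (MvPolynomial σ ℂ)}
    (hD : ∀ s, (D (X s)).IsHomogeneous 1) {f : MvPolynomial σ ℂ} {d : ℕ}
    (hf : f.IsHomogeneous d) : (D f).IsHomogeneous d := by
  classical
  have key : D f = ∑ s ∈ f.vars, D (X s) * pderiv s f := by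
    let D' : Derivation ℂ (MvPolynomial σ ℂ) (MvPolynomial σ ℂ) :=
      ∑ s ∈ f.vars, D (X s) • (pderiv s : Derivation ℂ (MvPolynomial σ ℂ) (MvPolynomial σ ℂ))
    have hD' (g) : D' g = ∑ s ∈ f.vars, D (X s) * pderiv s g := by
      simp [D', derivation_sum_apply]
    rw [← hD']
    refine derivation_eq_of_forall_mem_vars fun s hs => ?_
    rw [hD', Finset.sum_eq_single s]
    · simp
    · intro t _ hne
      rw [pderiv_X_of_ne hne.symm, mul_zero]
    · exact fun h => absurd hs h
  rcases d with _ | d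
  · rw [key]
    refine IsHomogeneous.sum _ _ _ fun s _ => ?_
    have : pderiv s f = 0 := by
      rw [totalDegree_eq_zero_iff_eq_C.1 (Nat.le_zero.1 hf.totalDegree_le), pderiv_C]
    rw [this, mul_zero]
    exact isHomogeneous_zero _ _ _
  · rw [key]
    refine IsHomogeneous.sum _ _ _ fun s _ => ?_
    rw [add_comm]
    exact (hD s).mul hf.pderiv

end Degree

section CurrentDegree

variable {ι : Type} [Fintype ι]

theorem isHomogeneous_currentDerivation (A : ι → ι → ℂ) (n : ℕ) {f : Fock ι} {d : ℕ}
    (hf : f.IsHomogeneous d) : (currentDerivation A n f).IsHomogeneous d := by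
  refine isHomogeneous_derivation (fun s => ?_) hf
  have h (c : ℂ) (t : (ι × ℕ) ⊕ (ι × ℕ)) : (c • X t : Fock ι).IsHomogeneous 1 :=
    Submodule.smul_mem (homogeneousSubmodule _ ℂ 1) c (isHomogeneous_X ℂ t)
  rcases s with ⟨i, m⟩ | ⟨i, m⟩
  · rw [currentDerivation_inl]
    split_ifs
    · exact IsHomogeneous.sum _ _ _ fun l _ => h _ _
    · exact isHomogeneous_zero _ _ _
  · rw [currentDerivation_inr]
    split_ifs
    · exact (IsHomogeneous.sum _ _ _ fun l _ => h _ _).neg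
    · exact isHomogeneous_zero _ _ _

theorem contraction_eq_sum (A : ι → ι → ℂ) (n : ℕ) (f : Fock ι) : contraction A n f =
    ∑ j, ∑ i, A i j • ∑ k ∈ Finset.range n,
      pderiv (Sum.inl (j, n - 1 - k)) (pderiv (Sum.inr (i, k)) f) := rfl

/-- A drop by one already suffices to make the contraction invisible in top degree: the inner
derivative provides it and the outer one does not raise the degree. -/
theorem contraction_mem_degLT (A : ι → ι → ℂ) (n : ℕ) {f : Fock ι} {d : ℕ}
    (hf : f ∈ degLT _ (d + 1)) : contraction A n f ∈ degLT _ d := by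
  rw [contraction_eq_sum]
  refine Submodule.sum_mem _ fun j _ => Submodule.sum_mem _ fun i _ => Submodule.smul_mem _ _
    (Submodule.sum_mem _ fun k _ => pderiv_mem_degLT _ ?_)
  intro m hm
  rw [coeff_pderiv] at hm
  have := hf _ (left_ne_zero_of_mul hm)
  rw [map_add, Finsupp.degree_single] at this
  lia

/-- The leading term of a vector killed by `A tⁿ` is killed by the corresponding derivation. -/
theorem currentDerivation_homogeneousComponent (A : ι → ι → ℂ) (n : ℕ) {f : Fock ι} {d : ℕ}
    (hf : f ∈ degLT _ (d + 1)) (h : currentDerivation A n f + contraction A n f = 0) :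
    currentDerivation A n (homogeneousComponent d f) = 0 := by
  have hd (g : Fock ι) (hg : g ∈ degLT _ d) : currentDerivation A n g ∈ degLT _ d := by
    rw [← sum_homogeneousComponent g, map_sum]
    refine Submodule.sum_mem _ fun i _ => ?_
    by_cases hi : i < d
    · exact IsHomogeneous.mem_degLT
        (isHomogeneous_currentDerivation A n (homogeneousComponent_isHomogeneous i g)) hi
    · have : homogeneousComponent i g = 0 := by
        ext m
        rw [coeff_homogeneousComponent]
        split_ifs with hm
        · by_contra hne
          exact hi (hm ▸ hg m (by simpa using hne))
        · simp
      rw [this, map_zero]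
      exact zero_mem _
  -- This element is homogeneous of degree d, yet equals terms of degree below d: the contraction
  -- and the image of the lower part of f. It must vanish.
  have h1 : currentDerivation A n (homogeneousComponent d f) ∈ degLT _ d := by
    have e : currentDerivation A n (homogeneousComponent d f) =
        -(contraction A n f) - currentDerivation A n (f - homogeneousComponent d f) := by
      rw [map_sub, ← eq_neg_of_add_eq_zero_left h]
      ring
    rw [e]
    exact sub_mem (neg_mem (contraction_mem_degLT A n hf))
      (hd _ (sub_homogeneousComponent_mem_degLT hf))
  have h2 := isHomogeneous_currentDerivation A n (homogeneousComponent_isHomogeneous d f)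
  ext m
  rw [coeff_zero]
  by_contra hne
  have := h1 m hne
  exact hne (h2.coeff_eq_zero (by lia))

end CurrentDegree

/-! ### The adjoint action and the three quadratic invariants. -/

section SlTwo

/-- The matrix of `ad ξ` in the basis `x, y, h`, where `ξ = p x + q y + r h`. -/
def adMatrix (p q r : ℂ) : Fin 3 → Fin 3 → ℂ :=
  ![![2 * r, 0, -2 * p], ![0, -2 * r, 2 * q], ![-q, p, 0] ]

theorem repr_lie_sl2Basis (ξ : sl2) :
    (fun i j => sl2Basis.repr ⁅ξ, sl2Basis j⁆ i) = adMatrix (ξ.1 0 1) (ξ.1 1 0) (ξ.1 0 0) := by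
  have h (j : Fin 3) : sl2Basis j = sl2Mk ((Pi.single j 1 : Fin 3 → ℂ) 0)
      ((Pi.single j 1 : Fin 3 → ℂ) 1) ((Pi.single j 1 : Fin 3 → ℂ) 2) := by
    simp [sl2Basis, sl2Coords]
  have htr : ξ.1 1 1 = -ξ.1 0 0 := by
    have h := ξ.2
    have htr : ξ.1 0 0 + ξ.1 1 1 = 0 := by
      simpa [LieAlgebra.SpecialLinear.sl, Matrix.trace_fin_two] using h
    linear_combination htr
  ext i j
  rw [sl2Basis, Module.Basis.ofEquivFun_repr_apply, ← sl2Basis, h]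
  fin_cases i <;> fin_cases j <;>
    simp [sl2Coords, sl2Mk, adMatrix, Matrix.mul_apply, Fin.sum_univ_two, Ring.lie_def, htr,
      Matrix.vecMul, dotProduct] <;> ring

/-- The quadratic form on the first arc. -/
def betaNorm {R : Type*} [CommRing R] (l : Fin 3 → PowerSeries R) : PowerSeries R :=
  l 2 * l 2 + 4 • (l 0 * l 1)

/-- The pairing of two arcs. -/
def arcPairing {R : Type*} [CommRing R] (l w : Fin 3 → PowerSeries R) : PowerSeries R :=
  l 2 * w 2 + l 0 * w 0 + l 1 * w 1

/-- The quadratic form on the second arc. -/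
def gammaNorm {R : Type*} [CommRing R] (w : Fin 3 → PowerSeries R) : PowerSeries R :=
  w 2 * w 2 + w 0 * w 1

/-- The basic invariants of a pair of arcs. -/
def arcInvariants {R : Type*} [CommRing R] (l w : Fin 3 → PowerSeries R) :
    Fin 3 → PowerSeries R :=
  ![betaNorm l, arcPairing l w, gammaNorm w]

/-- The universal first arc. -/
def betaArc (i : Fin 3) : PowerSeries (Fock (Fin 3)) := PowerSeries.mk fun k => X (Sum.inl (i, k))

/-- The universal second arc. -/
def gammaArc (i : Fin 3) : PowerSeries (Fock (Fin 3)) := PowerSeries.mk fun k => X (Sum.inr (i, k))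

/-- The coefficients of the basic invariants of the universal pair of arcs. -/
def quadric (p : Fin 3 × ℕ) : Fock (Fin 3) :=
  PowerSeries.coeff p.2 (arcInvariants betaArc gammaArc p.1)

/-- Multiples of the three fields, in the order of the basic invariants. -/
def invariantField : Fin 3 → QO (Fock (Fin 3)) := ![(-2 : ℂ) • vy, vh, (2 : ℂ) • vx]

theorem invariantField_zero : invariantField 0 = wick (betaField 2) (betaField 2) +
    (4 : ℂ) • wick (betaField 0) (betaField 1) := by
  simp only [invariantField, Matrix.cons_val_zero, vy, β, beta_basis, smul_smul]
  norm_num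

theorem invariantField_one : invariantField 1 = wick (betaField 2) (gammaField 2) +
    wick (betaField 0) (gammaField 0) + wick (betaField 1) (gammaField 1) := by
  simp only [invariantField, Matrix.cons_val, vh, β, γ, beta_basis, gamma_coord]

theorem invariantField_two : invariantField 2 = wick (gammaField 2) (gammaField 2) +
    wick (gammaField 0) (gammaField 1) := by
  simp only [invariantField, Matrix.cons_val, vx, γ, gamma_coord, smul_smul]
  norm_num

theorem state_betaField (i : Fin 3) : state 1 (betaField i) = X (Sum.inl (i, 0)) := by
  rw [state_apply, betaField_mode]
  exact mul_one _

theorem state_gammaField (i : Fin 3) : state 1 (gammaField i) = X (Sum.inr (i, 0)) := by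
  rw [state_apply, gammaField_mode]
  exact mul_one _

theorem state_wick {a b : QO (Fock (Fin 3))} (ha : a ∈ creative 1) (hb : b ∈ creative 1) :
    state 1 (wick a b) = (a[[-1]]) (state 1 b) := state_circ ha hb _

theorem state_wick_betaField (i : Fin 3) {b : QO (Fock (Fin 3))} (hb : b ∈ creative 1) :
    state 1 (wick (betaField i) b) = X (Sum.inl (i, 0)) * state 1 b := by
  rw [state_wick (betaField_mem_creative i) hb, betaField_mode]
  rfl

theorem state_wick_gammaField (i : Fin 3) {b : QO (Fock (Fin 3))} (hb : b ∈ creative 1) :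
    state 1 (wick (gammaField i) b) = X (Sum.inr (i, 0)) * state 1 b := by
  rw [state_wick (gammaField_mem_creative i) hb, gammaField_mode]
  rfl

theorem quadric_zero_zero : quadric (0, 0) =
    X (Sum.inl (2, 0)) * X (Sum.inl (2, 0)) +
      (4 : ℂ) • (X (Sum.inl (0, 0)) * X (Sum.inl (1, 0))) := by
  have h4 : (C 4 : Fock (Fin 3)) = 4 := map_ofNat C 4
  rw [MvPolynomial.smul_eq_C_mul, h4]
  simp [quadric, arcInvariants, betaNorm, betaArc]
  exact map_ofNat _ 4

theorem quadric_one_zero : quadric (1, 0) =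
    X (Sum.inl (2, 0)) * X (Sum.inr (2, 0)) + X (Sum.inl (0, 0)) * X (Sum.inr (0, 0)) +
      X (Sum.inl (1, 0)) * X (Sum.inr (1, 0)) := by
  simp [quadric, arcInvariants, arcPairing, betaArc, gammaArc]

theorem quadric_two_zero : quadric (2, 0) =
    X (Sum.inr (2, 0)) * X (Sum.inr (2, 0)) + X (Sum.inr (0, 0)) * X (Sum.inr (1, 0)) := by
  simp [quadric, arcInvariants, gammaNorm, gammaArc]

theorem state_invariantField (i : Fin 3) : state 1 (invariantField i) = quadric (i, 0) := by
  have hβ := betaField_mem_creative (ι := Fin 3)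
  have hγ := gammaField_mem_creative (ι := Fin 3)
  fin_cases i
  · simp [invariantField_zero, state_wick_betaField, hβ, state_betaField, quadric_zero_zero]
  · simp [invariantField_one, state_wick_betaField, hγ, state_gammaField, quadric_one_zero]
  · simp [invariantField_two, state_wick_gammaField, hγ, state_gammaField, quadric_two_zero]

theorem currentDerivation_quadric (p q r : ℂ) (n : ℕ) (i : Fin 3) :
    currentDerivation (adMatrix p q r) n (quadric (i, 0)) = 0 := by
  have h2 : (C 2 : Fock (Fin 3)) = 2 := map_ofNat C 2
  have h4 : (C 4 : Fock (Fin 3)) = 4 := map_ofNat C 4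
  have hD (D : Derivation ℂ (Fock (Fin 3)) (Fock (Fin 3))) : D 4 = 0 := D.map_natCast 4
  rcases n with _ | n
  · fin_cases i <;>
      simp [quadric_zero_zero, quadric_one_zero, quadric_two_zero, currentDerivation_inl,
        currentDerivation_inr, Fin.sum_univ_three, adMatrix, MvPolynomial.smul_eq_C_mul, h2, h4, hD] <;> ring
  · fin_cases i <;>
      simp [quadric_zero_zero, quadric_one_zero, quadric_two_zero, currentDerivation_inl,
        currentDerivation_inr]

/-- Only the pairing mixes β with γ. Its mixed second derivatives are Kronecker deltas, so its
contraction is a multiple of the trace of ad ξ, which is zero. -/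
theorem contraction_quadric (p q r : ℂ) (n : ℕ) (i : Fin 3) :
    contraction (adMatrix p q r) n (quadric (i, 0)) = 0 := by
  rw [contraction_eq_sum]
  fin_cases i
  · simp [quadric_zero_zero, pderiv_X]
  · have key (i j : Fin 3) (a b : ℕ) :
        pderiv (Sum.inl (j, a)) (pderiv (Sum.inr (i, b)) (quadric (1, 0))) =
          if i = j then if a = 0 ∧ b = 0 then 1 else 0 else 0 := by
      rcases a with _ | a <;> rcases b with _ | b <;> fin_cases i <;> fin_cases j <;>
        simp [quadric_one_zero, pderiv_X]
    simp only [Fin.mk_one, key]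
    simp [Fin.sum_univ_three, adMatrix]
  · have key (i j : Fin 3) (a b : ℕ) :
        pderiv (Sum.inl (j, a)) (pderiv (Sum.inr (i, b)) (quadric (2, 0))) = 0 := by
      rcases b with _ | b <;> fin_cases i <;>
        simp [quadric_two_zero, pderiv_X]
    simp [key]

theorem invariantField_mem_system (i : Fin 3) : invariantField i ∈ system sl2Basis := by
  have hβ := betaField_mem_system sl2Basis
  have hγ := gammaField_mem_system sl2Basis
  have hw {a b : QO (Fock (Fin 3))} (ha : a ∈ system sl2Basis) (hb : b ∈ system sl2Basis) :=
    (isVertexAlgebra_system sl2Basis).toIsQOA.wick_mem ha hb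
  fin_cases i
  · change invariantField 0 ∈ _
    rw [invariantField_zero]
    exact add_mem (hw (hβ _) (hβ _)) (Submodule.smul_mem _ _ (hw (hβ _) (hβ _)))
  · change invariantField 1 ∈ _
    rw [invariantField_one]
    exact add_mem (add_mem (hw (hβ _) (hγ _)) (hw (hβ _) (hγ _))) (hw (hβ _) (hγ _))
  · change invariantField 2 ∈ _
    rw [invariantField_two]
    exact add_mem (hw (hγ _) (hγ _)) (hw (hγ _) (hγ _))

/-- Translates the commutant into differential equations on the state; the rest of the argument
takes place in the polynomial ring. -/
theorem mem_commutant_iff {v : QO (Fock (Fin 3))} (hv : v ∈ system sl2Basis) :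
    v ∈ commutant (thetaAlgebra sl2Basis) (system sl2Basis) ↔ ∀ (p q r : ℂ) (n : ℕ),
      currentDerivation (adMatrix p q r) n (state 1 v) +
        contraction (adMatrix p q r) n (state 1 v) = 0 := by
  rw [← SetLike.mem_coe, coe_commutant_eq_currentInvariants, mem_currentInvariants_iff _ hv]
  simp only [theta_mode, repr_lie_sl2Basis]
  exact ⟨fun h p q r n => by simpa [sl2Mk] using h (sl2Mk p q r) n, fun h ξ n => h _ _ _ n⟩

theorem invariantField_mem_commutant (i : Fin 3) :
    invariantField i ∈ commutant (thetaAlgebra sl2Basis) (system sl2Basis) := by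
  rw [mem_commutant_iff (invariantField_mem_system i), state_invariantField]
  intro p q r n
  rw [currentDerivation_quadric, contraction_quadric, add_zero]

end SlTwo

/-! ### Leading terms of the modes of the three fields. -/

section Symbol

variable {ι : Type}

/-- The mode `v(-k-1)` is multiplication by `q k` up to terms of lower degree. -/
def HasSymbol (v : QO (Fock ι)) (q : ℕ → Fock ι) : Prop :=
  ∀ (k d : ℕ), ∀ f ∈ degLT _ d, (v[[Int.negSucc k]]) f - q k * f ∈ degLT _ (d + 1)

theorem HasSymbol.add {v w : QO (Fock ι)} {p q : ℕ → Fock ι} (hv : HasSymbol v p)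
    (hw : HasSymbol w q) : HasSymbol (v + w) (p + q) := by
  intro k d f hf
  have := add_mem (hv k d f hf) (hw k d f hf)
  rw [map_add, Pi.add_apply, LinearMap.add_apply, Pi.add_apply]
  convert this using 1
  ring

theorem HasSymbol.smul {v : QO (Fock ι)} {q : ℕ → Fock ι} (hv : HasSymbol v q) (c : ℂ) :
    HasSymbol (c • v) (c • q) := by
  intro k d f hf
  have := Submodule.smul_mem _ c (hv k d f hf)
  rw [map_smul, Pi.smul_apply, LinearMap.smul_apply, Pi.smul_apply]
  rwa [smul_sub, ← smul_mul_assoc] at this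

/-- A field whose negative modes are multiplications by variables, and whose nonnegative modes do
not raise degrees. -/
structure IsOscillator (a : QO (Fock ι)) (s : ℕ → (ι × ℕ) ⊕ (ι × ℕ)) : Prop where
  negSucc (k : ℕ) (f : Fock ι) : (a[[Int.negSucc k]]) f = X (s k) * f
  mem_degLT (k d : ℕ) : ∀ f ∈ degLT _ d, (a[[(k : ℤ)]]) f ∈ degLT _ d

theorem isOscillator_betaField (i : ι) :
    IsOscillator (betaField i) fun k => Sum.inl (i, k) where
  negSucc k f := by rw [betaField_mode]; rfl
  mem_degLT k d f hf := by rw [betaField_mode]; exact pderiv_mem_degLT _ hf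

theorem isOscillator_gammaField (i : ι) :
    IsOscillator (gammaField i) fun k => Sum.inr (i, k) where
  negSucc k f := by rw [gammaField_mode]; rfl
  mem_degLT k d f hf := by rw [gammaField_mode]; exact neg_mem (pderiv_mem_degLT _ hf)

theorem IsOscillator.mem_degLT_succ {a : QO (Fock ι)} {s : ℕ → (ι × ℕ) ⊕ (ι × ℕ)}
    (ha : IsOscillator a s) (n : ℤ) {d : ℕ} {f : Fock ι} (hf : f ∈ degLT _ d) :
    (a[[n]]) f ∈ degLT _ (d + 1) := by
  rcases n with k | k
  · exact degLT_mono (Nat.le_succ d) (ha.mem_degLT k d f hf)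
  · rw [ha.negSucc]
    exact IsHomogeneous.mul_mem_degLT (isHomogeneous_X _ _) hf

/-- For the mode -k-1, the terms j ≤ k of the first sum are products of two creation operators and
form a convolution. Every other term has at least one nonnegative mode and so raises the degree by
at most one. -/
theorem hasSymbol_wick {a b : QO (Fock ι)} {s t : ℕ → (ι × ℕ) ⊕ (ι × ℕ)}
    (ha : IsOscillator a s) (hb : IsOscillator b t) :
    HasSymbol (wick a b) fun k =>
      PowerSeries.coeff k (PowerSeries.mk (fun k => (X (s k) : Fock ι)) *
        PowerSeries.mk (fun k => X (t k))) := by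
  intro k d f hf
  obtain ⟨N, hN⟩ := exists_mode_eq_zero a f
  obtain ⟨M, hM⟩ := exists_mode_eq_zero b f
  rw [wick_mode_eq_sum a b _ f (N := k + 1 + (N.toNat + M.toNat)), Finset.sum_add_distrib,
    Finset.sum_range_add]
  · have h1 : ∑ j ∈ Finset.range (k + 1), (a[[-1 - (j : ℤ)]]) ((b[[Int.negSucc k + j]]) f) =
        PowerSeries.coeff k (PowerSeries.mk (fun k => (X (s k) : Fock ι)) *
          PowerSeries.mk (fun k => X (t k))) * f := by
      rw [PowerSeries.coeff_mul, Finset.Nat.sum_antidiagonal_eq_sum_range_succ_mk,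
        Finset.sum_mul]
      refine Finset.sum_congr rfl fun j hj => ?_
      have hj' : j ≤ k := by simpa [Nat.lt_succ_iff] using hj
      rw [show -1 - (j : ℤ) = Int.negSucc j by rw [Int.negSucc_eq]; ring,
        show Int.negSucc k + j = Int.negSucc (k - j) by simp only [Int.negSucc_eq]; lia,
        ha.negSucc, hb.negSucc, PowerSeries.coeff_mk, PowerSeries.coeff_mk, mul_assoc]
    rw [h1, add_assoc, add_sub_cancel_left]
    refine add_mem (sum_mem fun j _ => ?_) (sum_mem fun j _ => ?_)
    · refine ha.mem_degLT_succ _ ?_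
      rw [show Int.negSucc k + ((k + 1 + j : ℕ) : ℤ) = j by
        rw [Int.negSucc_eq]; push_cast; ring]
      exact hb.mem_degLT _ _ _ hf
    · exact hb.mem_degLT_succ _ (ha.mem_degLT _ _ _ hf)
  · intro j hj
    rw [Int.negSucc_eq]
    exact ⟨hM _ (by lia), hN _ (by lia)⟩

theorem hasSymbol_invariantField (i : Fin 3) :
    HasSymbol (invariantField i) fun k => quadric (i, k) := by
  have hβ := isOscillator_betaField (ι := Fin 3)
  have hγ := isOscillator_gammaField (ι := Fin 3)
  fin_cases i
  · change HasSymbol (invariantField 0) fun k => quadric (0, k)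
    rw [invariantField_zero]
    convert (hasSymbol_wick (hβ 2) (hβ 2)).add ((hasSymbol_wick (hβ 0) (hβ 1)).smul 4) using 1
    ext1 k
    change PowerSeries.coeff k (betaNorm betaArc) = _
    rw [betaNorm, map_add, map_nsmul, ← Nat.cast_smul_eq_nsmul ℂ]
    rfl
  · change HasSymbol (invariantField 1) fun k => quadric (1, k)
    rw [invariantField_one]
    exact ((hasSymbol_wick (hβ 2) (hγ 2)).add (hasSymbol_wick (hβ 0) (hγ 0))).add
      (hasSymbol_wick (hβ 1) (hγ 1))
  · change HasSymbol (invariantField 2) fun k => quadric (2, k)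
    rw [invariantField_two]
    exact (hasSymbol_wick (hγ 2) (hγ 2)).add (hasSymbol_wick (hγ 0) (hγ 1))

theorem isHomogeneous_quadric (p : Fin 3 × ℕ) : (quadric p).IsHomogeneous 2 := by
  have key (s t : ℕ → (Fin 3 × ℕ) ⊕ (Fin 3 × ℕ)) (k : ℕ) :
      (PowerSeries.coeff k (PowerSeries.mk (fun k => (X (s k) : Fock (Fin 3))) *
        PowerSeries.mk (fun k => X (t k)))).IsHomogeneous 2 := by
    rw [PowerSeries.coeff_mul]
    refine IsHomogeneous.sum _ _ _ fun x _ => ?_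
    rw [PowerSeries.coeff_mk, PowerSeries.coeff_mk]
    exact (isHomogeneous_X _ _).mul (isHomogeneous_X _ _)
  obtain ⟨i, k⟩ := p
  fin_cases i
  · change (PowerSeries.coeff k (betaNorm betaArc)).IsHomogeneous 2
    rw [betaNorm, map_add, map_nsmul]
    exact (key _ _ k).add (Submodule.smul_of_tower_mem (homogeneousSubmodule _ ℂ 2) 4 (key _ _ k))
  · exact ((key _ _ k).add (key _ _ k)).add (key _ _ k)
  · exact (key _ _ k).add (key _ _ k)

end Symbol

/-! ### Arcs and normal forms -/

section ArcEvaluation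

/-- The evaluation of polynomials at a pair of arcs. -/
def arcEval {R : Type*} [CommRing R] [Algebra ℂ R] (l w : Fin 3 → PowerSeries R) :
    Fock (Fin 3) →ₐ[ℂ] R :=
  aeval (Sum.elim (fun p => PowerSeries.coeff p.2 (l p.1)) fun p => PowerSeries.coeff p.2 (w p.1))

theorem arcEval_inl {R : Type*} [CommRing R] [Algebra ℂ R] (l w : Fin 3 → PowerSeries R)
    (i : Fin 3) (k : ℕ) : arcEval l w (X (Sum.inl (i, k))) = PowerSeries.coeff k (l i) := by
  simp [arcEval]

theorem arcEval_inr {R : Type*} [CommRing R] [Algebra ℂ R] (l w : Fin 3 → PowerSeries R)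
    (i : Fin 3) (k : ℕ) : arcEval l w (X (Sum.inr (i, k))) = PowerSeries.coeff k (w i) := by
  simp [arcEval]

theorem map_arcEval {R S : Type*} [CommRing R] [Algebra ℂ R] [CommRing S] [Algebra ℂ S]
    (φ : R →ₐ[ℂ] S) (l w : Fin 3 → PowerSeries R) (f : Fock (Fin 3)) :
    φ (arcEval l w f) = arcEval (fun i => PowerSeries.map (φ : R →+* S) (l i))
      (fun i => PowerSeries.map (φ : R →+* S) (w i)) f := by
  have : φ.comp (arcEval l w) = arcEval (fun i => PowerSeries.map (φ : R →+* S) (l i))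
      (fun i => PowerSeries.map (φ : R →+* S) (w i)) := by
    refine MvPolynomial.algHom_ext fun s => ?_
    rcases s with ⟨i, k⟩ | ⟨i, k⟩
    · rw [AlgHom.comp_apply, arcEval_inl, arcEval_inl, PowerSeries.coeff_map]; rfl
    · rw [AlgHom.comp_apply, arcEval_inr, arcEval_inr, PowerSeries.coeff_map]; rfl
  exact DFunLike.congr_fun this f

theorem arcEval_quadric {R : Type*} [CommRing R] [Algebra ℂ R] (l w : Fin 3 → PowerSeries R)
    (p : Fin 3 × ℕ) :
    arcEval l w (quadric p) = PowerSeries.coeff p.2 (arcInvariants l w p.1) := by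
  have hl (i : Fin 3) : PowerSeries.map (arcEval l w : Fock (Fin 3) →+* R) (betaArc i) = l i := by
    ext k
    rw [PowerSeries.coeff_map, betaArc, PowerSeries.coeff_mk]
    exact arcEval_inl l w i k
  have hw (i : Fin 3) : PowerSeries.map (arcEval l w : Fock (Fin 3) →+* R) (gammaArc i) = w i := by
    ext k
    rw [PowerSeries.coeff_map, gammaArc, PowerSeries.coeff_mk]
    exact arcEval_inr l w i k
  obtain ⟨i, k⟩ := p
  have h := PowerSeries.coeff_map (arcEval l w : Fock (Fin 3) →+* R) k
    (arcInvariants betaArc gammaArc i)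
  refine h.symm.trans (congrArg _ ?_)
  fin_cases i
  · change PowerSeries.map _ (betaNorm _) = betaNorm l
    simp only [betaNorm, map_add, map_mul, map_nsmul, hl]
  · change PowerSeries.map _ (arcPairing _ _) = arcPairing l w
    simp only [arcPairing, map_add, map_mul, hl, hw]
  · change PowerSeries.map _ (gammaNorm _) = gammaNorm w
    simp only [gammaNorm, map_add, map_mul, hw]

/-- Polynomials invariant under a current algebra element `A p(t)` are constant along
quadratic solution curves of its flow. -/
theorem arcEval_flow {A : Fin 3 → Fin 3 → ℂ} {f : Fock (Fin 3)}
    (hf : ∀ n, currentDerivation A n f = 0) (p : PowerSeries ℂ)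
    {l₀ l₁ l₂ w₀ w₁ w₂ : Fin 3 → PowerSeries ℂ}
    (hl₁ : ∀ i, l₁ i = p * ∑ j, A j i • l₀ j) (hl₂ : ∀ i, 2 • l₂ i = p * ∑ j, A j i • l₁ j)
    (hl₃ : ∀ i, p * ∑ j, A j i • l₂ j = 0)
    (hw₁ : ∀ i, w₁ i = -(p * ∑ j, A i j • w₀ j)) (hw₂ : ∀ i, 2 • w₂ i = -(p * ∑ j, A i j • w₁ j))
    (hw₃ : ∀ i, p * ∑ j, A i j • w₂ j = 0) :
    arcEval (l₀ + l₁ + l₂) (w₀ + w₁ + w₂) f = arcEval l₀ w₀ f := by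
  let T : Polynomial ℂ := Polynomial.X
  let path (v₀ v₁ v₂ : Fin 3 → PowerSeries ℂ) (x : Fin 3 × ℕ) : Polynomial ℂ :=
    Polynomial.C (PowerSeries.coeff x.2 (v₀ x.1)) +
      T * Polynomial.C (PowerSeries.coeff x.2 (v₁ x.1)) +
      T ^ 2 * Polynomial.C (PowerSeries.coeff x.2 (v₂ x.1))
  let φ : Fock (Fin 3) →ₐ[ℂ] Polynomial ℂ := aeval (Sum.elim (path l₀ l₁ l₂) (path w₀ w₁ w₂))
  have hφ (c : ℂ) (x y : Fin 3 → PowerSeries ℂ)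
      (hx : ∀ i, x i = l₀ i + c • l₁ i + c ^ 2 • l₂ i)
      (hy : ∀ i, y i = w₀ i + c • w₁ i + c ^ 2 • w₂ i) :
      Polynomial.aeval c (φ f) = arcEval x y f := by
    have : (Polynomial.aeval c).comp φ = arcEval x y := by
      refine MvPolynomial.algHom_ext fun s => ?_
      rcases s with ⟨i, k⟩ | ⟨i, k⟩
      · rw [arcEval_inl, hx]; simp [φ, path, T]; ring
      · rw [arcEval_inr, hy]; simp [φ, path, T]; ring
    exact DFunLike.congr_fun this f
  have hC : (Polynomial.C 2 : Polynomial ℂ) = 2 := map_ofNat _ 2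
  obtain ⟨N, hN⟩ := exists_index_bound f
  have hconv (m : ℕ) (hm : m < N) (g : ℕ → Polynomial ℂ) (v₀ v₁ v₂ : PowerSeries ℂ)
      (hg : ∀ k, g k = Polynomial.C (PowerSeries.coeff k v₀) +
        T * Polynomial.C (PowerSeries.coeff k v₁) + T ^ 2 * Polynomial.C (PowerSeries.coeff k v₂)) :
      ∑ n ∈ Finset.range N, PowerSeries.coeff n p • (if n ≤ m then g (m - n) else 0) =
      Polynomial.C (PowerSeries.coeff m (p * v₀)) + T * Polynomial.C (PowerSeries.coeff m (p * v₁)) +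
        T ^ 2 * Polynomial.C (PowerSeries.coeff m (p * v₂)) := by
    simp only [PowerSeries.coeff_mul, Finset.Nat.sum_antidiagonal_eq_sum_range_succ_mk, map_sum,
      Finset.mul_sum, ← Finset.sum_add_distrib, hg]
    obtain ⟨r, rfl⟩ := Nat.exists_eq_add_of_le hm
    rw [Finset.sum_range_add, Finset.sum_eq_zero (s := Finset.range r), add_zero]
    · refine Finset.sum_congr rfl fun n hn => ?_
      have hn' : n ≤ m := by simpa [Nat.lt_succ_iff] using hn
      rw [if_pos hn', Polynomial.smul_eq_C_mul]
      simp only [map_mul]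
      ring
    · intro n _
      rw [if_neg (by lia), smul_zero]
  -- Along the path v₀ + T v₁ + T² v₂ the velocity is the vector field ∑ pₙ A tⁿ; both sides are
  -- derivations over φ, so it is enough to compare them on the variables of f, whose indices are
  -- below N.
  have hder : Polynomial.derivative (φ f) = 0 := by
    let _ : Algebra (Fock (Fin 3)) (Polynomial ℂ) := φ.toAlgebra
    have : IsScalarTower ℂ (Fock (Fin 3)) (Polynomial ℂ) := IsScalarTower.of_algHom φ
    let D₁ : Derivation ℂ (Fock (Fin 3)) (Polynomial ℂ) :=
      Polynomial.derivative'.compAlgebraMap (Fock (Fin 3))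
    let D₂ : Derivation ℂ (Fock (Fin 3)) (Polynomial ℂ) :=
      (Algebra.linearMap (Fock (Fin 3)) (Polynomial ℂ)).compDer
        (∑ n ∈ Finset.range N, PowerSeries.coeff n p • currentDerivation A n)
    have h₁ (g) : D₁ g = Polynomial.derivative (φ g) := rfl
    have h₂ (g) : D₂ g = ∑ n ∈ Finset.range N, PowerSeries.coeff n p •
        φ (currentDerivation A n g) := by
      change φ ((∑ n ∈ Finset.range N, PowerSeries.coeff n p • currentDerivation A n) g) = _
      simp [derivation_sum_apply]
    have h : D₁ f = D₂ f := by
      refine derivation_eq_of_forall_mem_vars fun s hs => ?_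
      have hs' := hN s hs
      rw [h₁, h₂]
      rcases s with ⟨i, m⟩ | ⟨i, m⟩
      · simp only [Sum.elim_inl] at hs'
        have e (n : ℕ) : φ (currentDerivation A n (X (Sum.inl (i, m)))) =
            if n ≤ m then ∑ j, A j i • path l₀ l₁ l₂ (j, m - n) else 0 := by
          rw [currentDerivation_inl]
          split_ifs <;> simp [φ]
        simp only [e]
        rw [hconv m hs' (fun k => ∑ j, A j i • path l₀ l₁ l₂ (j, k)) (∑ j, A j i • l₀ j)
          (∑ j, A j i • l₁ j) (∑ j, A j i • l₂ j), ← hl₁, ← hl₂, hl₃]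
        · simp only [map_nsmul]
          simp [φ, path, T, hC]
          ring
        · intro k
          simp only [path, map_sum, Finset.mul_sum, ← Finset.sum_add_distrib]
          refine Finset.sum_congr rfl fun j _ => ?_
          simp [Polynomial.smul_eq_C_mul]
          ring
      · simp only [Sum.elim_inr] at hs'
        have e (n : ℕ) : φ (currentDerivation A n (X (Sum.inr (i, m)))) =
            if n ≤ m then -∑ j, A i j • path w₀ w₁ w₂ (j, m - n) else 0 := by
          rw [currentDerivation_inr]
          split_ifs <;> simp [φ]
        simp only [e]
        rw [hconv m hs' (fun k => -∑ j, A i j • path w₀ w₁ w₂ (j, k)) (-∑ j, A i j • w₀ j)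
          (-∑ j, A i j • w₁ j) (-∑ j, A i j • w₂ j), mul_neg, mul_neg, mul_neg, ← hw₁, ← hw₂, hw₃]
        · simp only [map_nsmul]
          simp [φ, path, T, hC]
          ring
        · intro k
          simp only [path, map_sum, map_neg, ← Finset.sum_neg_distrib, Finset.mul_sum,
            ← Finset.sum_add_distrib]
          refine Finset.sum_congr rfl fun j _ => ?_
          simp [Polynomial.smul_eq_C_mul]
          ring
    rw [← h₁, h, h₂]
    simp [hf]
  -- In characteristic zero a vanishing derivative means a constant, so the values at T = 1 and T =
  -- 0 agree.
  obtain ⟨c, hc⟩ :=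
    Polynomial.natDegree_eq_zero.1 (Polynomial.derivative_eq_zero.1 hder)
  rw [← hφ 1 (l₀ + l₁ + l₂) (w₀ + w₁ + w₂) (by simp) (by simp), ← hφ 0 l₀ w₀ (by simp) (by simp),
    ← hc]
  simp

/-- Hensel's lemma in the X-adic topology lifts a complex square root of the constant coefficient,
which is a simple root. -/
theorem exists_sq_eq {φ : PowerSeries ℂ} (h : PowerSeries.constantCoeff φ ≠ 0) :
    ∃ ψ : PowerSeries ℂ, ψ * ψ = φ ∧ PowerSeries.constantCoeff ψ ≠ 0 := by
  obtain ⟨c, hc⟩ := IsAlgClosed.exists_pow_nat_eq (PowerSeries.constantCoeff φ) (n := 2) (by simp)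
  have hc0 : c ≠ 0 := by rintro rfl; exact h (by simpa using hc.symm)
  have hH : HenselianRing (PowerSeries ℂ) (Ideal.span {PowerSeries.X}) := inferInstance
  obtain ⟨ψ, hψ, -⟩ := hH.is_henselian (Polynomial.X ^ 2 - Polynomial.C φ)
    (Polynomial.monic_X_pow_sub_C φ (by simp)) (PowerSeries.C c) (by
      rw [Ideal.mem_span_singleton, PowerSeries.X_dvd_iff]
      simp [hc]) (by
      refine IsUnit.map _ ?_
      rw [PowerSeries.isUnit_iff_constantCoeff]
      simp [hc0])
  have e : ψ * ψ = φ := by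
    have : ψ ^ 2 - φ = 0 := by simpa [Polynomial.IsRoot] using hψ
    rw [← pow_two]; linear_combination this
  refine ⟨ψ, e, fun h0 => h ?_⟩
  rw [← e, map_mul, h0, mul_zero]

end ArcEvaluation

/-! ### Normal forms of generic pairs of arcs under unipotent substitutions. -/

section NormalForm

variable {f : Fock (Fin 3)}

/-- Since (ad x)³ = 0, the exponential of p(t) x is quadratic in p; these are its coordinates on
both arcs. -/
theorem arcEval_unipotent_upper (hf : ∀ n, currentDerivation (adMatrix 1 0 0) n f = 0)
    (p : PowerSeries ℂ) (l w : Fin 3 → PowerSeries ℂ) :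
    arcEval ![l 0, l 1 + p * l 2 - p * p * l 0, l 2 - 2 * (p * l 0)]
      ![w 0 + 2 * (p * w 2) - p * p * w 1, w 1, w 2 - p * w 1] f = arcEval l w f := by
  have hC : (PowerSeries.C 2 : PowerSeries ℂ) = 2 := map_ofNat _ 2
  have := arcEval_flow hf p (l₀ := l) (l₁ := ![0, p * l 2, -(2 * (p * l 0))])
    (l₂ := ![0, -(p * p * l 0), 0]) (w₀ := w) (w₁ := ![2 * (p * w 2), 0, -(p * w 1)])
    (w₂ := ![-(p * p * w 1), 0, 0]) ?_ ?_ ?_ ?_ ?_ ?_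
  · rw [← this]
    refine congrArg₂ (fun l w => arcEval l w f) ?_ ?_ <;> ext1 i <;> fin_cases i <;>
      simp [-Matrix.add_cons, -Matrix.cons_add] <;> ring
  all_goals
    intro i
    fin_cases i <;> simp [Fin.sum_univ_three, adMatrix, PowerSeries.smul_eq_C_mul, hC] <;> ring

theorem arcEval_unipotent_lower (hf : ∀ n, currentDerivation (adMatrix 0 1 0) n f = 0)
    (p : PowerSeries ℂ) (l w : Fin 3 → PowerSeries ℂ) :
    arcEval ![l 0 - p * l 2 - p * p * l 1, l 1, l 2 + 2 * (p * l 1)]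
      ![w 0, w 1 - 2 * (p * w 2) - p * p * w 0, w 2 + p * w 0] f = arcEval l w f := by
  have hC : (PowerSeries.C 2 : PowerSeries ℂ) = 2 := map_ofNat _ 2
  have := arcEval_flow hf p (l₀ := l) (l₁ := ![-(p * l 2), 0, 2 * (p * l 1)])
    (l₂ := ![-(p * p * l 1), 0, 0]) (w₀ := w) (w₁ := ![0, -(2 * (p * w 2)), p * w 0])
    (w₂ := ![0, -(p * p * w 0), 0]) ?_ ?_ ?_ ?_ ?_ ?_
  · rw [← this]
    refine congrArg₂ (fun l w => arcEval l w f) ?_ ?_ <;> ext1 i <;> fin_cases i <;>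
      simp [-Matrix.add_cons, -Matrix.cons_add] <;> ring
  all_goals
    intro i
    fin_cases i <;> simp [Fin.sum_univ_three, adMatrix, PowerSeries.smul_eq_C_mul, hC] <;> ring

/-- Conjugating the second arc to the diagonal. -/
theorem exists_arcEval_eq_diagonal (hx : ∀ n, currentDerivation (adMatrix 1 0 0) n f = 0)
    (hy : ∀ n, currentDerivation (adMatrix 0 1 0) n f = 0) (l w : Fin 3 → PowerSeries ℂ)
    (hw : PowerSeries.constantCoeff (w 0) ≠ 0) {s : PowerSeries ℂ} (hs : s * s = gammaNorm w)
    (hs0 : PowerSeries.constantCoeff s ≠ 0) :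
    ∃ l' : Fin 3 → PowerSeries ℂ, betaNorm l' = betaNorm l ∧ l' 2 * s = arcPairing l w ∧
      arcEval l' ![0, 0, s] f = arcEval l w f := by
  have hw' := PowerSeries.mul_inv_cancel (w 0) hw
  have hs' := PowerSeries.mul_inv_cancel s hs0
  have hw0 : w 0 ≠ 0 := by intro h; simp [h] at hw
  have h2 : (2 : PowerSeries ℂ) * PowerSeries.C (1 / 2) = 1 := by
    rw [← map_ofNat PowerSeries.C, ← map_mul]
    simp
  -- The lower substitution with p turns w₂ into s, after which preservation of w₂² + w₀w₁ = s²
  -- forces the new w₁ to vanish. The upper one with p' = -w₀/(2s) then removes w₀.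
  set p := (s - w 2) * (w 0)⁻¹ with hp
  set p' := -(PowerSeries.C (1 / 2) * w 0 * s⁻¹) with hp'
  have e1 : p * w 0 = s - w 2 := by rw [hp]; linear_combination (s - w 2) * hw'
  have e2 : 2 * (p' * s) = -w 0 := by
    rw [hp']; linear_combination (-w 0 * (s * s⁻¹)) * h2 - w 0 * hs'
  have e3 : w 1 - 2 * (p * w 2) - p * p * w 0 = 0 := by
    refine (mul_eq_zero.1 (?_ : w 0 * _ = 0)).resolve_left hw0
    rw [gammaNorm] at hs
    linear_combination (-2 * w 2 - p * w 0 - (s - w 2)) * e1 - hs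
  set l₁ : Fin 3 → PowerSeries ℂ := ![l 0 - p * l 2 - p * p * l 1, l 1, l 2 + 2 * (p * l 1)]
    with hl₁
  have f1 := arcEval_unipotent_lower hy p l w
  rw [← hl₁, e3, show w 2 + p * w 0 = s by rw [e1]; ring] at f1
  have f2 := arcEval_unipotent_upper hx p' l₁ ![w 0, 0, s]
  rw [f1] at f2
  refine ⟨![l₁ 0, l₁ 1 + p' * l₁ 2 - p' * p' * l₁ 0, l₁ 2 - 2 * (p' * l₁ 0)], ?_, ?_, ?_⟩
  · simp [betaNorm, hl₁]
    ring
  · simp [arcPairing, hl₁]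
    linear_combination (-(l 0 - p * l 2 - p * p * l 1)) * e2 - l 2 * e1 - l 1 * e3 -
      2 * p * l 1 * e1
  · rw [← f2]
    refine congrArg₂ (fun l w => arcEval l w f) rfl ?_
    ext1 i
    fin_cases i <;> simp [e2]

theorem arcEval_diagonal (hx : ∀ n, currentDerivation (adMatrix 1 0 0) n f = 0)
    (hy : ∀ n, currentDerivation (adMatrix 0 1 0) n f = 0) (l : Fin 3 → PowerSeries ℂ)
    (s : PowerSeries ℂ) (h : PowerSeries.constantCoeff (l 1) ≠ 0) :
    arcEval l ![0, 0, s] f =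
      arcEval ![PowerSeries.C (1 / 4), betaNorm l - l 2 * l 2, -l 2] ![0, 0, -s] f := by
  -- The product of the upper, lower and upper substitutions with a, -1/a and a represents the Weyl
  -- element: it exchanges the first two coordinates up to scaling and negates the third. The new l₀
  -- is -l₁/a², so a² = -4 l₁ makes it 1/4.
  obtain ⟨a, ha, ha0⟩ := exists_sq_eq (φ := -(4 * l 1)) (by
    rw [map_neg, map_mul, map_ofNat]
    simpa using h)
  have hb := PowerSeries.mul_inv_cancel a ha0
  have h4 : (4 : PowerSeries ℂ) * PowerSeries.C 4⁻¹ = 1 := by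
    rw [← map_ofNat PowerSeries.C, ← map_mul]
    simp
  rw [← arcEval_unipotent_upper hx a l, ← arcEval_unipotent_lower hy (-a⁻¹),
    ← arcEval_unipotent_upper hx a]
  set b := a⁻¹
  have hl : -(l 1 * (b * b)) = PowerSeries.C 4⁻¹ := by
    linear_combination (l 1 * b * b) * h4 - b * b * PowerSeries.C 4⁻¹ * ha +
      PowerSeries.C 4⁻¹ * (a * b + 1) * hb
  refine congrArg₂ (fun l w => arcEval l w f) ?_ ?_ <;> ext1 i <;> fin_cases i <;>
    simp [betaNorm]
  · linear_combination hl + (l 0 * (a * b - 1) - b * l 2) * hb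
  · linear_combination ((a * b - 1) * (l 1 + a * l 2 - a * a * l 0) - a * l 2 +
      2 * a * a * l 0) * hb - l 0 * ha
  · linear_combination (-2 * l 2 + 4 * a * l 0 + 2 * b * (l 1 + a * l 2 - a * a * l 0)) * hb
  · linear_combination 2 * a * s * (a * b - 2) * hb
  · linear_combination -2 * b * s * hb
  · linear_combination 2 * s * (a * b - 1) * hb

/-- The value of an invariant polynomial at a generic pair of arcs only depends on the basic
invariants, up to the choice of a square root. -/
theorem arcEval_eq_normalForm (hx : ∀ n, currentDerivation (adMatrix 1 0 0) n f = 0)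
    (hy : ∀ n, currentDerivation (adMatrix 0 1 0) n f = 0) (l w : Fin 3 → PowerSeries ℂ)
    (hw : PowerSeries.constantCoeff (w 0) ≠ 0) {s e : PowerSeries ℂ} (hs : s * s = gammaNorm w)
    (he : e * s = arcPairing l w) (hs0 : PowerSeries.constantCoeff s ≠ 0)
    (hd : PowerSeries.constantCoeff (betaNorm l * gammaNorm w - arcPairing l w * arcPairing l w) ≠
      0) :
    arcEval l w f = arcEval ![PowerSeries.C (1 / 4), betaNorm l - e * e, e] ![0, 0, s] f := by
  have hs' : s ≠ 0 := by rintro rfl; simp at hs0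
  -- Diagonalising with -s compensates the sign that the Weyl element introduces. The discriminant
  -- hypothesis then makes l'₁ a unit.
  obtain ⟨l', h1, h2, h3⟩ := exists_arcEval_eq_diagonal hx hy l w hw (s := -s)
    (by rw [← hs]; ring) (by simpa using hs0)
  have hl : l' 2 = -e := by
    refine mul_right_cancel₀ hs' ?_
    linear_combination -h2 + he
  rw [← h3, arcEval_diagonal hx hy, h1, hl]
  · simp
  · intro h0
    refine hd ?_
    have : betaNorm l * gammaNorm w - arcPairing l w * arcPairing l w =
        l' 1 * (4 * l' 0 * gammaNorm w) := by
      rw [← h1, ← h2, ← hs, betaNorm]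
      ring
    rw [this, map_mul, h0, zero_mul]

end NormalForm

/-! ### Invariants of the current algebra -/

section EvenPart

/-- The polynomial ring in the coefficients of three power series. -/
abbrev ArcRing := MvPolynomial (Fin 3 × ℕ) ℂ

/-- The `i`-th generic power series. -/
def genericArc (i : Fin 3) : PowerSeries ArcRing := PowerSeries.mk fun k => X (i, k)

/-- The coefficients of `a`, `e s` and `s ^ 2`, for generic power series `a`, `e`, `s`. -/
def evenGenerator (x : Fin 3 × ℕ) : ArcRing :=
  PowerSeries.coeff x.2
    (![genericArc 0, genericArc 1 * genericArc 2, genericArc 2 * genericArc 2] x.1)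

/-- The subalgebra generated by the coefficients of `a`, `e s` and `s ^ 2`. -/
def evenSubalgebra : Subalgebra ℂ ArcRing := (aeval evenGenerator).range

theorem evenGenerator_mem (x : Fin 3 × ℕ) : evenGenerator x ∈ evenSubalgebra :=
  ⟨X x, by simp⟩

theorem evenGenerator_two_zero : evenGenerator (2, 0) = X (2, 0) * X (2, 0) := by
  simp [evenGenerator, genericArc]

/-- The elements that a power of the constant coefficient of `s ^ 2` carries into the subalgebra
generated by the coefficients of `a`, `e s` and `s ^ 2`. -/
def localizedEven : Subalgebra ℂ ArcRing where
  carrier := {h | ∃ m : ℕ, (X (2, 0) * X (2, 0)) ^ m * h ∈ evenSubalgebra}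
  mul_mem' := by
    rintro g h ⟨m, hm⟩ ⟨n, hn⟩
    refine ⟨m + n, ?_⟩
    convert mul_mem hm hn using 1
    ring
  add_mem' := by
    rintro g h ⟨m, hm⟩ ⟨n, hn⟩
    have hz : (X (2, 0) * X (2, 0) : ArcRing) ∈ evenSubalgebra :=
      evenGenerator_two_zero ▸ evenGenerator_mem _
    refine ⟨m + n, ?_⟩
    convert add_mem (mul_mem (pow_mem hz n) hm) (mul_mem (pow_mem hz m) hn) using 1
    ring
  algebraMap_mem' c := ⟨0, by simpa using evenSubalgebra.algebraMap_mem c⟩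

theorem mem_localizedEven_of_mul_mem {h : ArcRing}
    (hh : X (2, 0) * X (2, 0) * h ∈ localizedEven) : h ∈ localizedEven := by
  obtain ⟨m, hm⟩ := hh
  refine ⟨m + 1, ?_⟩
  convert hm using 1
  ring

theorem evenGenerator_mem_localizedEven (x : Fin 3 × ℕ) : evenGenerator x ∈ localizedEven :=
  ⟨0, by simpa using evenGenerator_mem x⟩

/-- The elements whose product with the constant coefficient of `s` lies in `localizedEven`. -/
def localizedOdd : Submodule ℂ ArcRing :=
  (Subalgebra.toSubmodule localizedEven).comap (LinearMap.mulLeft ℂ (X (2, 0)))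

theorem mem_localizedOdd {h : ArcRing} : h ∈ localizedOdd ↔ X (2, 0) * h ∈ localizedEven := Iff.rfl

theorem mul_mem_localizedOdd {g h : ArcRing} (hg : g ∈ localizedEven) (hh : h ∈ localizedOdd) :
    g * h ∈ localizedOdd := by
  rw [mem_localizedOdd] at *
  convert mul_mem hg hh using 1
  ring

/-- With s₀ the constant coefficient of s, s₀² g h = (s₀ g)(s₀ h), and the factor s₀² may be dropped
in `localizedEven`. -/
theorem odd_mul_odd_mem {g h : ArcRing} (hg : g ∈ localizedOdd) (hh : h ∈ localizedOdd) :
    g * h ∈ localizedEven := by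
  refine mem_localizedEven_of_mul_mem ?_
  convert mul_mem (mem_localizedOdd.1 hg) (mem_localizedOdd.1 hh) using 1
  ring

/-- The k-th coefficient of s² is 2 s₀ s_k plus products of earlier odd elements, for k > 0, which
solves recursively for s₀ s_k. The coefficients of es do the same for e. -/
theorem X_two_mem_localizedOdd (k : ℕ) : (X (2, k) : ArcRing) ∈ localizedOdd := by
  induction k using Nat.strong_induction_on with
  | _ k ih =>
    rcases Nat.eq_zero_or_pos k with rfl | hk
    · rw [mem_localizedOdd, ← evenGenerator_two_zero]
      exact evenGenerator_mem_localizedEven _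
    · obtain ⟨k, rfl⟩ := Nat.exists_eq_add_of_le' hk
      have h := evenGenerator_mem_localizedEven (2, k + 1)
      have e : evenGenerator (2, k + 1) = (2 : ℂ) • (X (2, 0) * X (2, k + 1)) +
          ∑ i ∈ Finset.range k, X (2, i + 1) * X (2, k - i) := by
        simp only [evenGenerator, genericArc]
        change PowerSeries.coeff (k + 1) (PowerSeries.mk (fun k => (X (2, k) : ArcRing)) *
          PowerSeries.mk (fun k => X (2, k))) = _
        rw [PowerSeries.coeff_mul, Finset.Nat.sum_antidiagonal_eq_sum_range_succ_mk,
          Finset.sum_range_succ', Finset.sum_range_succ]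
        simp only [PowerSeries.coeff_mk, Nat.sub_self, Nat.sub_zero, Nat.add_sub_add_right]
        rw [ofNat_smul_eq_nsmul ℂ 2]
        ring
      rw [e] at h
      have h' : ∑ i ∈ Finset.range k, (X (2, i + 1) * X (2, k - i) : ArcRing) ∈ localizedEven :=
        sum_mem fun i hi => odd_mul_odd_mem (ih _ (by simp at hi; lia)) (ih _ (by lia))
      have := Subalgebra.smul_mem _ ((add_mem_cancel_right h').1 h) (2⁻¹ : ℂ)
      rwa [inv_smul_smul₀ two_ne_zero] at this

theorem X_one_mem_localizedOdd (k : ℕ) : (X (1, k) : ArcRing) ∈ localizedOdd := by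
  induction k using Nat.strong_induction_on with
  | _ k ih =>
    have h := evenGenerator_mem_localizedEven (1, k)
    have e : evenGenerator (1, k) = X (2, 0) * X (1, k) +
        ∑ i ∈ Finset.range k, X (1, i) * X (2, k - i) := by
      simp only [evenGenerator, genericArc]
      change PowerSeries.coeff k (PowerSeries.mk (fun k => (X (1, k) : ArcRing)) *
        PowerSeries.mk (fun k => X (2, k))) = _
      rw [PowerSeries.coeff_mul, Finset.Nat.sum_antidiagonal_eq_sum_range_succ_mk,
        Finset.sum_range_succ]
      simp only [PowerSeries.coeff_mk, Nat.sub_self]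
      ring
    rw [e] at h
    exact (add_mem_cancel_right (sum_mem fun i hi =>
      odd_mul_odd_mem (ih _ (by simpa using hi)) (X_two_mem_localizedOdd _))).1 h

/-- The involution changing the signs of `e` and `s`. -/
def signInvolution : ArcRing →ₐ[ℂ] ArcRing :=
  aeval fun x => if x.1 = 0 then X x else -X x

/-- Both parities are carried through the induction because multiplying by a coefficient of e or s
exchanges them. The even half applies to the symmetrisation of a normal form value. -/
theorem signInvolution_parity (h : ArcRing) :
    h + signInvolution h ∈ localizedEven ∧ h - signInvolution h ∈ localizedOdd := by
  induction h using MvPolynomial.induction_on with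
  | C c =>
    have : signInvolution (C c) = C c := AlgHom.commutes _ c
    rw [this, sub_self]
    exact ⟨add_mem (localizedEven.algebraMap_mem c) (localizedEven.algebraMap_mem c), zero_mem _⟩
  | add p q hp hq =>
    rw [map_add, add_add_add_comm, add_sub_add_comm]
    exact ⟨add_mem hp.1 hq.1, add_mem hp.2 hq.2⟩
  | mul_X p x hp =>
    by_cases hx : x.1 = 0
    · have h0 : (X x : ArcRing) ∈ localizedEven := by
        convert evenGenerator_mem_localizedEven x using 1
        obtain ⟨i, k⟩ := x
        obtain rfl : i = 0 := hx
        simp [evenGenerator, genericArc]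
      have : signInvolution (X x) = X x := by simp [signInvolution, hx]
      rw [map_mul, this, ← add_mul, ← sub_mul, mul_comm (p - _)]
      exact ⟨mul_mem hp.1 h0, mul_mem_localizedOdd h0 hp.2⟩
    · have h1 : (X x : ArcRing) ∈ localizedOdd := by
        obtain ⟨i, k⟩ := x
        fin_cases i
        · exact absurd rfl hx
        · exact X_one_mem_localizedOdd k
        · exact X_two_mem_localizedOdd k
      have : signInvolution (X x) = -X x := by simp [signInvolution, hx]
      rw [map_mul, this, mul_neg, ← sub_eq_add_neg, sub_neg_eq_add, ← add_mul, ← sub_mul]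
      exact ⟨odd_mul_odd_mem hp.2 h1, mul_mem_localizedOdd hp.1 h1⟩

end EvenPart

/-! ### Descent from normal forms to the three basic invariants. -/

section Generic

/-- Evaluation at a triple of power series. -/
def evalArcs (v : Fin 3 → PowerSeries ℂ) : ArcRing →ₐ[ℂ] ℂ :=
  aeval fun x => PowerSeries.coeff x.2 (v x.1)

theorem map_evalArcs_genericArc (v : Fin 3 → PowerSeries ℂ) (i : Fin 3) :
    PowerSeries.map (evalArcs v : ArcRing →+* ℂ) (genericArc i) = v i := by
  ext k
  rw [PowerSeries.coeff_map, genericArc, PowerSeries.coeff_mk]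
  simp [evalArcs]

theorem evalArcs_evenGenerator (v : Fin 3 → PowerSeries ℂ) (F : ArcRing) :
    evalArcs v (aeval evenGenerator F) = evalArcs ![v 0, v 1 * v 2, v 2 * v 2] F := by
  have : (evalArcs v).comp (aeval evenGenerator) = evalArcs ![v 0, v 1 * v 2, v 2 * v 2] := by
    refine MvPolynomial.algHom_ext fun x => ?_
    rw [AlgHom.comp_apply, aeval_X]
    have h := PowerSeries.coeff_map (evalArcs v : ArcRing →+* ℂ) x.2
      (![genericArc 0, genericArc 1 * genericArc 2, genericArc 2 * genericArc 2] x.1)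
    refine h.symm.trans ?_
    obtain ⟨i, k⟩ := x
    refine Eq.trans ?_ (aeval_X _ _).symm
    refine congrArg _ ?_
    fin_cases i <;> simp [map_evalArcs_genericArc]
  exact DFunLike.congr_fun this F

theorem evalArcs_signInvolution (v : Fin 3 → PowerSeries ℂ) (F : ArcRing) :
    evalArcs v (signInvolution F) = evalArcs ![v 0, -v 1, -v 2] F := by
  have : (evalArcs v).comp signInvolution = evalArcs ![v 0, -v 1, -v 2] := by
    refine MvPolynomial.algHom_ext fun x => ?_
    obtain ⟨i, k⟩ := x
    fin_cases i <;> simp [evalArcs, signInvolution]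
  exact DFunLike.congr_fun this F

theorem arcEval_aeval_quadric (l w : Fin 3 → PowerSeries ℂ) (F : ArcRing) :
    arcEval l w (aeval quadric F) = evalArcs (arcInvariants l w) F := by
  have : (arcEval l w).comp (aeval quadric) = evalArcs (arcInvariants l w) := by
    refine MvPolynomial.algHom_ext fun x => ?_
    rw [AlgHom.comp_apply, aeval_X, arcEval_quadric, evalArcs, aeval_X]
  exact DFunLike.congr_fun this F

/-- The values of a polynomial on the normal forms of pairs of arcs. -/
def normalFormValue (f : Fock (Fin 3)) : ArcRing :=
  arcEval ![PowerSeries.C (C (1 / 4)), genericArc 0 - genericArc 1 * genericArc 1, genericArc 1]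
    ![0, 0, genericArc 2] f

theorem evalArcs_normalFormValue (v : Fin 3 → PowerSeries ℂ) (f : Fock (Fin 3)) :
    evalArcs v (normalFormValue f) =
      arcEval ![PowerSeries.C (1 / 4), v 0 - v 1 * v 1, v 1] ![0, 0, v 2] f := by
  rw [normalFormValue, map_arcEval]
  refine congrArg₂ (fun l w => arcEval l w f) ?_ ?_ <;> ext1 i <;> fin_cases i <;>
    simp [map_evalArcs_genericArc]

theorem arcEval_mk (x : (Fin 3 × ℕ) ⊕ (Fin 3 × ℕ) → ℂ) (f : Fock (Fin 3)) :
    arcEval (fun i => PowerSeries.mk fun k => x (Sum.inl (i, k)))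
      (fun i => PowerSeries.mk fun k => x (Sum.inr (i, k))) f = eval x f := by
  have : arcEval (fun i => PowerSeries.mk fun k => x (Sum.inl (i, k)))
      (fun i => PowerSeries.mk fun k => x (Sum.inr (i, k))) = aeval x := by
    refine MvPolynomial.algHom_ext fun s => ?_
    rcases s with ⟨i, k⟩ | ⟨i, k⟩
    · simp [arcEval_inl]
    · simp [arcEval_inr]
  rw [this]
  rfl

/-- A polynomial vanishing at all pairs of arcs is zero. -/
theorem eq_zero_of_arcEval {f : Fock (Fin 3)} (h : ∀ l w, arcEval l w f = (0 : ℂ)) : f = 0 :=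
  MvPolynomial.funext fun x => by rw [← arcEval_mk, h, map_zero]

theorem quadric_two_zero_ne_zero : quadric (2, 0) ≠ 0 := by
  intro h
  have := arcEval_quadric (R := ℂ) 0 ![0, 0, 1] (2, 0)
  rw [h, map_zero] at this
  simp [arcInvariants, gammaNorm] at this

variable {f : Fock (Fin 3)}

theorem exists_pow_quadric_mul_eq (hx : ∀ n, currentDerivation (adMatrix 1 0 0) n f = 0)
    (hy : ∀ n, currentDerivation (adMatrix 0 1 0) n f = 0) :
    ∃ (m : ℕ) (F : ArcRing), quadric (2, 0) ^ m * f = aeval quadric F := by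
  obtain ⟨m, F, hF⟩ := (signInvolution_parity (normalFormValue f)).1
  change aeval evenGenerator F = _ at hF
  -- D collects the genericity conditions of the normal form. An identity valid where D ≠ 0 becomes,
  -- after multiplication by D, an identity at all arcs, and D cancels in the domain.
  set D : Fock (Fin 3) := X (Sum.inr (0, 0)) * quadric (2, 0) *
    (quadric (0, 0) * quadric (2, 0) - quadric (1, 0) * quadric (1, 0)) with hD
  have evD (l w : Fin 3 → PowerSeries ℂ) : arcEval l w D = PowerSeries.constantCoeff (w 0) *
      PowerSeries.constantCoeff (gammaNorm w) * PowerSeries.constantCoeff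
        (betaNorm l * gammaNorm w - arcPairing l w * arcPairing l w) := by
    simp only [hD, map_mul, map_sub, arcEval_inr, arcEval_quadric, arcInvariants,
      PowerSeries.coeff_zero_eq_constantCoeff]
    rfl
  have hD0 : D ≠ 0 := by
    intro h
    have := evD ![1, 0, 0] ![1, 0, 1]
    rw [h, map_zero] at this
    simp [betaNorm, gammaNorm, arcPairing] at this
  clear_value D
  have key : D * (quadric (2, 0) ^ m * (2 * f) - aeval quadric F) = 0 := by
    refine eq_zero_of_arcEval fun l w => ?_
    rw [map_mul]
    by_cases h0 : arcEval l w D = (0 : ℂ)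
    · rw [h0, zero_mul]
    rw [evD] at h0
    have hw := left_ne_zero_of_mul (left_ne_zero_of_mul h0)
    have hc := right_ne_zero_of_mul (left_ne_zero_of_mul h0)
    have hd := right_ne_zero_of_mul h0
    obtain ⟨s, hs, hs0⟩ := exists_sq_eq hc
    have hs' := PowerSeries.mul_inv_cancel s hs0
    set e := arcPairing l w * s⁻¹ with he
    have he' : e * s = arcPairing l w := by rw [he, mul_assoc, mul_comm s⁻¹, hs', mul_one]
    have h1 := arcEval_eq_normalForm hx hy l w hw hs he' hs0 hd
    -- Both choices of square root give the same value of f, so symmetrising the normal form yields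
    -- 2f.
    have h2 := arcEval_eq_normalForm hx hy l w hw (s := -s) (e := -e) (by rw [neg_mul_neg, hs])
      (by rw [neg_mul_neg, he']) (by simpa using hs0) hd
    have h3 := congrArg (evalArcs ![betaNorm l, e, s]) hF
    rw [evalArcs_evenGenerator, map_mul, map_add, evalArcs_signInvolution,
      evalArcs_normalFormValue, evalArcs_normalFormValue] at h3
    simp only [Matrix.cons_val_zero, Matrix.cons_val_one, Matrix.cons_val] at h3
    rw [← h1, ← h2, hs, he', map_pow, map_mul] at h3
    have h4 : evalArcs ![betaNorm l, e, s] (X (2, 0)) * evalArcs ![betaNorm l, e, s] (X (2, 0)) =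
        arcEval l w (quadric (2, 0)) := by
      rw [arcEval_quadric]
      simp [evalArcs, arcInvariants, ← hs]
    rw [h4] at h3
    rw [map_sub, map_mul, map_mul, map_pow, arcEval_aeval_quadric, map_ofNat]
    have h5 : evalArcs (arcInvariants l w) F = _ := h3
    rw [h5]
    ring
  refine ⟨m, (1 / 2 : ℂ) • F, ?_⟩
  have h := sub_eq_zero.1 ((mul_eq_zero.1 key).resolve_left hD0)
  rw [map_smul, ← h, smul_eq_C_mul]
  have h2 : (C (1 / 2) : Fock (Fin 3)) * 2 = 1 := by
    rw [← map_ofNat C, ← map_mul]; simp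
  linear_combination (-(quadric (2, 0) ^ m * f)) * h2

theorem X_dvd_sub_aeval_update (s : Fin 3 × ℕ) (F : ArcRing) :
    X s ∣ F - aeval (Function.update X s 0) F := by
  induction F using MvPolynomial.induction_on with
  | C c => simp
  | add p q hp hq => rw [map_add, add_sub_add_comm]; exact dvd_add hp hq
  | mul_X p x hp =>
    rw [map_mul, aeval_X]
    by_cases h : x = s
    · subst h; simp
    · rw [Function.update_of_ne h, ← sub_mul]
      exact hp.mul_right _

/-- If m > 0, F vanishes at the invariants of every pair whose `quadric (2, 0)` is zero. These
values are dense in the hyperplane X(2,0) = 0, so X(2,0) divides F and one power cancels. -/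
theorem exists_eq_aeval_quadric_of_pow {m : ℕ} {F : ArcRing}
    (h : quadric (2, 0) ^ m * f = aeval quadric F) : ∃ F : ArcRing, f = aeval quadric F := by
  induction m generalizing F with
  | zero => exact ⟨F, by simpa using h⟩
  | succ m ih =>
    -- The factor X(0,0) restricts to points where a has a square root r.
    have h0 : X (0, 0) * aeval (Function.update X (2, 0) 0) F = (0 : ArcRing) := by
      refine MvPolynomial.funext fun x => ?_
      rw [map_mul, eval_X, map_zero]
      by_cases hx : x (0, 0) = 0
      · rw [hx, zero_mul]
      refine mul_eq_zero_of_right _ ?_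
      let a : PowerSeries ℂ := PowerSeries.mk fun k => x (0, k)
      let b : PowerSeries ℂ := PowerSeries.mk fun k => x (1, k)
      let c : PowerSeries ℂ := PowerSeries.mk fun k => if k = 0 then 0 else x (2, k)
      obtain ⟨r, hr, hr0⟩ := exists_sq_eq (φ := a) (by simpa [a] using hx)
      have hr' := PowerSeries.mul_inv_cancel r hr0
      -- With l = (0, 0, r) the pairing prescribes w₂ = b/r, and w₁ = 1 leaves w₀ free to adjust the
      -- last invariant to c.
      have hinv : arcInvariants ![0, 0, r] ![c - b * r⁻¹ * (b * r⁻¹), 1, b * r⁻¹] = ![a, b, c] := by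
        ext1 i
        fin_cases i
        · simp [arcInvariants, betaNorm, hr]
        · simp [arcInvariants, arcPairing]
          linear_combination b * hr'
        · simp [arcInvariants, gammaNorm]
      have hF : evalArcs ![a, b, c] F = 0 := by
        rw [← hinv, ← arcEval_aeval_quadric, ← h, map_mul, map_pow, arcEval_quadric, hinv]
        simp [c]
      rw [← hF]
      have : (aeval x : ArcRing →ₐ[ℂ] ℂ).comp (aeval (Function.update X (2, 0) 0)) =
          evalArcs ![a, b, c] := by
        refine MvPolynomial.algHom_ext fun s => ?_
        rw [AlgHom.comp_apply, aeval_X, evalArcs, aeval_X]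
        obtain ⟨i, k⟩ := s
        rw [Function.update_apply]
        fin_cases i
        · simp [a]
        · simp [b]
        · by_cases hk : k = 0 <;> simp [c, hk]
      exact DFunLike.congr_fun this F
    have h1 := (mul_eq_zero.1 h0).resolve_left (X_ne_zero _)
    have h2 := X_dvd_sub_aeval_update (2, 0) F
    rw [h1, sub_zero] at h2
    obtain ⟨F', rfl⟩ := h2
    refine ih (F := F') (mul_left_cancel₀ quadric_two_zero_ne_zero ?_)
    rw [map_mul, aeval_X] at h
    rw [← h]
    ring

/-- The invariants of the current algebra of `sl₂` in the polynomial functions on pairs of arcs are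
generated by the coefficients of the basic invariants. -/
theorem exists_eq_aeval_quadric (hf : ∀ p q r n, currentDerivation (adMatrix p q r) n f = 0) :
    ∃ F : ArcRing, f = aeval quadric F := by
  obtain ⟨m, F, h⟩ := exists_pow_quadric_mul_eq (hf 1 0 0) (hf 0 1 0)
  exact exists_eq_aeval_quadric_of_pow h

end Generic

/-! ### Strong generation -/

section StrongGeneration

theorem iterate_deriv_mode_neg_one {V : Type*} [AddCommGroup V] [Module ℂ V] (k : ℕ) (a : QO V) :
    (deriv^[k] a)[[-1]] = (k.factorial : ℂ) • a[[Int.negSucc k]] := by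
  induction k generalizing a with
  | zero => simp
  | succ k ih =>
    rw [Function.iterate_succ_apply, ih, deriv_mode, smul_smul, Nat.factorial_succ,
      show Int.negSucc k - 1 = Int.negSucc (k + 1) by simp only [Int.negSucc_eq]; push_cast; ring]
    congr 1
    rw [Int.negSucc_eq]
    push_cast
    ring

theorem IsQOA.iterate_deriv_mem {V : Type*} [AddCommGroup V] [Module ℂ V]
    {A : Submodule ℂ (QO V)} (hA : IsQOA A) {a : QO V} (ha : a ∈ A) (k : ℕ) :
    deriv^[k] a ∈ A := by
  induction k with
  | zero => exact ha
  | succ k ih => rw [Function.iterate_succ_apply']; exact hA.deriv_mem ih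

/-- The three strong generators. -/
abbrev strongGenerators : Set (QO (Fock (Fin 3))) := {vx, vy, vh}

theorem exists_strongGenerator (i : Fin 3) :
    ∃ v ∈ strongGenerators, ∃ c : ℂ, c ≠ 0 ∧ v = c • invariantField i := by
  fin_cases i
  · exact ⟨vy, by simp, (-2)⁻¹, by simp, (inv_smul_smul₀ (by simp) vy).symm⟩
  · exact ⟨vh, by simp, 1, one_ne_zero, (one_smul ℂ vh).symm⟩
  · exact ⟨vx, by simp, 2⁻¹, by simp, (inv_smul_smul₀ two_ne_zero vx).symm⟩

theorem strongGenerators_subset :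
    strongGenerators ⊆ commutant (thetaAlgebra sl2Basis) (system sl2Basis) := by
  have h2 : (2 : ℂ) ≠ 0 := two_ne_zero
  rintro _ (rfl | rfl | rfl)
  · exact (Submodule.smul_mem_iff _ h2).1 (invariantField_mem_commutant 2)
  · exact (Submodule.smul_mem_iff _ (neg_ne_zero.2 h2)).1 (invariantField_mem_commutant 0)
  · exact invariantField_mem_commutant 1

theorem span_wickMonomials_le_commutant : Submodule.span ℂ (wickMonomials strongGenerators) ≤
    commutant (thetaAlgebra sl2Basis) (system sl2Basis) :=
  (isVertexAlgebra_commutant sl2Basis _).toIsQOA.span_wickMonomials_le strongGenerators_subset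

/-- The Wick monomials have the monomials in the basic invariants as symbols. -/
theorem exists_wickMonomial {r : ℕ} {m : Fin 3 × ℕ →₀ ℕ} (hm : m.degree = r) :
    ∃ w ∈ wickMonomials strongGenerators, ∃ c : ℂ, c ≠ 0 ∧
      state 1 w - c • aeval quadric (monomial m (1 : ℂ)) ∈ degLT _ (2 * r) := by
  induction r generalizing m with
  | zero =>
    obtain rfl : m = 0 := (Finsupp.degree_eq_zero_iff m).1 hm
    refine ⟨one, ⟨[], by simp, rfl⟩, 1, one_ne_zero, ?_⟩
    rw [state_one, one_smul, ← C_apply, map_one, map_one, sub_self]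
    exact zero_mem _
  | succ r ih =>
    obtain ⟨⟨i, k⟩, hx⟩ : ∃ x, m x ≠ 0 := by
      by_contra! h
      have : m = 0 := Finsupp.ext h
      simp [this] at hm
    obtain ⟨m, rfl⟩ : ∃ m', m = m' + Finsupp.single (i, k) 1 :=
      ⟨m - Finsupp.single (i, k) 1, (tsub_add_cancel_of_le (by
        rw [Finsupp.single_le_iff]; lia)).symm⟩
    have hm' : m.degree = r := by simpa using hm
    obtain ⟨w, ⟨l, hl, rfl⟩, c₁, hc₁, hw⟩ := ih hm'
    obtain ⟨v, hv, c₂, hc₂, hvi⟩ := exists_strongGenerator i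
    set w := l.foldr (fun p b => wick (deriv^[p.1] p.2) b) one
    have hsys : IsQOA (system sl2Basis) := (isVertexAlgebra_system sl2Basis).toIsQOA
    have hwm : w ∈ system sl2Basis :=
      (span_wickMonomials_le_commutant (Submodule.subset_span ⟨l, hl, rfl⟩)).1
    have hvm : v ∈ system sl2Basis := (strongGenerators_subset hv).1
    -- The factor k! comes from (∂^k v)(-1) = k! v(-k-1), and c₂ from the normalisation of the
    -- generator.
    refine ⟨wick (deriv^[k] v) w, ⟨(k, v) :: l, ?_, rfl⟩, k.factorial * c₂ * c₁,
      mul_ne_zero (mul_ne_zero (Nat.cast_ne_zero.2 k.factorial_ne_zero) hc₂) hc₁, ?_⟩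
    · exact List.forall_mem_cons.2 ⟨hv, hl⟩
    rw [state_wick (system_le_creative _ (hsys.iterate_deriv_mem hvm k))
      (system_le_creative _ hwm), iterate_deriv_mode_neg_one, LinearMap.smul_apply]
    have hM : (aeval quadric (monomial m (1 : ℂ))).IsHomogeneous (2 * r) :=
      (isHomogeneous_monomial 1 hm').aeval quadric isHomogeneous_quadric
    have hg : state 1 w ∈ degLT _ (2 * r + 1) := by
      have := add_mem (degLT_mono (Nat.le_succ _) hw)
        (Submodule.smul_mem _ c₁ (IsHomogeneous.mem_degLT hM (Nat.lt_succ_self _)))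
      rwa [sub_add_cancel] at this
    have h1 := ((hasSymbol_invariantField i).smul c₂) k _ _ hg
    rw [← hvi] at h1
    have h2 := IsHomogeneous.mul_mem_degLT (isHomogeneous_quadric (i, k)) hw
    have h3 := Submodule.smul_mem _ (k.factorial : ℂ) (add_mem h1 (Submodule.smul_mem _ c₂ h2))
    rw [show 2 * (r + 1) = 2 * r + 1 + 1 by ring]
    convert h3 using 1
    rw [monomial_add_single, map_mul, map_pow, aeval_X, pow_one]
    simp only [Pi.smul_apply, smul_eq_C_mul, map_mul]
    ring

theorem exists_mem_span_wickMonomials {r : ℕ} {F : ArcRing} (hF : F.IsHomogeneous r) :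
    ∃ w ∈ Submodule.span ℂ (wickMonomials strongGenerators),
      state 1 w - aeval quadric F ∈ degLT _ (2 * r) := by
  have h (m : Fin 3 × ℕ →₀ ℕ) (hm : m ∈ F.support) :
      ∃ w ∈ Submodule.span ℂ (wickMonomials strongGenerators),
        state 1 w - aeval quadric (monomial m (F.coeff m)) ∈ degLT _ (2 * r) := by
    obtain ⟨w, hw, c₁, hc₁, h⟩ := exists_wickMonomial (m := m) (r := r) (by
      by_contra hne
      exact mem_support_iff.1 hm (hF.coeff_eq_zero hne))
    refine ⟨(F.coeff m * c₁⁻¹) • w, Submodule.smul_mem _ _ (Submodule.subset_span hw), ?_⟩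
    convert Submodule.smul_mem _ (F.coeff m * c₁⁻¹) h using 1
    rw [map_smul, smul_sub, smul_smul, mul_assoc, inv_mul_cancel₀ hc₁, mul_one,
      ← map_smul (aeval quadric), smul_monomial, smul_eq_mul, mul_one]
  choose! w hw h using h
  refine ⟨∑ m ∈ F.support, w m, sum_mem hw, ?_⟩
  conv => enter [2, 2]; rw [F.as_sum]
  rw [map_sum, map_sum, ← Finset.sum_sub_distrib]
  exact sum_mem h

/-- F need not be homogeneous, but its degree i part maps to degree 2i, so only parts with 2i = d
contribute and the others are approximated by zero. -/
theorem exists_mem_span_wickMonomials_of_aeval {d : ℕ} {F : ArcRing}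
    (hF : (aeval quadric F).IsHomogeneous d) :
    ∃ w ∈ Submodule.span ℂ (wickMonomials strongGenerators),
      state 1 w - aeval quadric F ∈ degLT _ d := by
  have h (i : ℕ) : ∃ w ∈ Submodule.span ℂ (wickMonomials strongGenerators),
      state 1 w - homogeneousComponent d (aeval quadric (homogeneousComponent i F)) ∈
        degLT _ d := by
    have hi := homogeneousComponent_isHomogeneous i F
    rw [homogeneousComponent_of_mem (hi.aeval quadric isHomogeneous_quadric)]
    split_ifs with hd
    · rw [hd]
      exact exists_mem_span_wickMonomials hi
    · exact ⟨0, zero_mem _, by simp⟩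
  choose w hw h using h
  refine ⟨∑ i ∈ Finset.range (F.totalDegree + 1), w i, sum_mem fun i _ => hw i, ?_⟩
  have e := homogeneousComponent_of_mem (m := d) hF
  rw [if_pos rfl] at e
  rw [← e]
  conv => enter [2, 2]; rw [← sum_homogeneousComponent F]
  rw [map_sum, map_sum, map_sum, ← Finset.sum_sub_distrib]
  exact sum_mem fun i _ => h i

/-- Every invariant vector is the state of a combination of Wick monomials. -/
theorem exists_state_eq {d : ℕ} {f : Fock (Fin 3)} (hd : f ∈ degLT _ d)
    (hf : ∀ (p q r : ℂ) (n : ℕ),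
      currentDerivation (adMatrix p q r) n f + contraction (adMatrix p q r) n f = 0) :
    ∃ w ∈ Submodule.span ℂ (wickMonomials strongGenerators), state 1 w = f := by
  induction d generalizing f with
  | zero => exact ⟨0, zero_mem _, by rw [map_zero, degLT_zero hd]⟩
  | succ d ih =>
    -- Match the leading term by Wick monomials. Their combination is itself in the commutant, so
    -- the difference is again an invariant vector, of smaller degree.
    obtain ⟨F, hF⟩ := exists_eq_aeval_quadric fun p q r n =>
      currentDerivation_homogeneousComponent (adMatrix p q r) n hd (hf p q r n)
    obtain ⟨w, hw, hwd⟩ := exists_mem_span_wickMonomials_of_aeval (d := d) (F := F)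
      (hF ▸ homogeneousComponent_isHomogeneous d f)
    rw [← hF] at hwd
    have hwc := span_wickMonomials_le_commutant hw
    have hwf := (mem_commutant_iff hwc.1).1 hwc
    obtain ⟨w', hw', h⟩ := ih (f := f - state 1 w) (by
      have := sub_mem (sub_homogeneousComponent_mem_degLT hd) hwd
      rwa [sub_sub_sub_cancel_right] at this) (fun p q r n => by
      have hc : contraction (adMatrix p q r) n (f - state 1 w) =
          contraction (adMatrix p q r) n f - contraction (adMatrix p q r) n (state 1 w) := by
        simp only [contraction, map_sub, smul_sub, Finset.sum_sub_distrib]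
      rw [map_sub, hc, sub_add_sub_comm, hf, hwf, sub_zero])
    exact ⟨w' + w, add_mem hw' hw, by rw [map_add, h, sub_add_cancel]⟩

theorem commutant_le_span_wickMonomials :
    commutant (thetaAlgebra sl2Basis) (system sl2Basis) ≤
      Submodule.span ℂ (wickMonomials strongGenerators) := by
  intro v hv
  obtain ⟨d, hd⟩ := exists_mem_degLT (state 1 v)
  obtain ⟨w, hw, h⟩ := exists_state_eq hd ((mem_commutant_iff hv.1).1 hv)
  have := eq_zero_of_state_eq_zero sl2Basis
    (sub_mem hv.1 (span_wickMonomials_le_commutant hw).1) (by rw [map_sub, h, sub_self])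
  rwa [sub_eq_zero.1 this]

end StrongGeneration

end BetaGamma

end

theorem theorem7p2 :
    BetaGamma.IsVertexAlgebra
        (BetaGamma.commutant (BetaGamma.thetaAlgebra BetaGamma.sl2Basis)
          (BetaGamma.system BetaGamma.sl2Basis)) ∧
      (BetaGamma.commutant (BetaGamma.thetaAlgebra BetaGamma.sl2Basis)
          (BetaGamma.system BetaGamma.sl2Basis) : Set (BetaGamma.QO (BetaGamma.Fock (Fin 3)))) =
        BetaGamma.currentInvariants BetaGamma.sl2Basis ∧
      BetaGamma.StronglyGenerates {BetaGamma.vx, BetaGamma.vy, BetaGamma.vh}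
        (BetaGamma.commutant (BetaGamma.thetaAlgebra BetaGamma.sl2Basis)
          (BetaGamma.system BetaGamma.sl2Basis)) :=
  ⟨BetaGamma.isVertexAlgebra_commutant _ _, BetaGamma.coe_commutant_eq_currentInvariants _,
    BetaGamma.strongGenerators_subset,
    le_antisymm BetaGamma.span_wickMonomials_le_commutant
      BetaGamma.commutant_le_span_wickMonomials⟩
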